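/- **Setting.** Let $A\neq 0$ be a unital C*-algebra and let $\mathcal A\subseteq A$ be a dense unital $*$-subalgebra. *Spectral triples.* An (odd) spectral triple $(\mathcal A,H,D)$ on $A$ consists of such an $\mathcal A$, a unital representation $\pi:A\to\mathbb B(H)$ on a Hilbert space and a densely defined self-adjoint operator $D$ on $H$ such that $(1+D^2)^{-1/2}$ is compact and, for all $a\in\mathcal A$, $\pi(a)\operatorname{Dom}D\subseteq\operatorname{Dom}D$ and $[D,\pi(a)]$ extends to a bounded operator. It is even if there is in addition a self-adjoint $\chi\in\mathbb B(H)$ with $\chi^2=1$, $\chi\pi(a)=\pi(a)\chi$ for all $a\in A$, $\chi\operatorname{Dom}D\subseteq\operatorname{Dom}D$ and $D\chi=-\chi D$; then $H=H^+\oplus H^-$, $\pi=\pi^+\oplus\pi^-$ and $D=\begin{pmatrix}0&D^-\\D^+&0\end{pmatrix}$. It is non-degenerate if $\pi$ is faithful and, for $a\in\mathcal A$, $[D,\pi(a)]=0$ if and only if $a\in\mathbb C1$. Put $\zeta_D(t)=\operatorname{Tr}((1+D^2)^{-t/2})$; the triple is finitely summable if $\zeta_D(t)<\infty$ for some $t>0$,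 and then $\operatorname{abs}(\zeta_D)=\inf\{t>0:\zeta_D(t)<\infty\}$. *Twisted actions.* Let $G$ be a discrete group and $(\rho,\sigma)$ a twisted action of $G$ on $A$: maps $\rho:G\to\operatorname{Aut}(A)$ and $\sigma:G\times G\to U(A)$ with $\rho_x(\sigma_{y,z})=\sigma_{x,y}\sigma_{xy,z}\sigma_{x,yz}^*$, $\rho_x\rho_y=\operatorname{Ad}(\sigma_{x,y})\rho_{xy}$, $\sigma_{x,e}=\sigma_{e,x}=1$ and $\rho_e=\operatorname{id}$. For a representation $\pi$ of $A$ on $H$, the left regular representation of the finitely supported functions $C_c(G,A)$ on $H\otimes\ell^2(G)$ is $$\Pi_\pi(a\delta_x)(\xi\otimes\delta_y)=\pi(\rho_{y^{-1}x^{-1}}(a)\sigma_{y^{-1}x^{-1},x})\xi\otimes\delta_{xy}.$$ For faithful $\pi$ the reduced twisted crossed product $A\rtimes_r^{\rho,\sigma}G$ is the norm closure of $\Pi_\pi(C_c(G,A))$. The action is smooth if it restricts to $\mathcal A$, i.e. $\rho_x(\mathcal A)=\mathcal A$ and $\sigma_{x,y}\in\mathcal A$ for all $x,y\in G$; then $C_c(G,\mathcal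 A)$ is a $*$-subalgebra of $A\rtimes_r^{\rho,\sigma}G$. *Length functions.* Let $V\ne0$ be a finite dimensional complex Hilbert space and $\ell:G\to\mathbb B_h(V)$ a map into the self-adjoint operators. It is translation bounded if $x\mapsto\ell(x)-\ell(y^{-1}x)$ is bounded for every $y\in G$. It is proper if $\ell(g)=0$ exactly for $g=e$, the set $\mathcal S=\bigcup_{x}\operatorname{Sp}\ell(x)$ has no accumulation point in $\mathbb R$, and for every $t\in\mathcal S$ there are only finitely many $x$ with $t\in\operatorname{Sp}\ell(x)$. Let $M_\ell(\delta_x\otimes v)=\delta_x\otimes\ell(x)v$ on $\ell^2(G)\otimes V$ and $B_n=\{g\in G:\min\operatorname{Sp}|\ell(g)|\le n\}$. $G$ has polynomial growth with respect to $\ell$ if $\#B_n$ grows at most polynomially, and then $d_G=\limsup_n\frac{\log\#B_n}{\log n}$. **Theorem.** Let $(\mathcal A,H,D)$ be a spectral triple on $A$ with faithful representation $\pi$, $(\rho,\sigma)$ a smooth twisted action of $G$ on $A$ with $$\sup_{x\in G}\|[D,\pi(\rho_x(a)\sigma_{x,y})]\|<\infty\qquad(a\in\mathcal A,\ y\in G),$$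 and $\ell:G\to\mathbb B_h(V)$ proper and translation bounded. (1a) If the triple is odd, then $(C_c(G,\mathcal A),\widetilde H,\widetilde D)$ with $\widetilde H=(H\otimes\ell^2(G)\otimes V)\oplus(H\otimes\ell^2(G)\otimes V)$, representation $\Pi\oplus\Pi$, where $\Pi$ is the extension of $\Pi_{\pi\otimes1_V}$ to $A\rtimes_r^{\rho,\sigma}G$, grading $1\oplus(-1)$ and $$\widetilde D=\begin{pmatrix}0&D\otimes1\otimes1-i\,1\otimes M_\ell\\D\otimes1\otimes1+i\,1\otimes M_\ell&0\end{pmatrix}$$ is an even spectral triple on $A\rtimes_r^{\rho,\sigma}G$. It is non-degenerate if $(\mathcal A,H,D)$ is. (1b) If the triple is even, then $(C_c(G,\mathcal A),\widetilde H,\widetilde D)$ with $\widetilde H=(H^+\otimes\ell^2(G)\otimes V)\oplus(H^-\otimes\ell^2(G)\otimes V)$, the representation of $A\rtimes_r^{\rho,\sigma}G$ which extends $\Pi_{\pi^+\otimes1_V}\oplus\Pi_{\pi^-\otimes1_V}$ and $$\widetilde D=\begin{pmatrix}1\otimes M_\ell&D^-\otimes1\otimes1\\D^+\otimes1\otimes1&-1\otimes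 M_\ell\end{pmatrix}$$ is an odd spectral triple on $A\rtimes_r^{\rho,\sigma}G$. It is non-degenerate if $(\mathcal A,H,D)$ is. (2) In both cases, if $(\mathcal A,H,D)$ is finitely summable and $G$ has polynomial growth with respect to $\ell$, then the new triple is finitely summable and $$\operatorname{abs}(\zeta_{\widetilde D})\le\operatorname{abs}(\zeta_D)+d_G,$$ with equality if $\lim_n\frac{\log\#B_n}{\log n}$ exists. -/

import Mathlib

open scoped TensorProduct ENNReal
open Filter Topology

noncomputable section

namespace TwistedTriple

/-! ### Unbounded operators, resolvents and traces -/

section Operators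

variable {H : Type*} [NormedAddCommGroup H] [InnerProductSpace ℂ H]

/-- The bounded operator `S` maps the domain of `D` to itself and the commutator `[D, S]`, defined
on the domain of `D`, is the restriction of the bounded operator `T`. -/
def IsCommutator (D : H →ₗ.[ℂ] H) (S T : H →L[ℂ] H) : Prop :=
  ∀ ξ : D.domain, ∃ h : S ξ ∈ D.domain, D ⟨S ξ, h⟩ - S (D ξ) = T ξ

/-- `R` is the bounded inverse of `1 + D²`: for every `η`, the vector `R η` lies in the domain of
`D`, its image `D (R η)` lies in the domain of `D`, and `R η + D (D (R η)) = η`. -/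
def IsInvOneAddSq (D : H →ₗ.[ℂ] H) (R : H →L[ℂ] H) : Prop :=
  ∀ η : H, ∃ ζ : H, (R η, ζ) ∈ D.graph ∧ (ζ, η - R η) ∈ D.graph

open Classical in
/-- The bounded operator `(1 + D²)⁻¹`; it exists for each self-adjoint `D`, see
`isInvOneAddSq_invOneAddSq`. -/
def invOneAddSq (D : H →ₗ.[ℂ] H) : H →L[ℂ] H :=
  if h : ∃ R, IsInvOneAddSq D R then h.choose else 0

theorem isInvOneAddSq_invOneAddSq [CompleteSpace H] {D : H →ₗ.[ℂ] H} (hD : IsSelfAdjoint D) :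
    IsInvOneAddSq D (invOneAddSq D) := by
  suffices h : ∃ R, IsInvOneAddSq D R by
    rw [invOneAddSq, dif_pos h]
    exact h.choose_spec
  let e := WithLp.prodContinuousLinearEquiv 2 ℂ H H
  let Γ : Submodule ℂ (WithLp 2 (H × H)) := D.graph.comap (e : WithLp 2 (H × H) →ₗ[ℂ] H × H)
  have hcl : IsClosed (Γ : Set (WithLp 2 (H × H))) := hD.isClosed.preimage e.continuous
  have : CompleteSpace Γ := hcl.completeSpace_coe
  refine ⟨(ContinuousLinearMap.fst ℂ H H) ∘L (e : WithLp 2 (H × H) →L[ℂ] H × H) ∘L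
    Γ.starProjection ∘L (e.symm : H × H →L[ℂ] WithLp 2 (H × H)) ∘L
    (ContinuousLinearMap.inl ℂ H H), fun η => ?_⟩
  set p : WithLp 2 (H × H) := Γ.starProjection (e.symm (η, 0)) with hp
  have hpΓ : (p.fst, p.snd) ∈ D.graph := by
    have : p ∈ Γ := Submodule.starProjection_apply_mem Γ _
    exact this
  refine ⟨p.snd, hpΓ, ?_⟩
  change (p.snd, η - p.fst) ∈ D.graph
  have horth : e.symm (η, 0) - p ∈ Γᗮ := Submodule.sub_starProjection_mem_orthogonal _
  have hgr : D.graph = D.graph.adjoint := by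
    conv_lhs => rw [← LinearPMap.isSelfAdjoint_def.mp hD]
    exact LinearPMap.adjoint_graph_eq_graph_adjoint hD.dense_domain
  rw [hgr, Submodule.mem_adjoint_iff]
  intro a b hab
  have h1 := horth (e.symm (a, b)) hab
  rw [WithLp.prod_inner_apply] at h1
  change inner ℂ a (η - p.fst) + inner ℂ b (0 - p.snd) = 0 at h1
  rw [zero_sub, inner_neg_right] at h1
  change inner ℂ b p.snd - inner ℂ a (η - p.fst) = 0
  linear_combination -h1

/-- The trace of a positive bounded operator, `∑ᵢ ⟨bᵢ, T bᵢ⟩ ∈ [0, ∞]` along a Hilbert basis; for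
positive `T` it does not depend on the basis. -/
def posTrace [CompleteSpace H] (T : H →L[ℂ] H) : ℝ≥0∞ :=
  let b := (exists_hilbertBasis ℂ H).choose_spec.choose
  ∑' i, ENNReal.ofReal (inner ℂ (b i) (T (b i))).re

/-- `ζ_D(t) = Tr ((1 + D²)^(-t/2)) ∈ [0, ∞]`. -/
def zeta [CompleteSpace H] (D : H →ₗ.[ℂ] H) (t : ℝ) : ℝ≥0∞ :=
  posTrace (invOneAddSq D ^ (t / 2))

/-- Finite summability. For complex `t` the operator `(1 + D²)^(-t/2)` is trace class if and only
if `(1 + D²)^(-Re t/2)` is, so that it is enough to look at real exponents; and if a non-positive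
exponent is a summability exponent, then `H` is finite dimensional and so is any positive one. -/
def FinitelySummable [CompleteSpace H] (D : H →ₗ.[ℂ] H) : Prop :=
  ∃ t : ℝ, 0 < t ∧ zeta D t < ∞

/-- The abscissa of convergence of `ζ_D`. -/
def abscissa [CompleteSpace H] (D : H →ₗ.[ℂ] H) : ℝ :=
  sInf {t : ℝ | 0 < t ∧ zeta D t < ∞}

end Operators

/-! ### Spectral triples -/

section Triples

variable {A : Type*} [CStarAlgebra A]
  {H : Type*} [NormedAddCommGroup H] [InnerProductSpace ℂ H] [CompleteSpace H]

/-- `(𝒜, H, D)` is an (odd) spectral triple on the C*-algebra `A`, with representation `π`. -/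
structure IsSpectralTriple (𝒜 : StarSubalgebra ℂ A) (π : A →⋆ₐ[ℂ] (H →L[ℂ] H))
    (D : H →ₗ.[ℂ] H) : Prop where
  dense : Dense (𝒜 : Set A)
  dense_domain : Dense (D.domain : Set H)
  isSelfAdjoint : IsSelfAdjoint D
  compact : IsCompactOperator (invOneAddSq D ^ (1 / 2 : ℝ))
  commutator : ∀ a ∈ 𝒜, ∃ T : H →L[ℂ] H, IsCommutator D (π a) T

/-- `(𝒜, H, D)` is an even spectral triple with grading operator `χ`. -/
structure IsEvenSpectralTriple (𝒜 : StarSubalgebra ℂ A) (π : A →⋆ₐ[ℂ] (H →L[ℂ] H))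
    (D : H →ₗ.[ℂ] H) (χ : H →L[ℂ] H) : Prop extends IsSpectralTriple 𝒜 π D where
  grading_selfAdjoint : IsSelfAdjoint χ
  grading_sq : χ * χ = 1
  grading_comm : ∀ a : A, π a * χ = χ * π a
  grading_anticomm : ∀ ξ : D.domain, ∃ h : χ ξ ∈ D.domain, D ⟨χ ξ, h⟩ = -χ (D ξ)

/-- Non-degeneracy: `π` is faithful and `[D, π(a)] = 0` exactly for the scalars `a ∈ 𝒜`. -/
def IsNondegenerate (𝒜 : StarSubalgebra ℂ A) (π : A →⋆ₐ[ℂ] (H →L[ℂ] H))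
    (D : H →ₗ.[ℂ] H) : Prop :=
  Function.Injective π ∧
    ∀ a ∈ 𝒜, IsCommutator D (π a) 0 ↔ ∃ c : ℂ, a = algebraMap ℂ A c

end Triples

/-! ### Direct sums of two Hilbert spaces -/

section DirectSum

variable {E F : Type*} [NormedAddCommGroup E] [InnerProductSpace ℂ E]
  [NormedAddCommGroup F] [InnerProductSpace ℂ F]

/-- The bounded operator `S ⊕ T` on the Hilbert space `E ⊕ F`. -/
def dsum (S : E →L[ℂ] E) (T : F →L[ℂ] F) : WithLp 2 (E × F) →L[ℂ] WithLp 2 (E × F) :=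
  ((WithLp.prodContinuousLinearEquiv 2 ℂ E F).symm : E × F →L[ℂ] WithLp 2 (E × F)) ∘L
    (S.prodMap T) ∘L (WithLp.prodContinuousLinearEquiv 2 ℂ E F : WithLp 2 (E × F) →L[ℂ] E × F)

/-- The representation `π₁ ⊕ π₂` on `E ⊕ F`. -/
def repSum {A : Type*} [CStarAlgebra A] [CompleteSpace E] [CompleteSpace F]
    (π₁ : A →⋆ₐ[ℂ] (E →L[ℂ] E)) (π₂ : A →⋆ₐ[ℂ] (F →L[ℂ] F)) :
    A →⋆ₐ[ℂ] (WithLp 2 (E × F) →L[ℂ] WithLp 2 (E × F)) where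
  toFun a := dsum (π₁ a) (π₂ a)
  map_one' := by rw [map_one, map_one]; rfl
  map_mul' a b := by rw [map_mul, map_mul]; rfl
  map_zero' := by rw [map_zero, map_zero]; rfl
  map_add' a b := by rw [map_add, map_add]; rfl
  commutes' c := by rw [AlgHomClass.commutes, AlgHomClass.commutes]; rfl
  map_star' a := by
    rw [map_star, map_star, ContinuousLinearMap.star_eq_adjoint, ContinuousLinearMap.star_eq_adjoint,
      ContinuousLinearMap.star_eq_adjoint, ContinuousLinearMap.eq_adjoint_iff]
    intro x y
    rw [WithLp.prod_inner_apply, WithLp.prod_inner_apply]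
    change inner ℂ (ContinuousLinearMap.adjoint (π₁ a) x.fst) y.fst
        + inner ℂ (ContinuousLinearMap.adjoint (π₂ a) x.snd) y.snd
      = inner ℂ x.fst (π₁ a y.fst) + inner ℂ x.snd (π₂ a y.snd)
    rw [ContinuousLinearMap.adjoint_inner_left, ContinuousLinearMap.adjoint_inner_left]

/-- The domain `(dom a ∩ dom c) ⊕ (dom b ∩ dom d)` of the block matrix `(a b; c d)`. -/
def blockDomain (a : E →ₗ.[ℂ] E) (b : F →ₗ.[ℂ] E) (c : E →ₗ.[ℂ] F) (d : F →ₗ.[ℂ] F) :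
    Submodule ℂ (WithLp 2 (E × F)) :=
  ((a.domain ⊓ c.domain).prod (b.domain ⊓ d.domain)).comap
    (WithLp.linearEquiv 2 ℂ (E × F) : WithLp 2 (E × F) →ₗ[ℂ] E × F)

/-- The unbounded operator on `E ⊕ F` with block matrix `(a b; c d)`, that is
`(ξ, η) ↦ (a ξ + b η, c ξ + d η)`, on its natural domain. -/
def blockOp (a : E →ₗ.[ℂ] E) (b : F →ₗ.[ℂ] E) (c : E →ₗ.[ℂ] F) (d : F →ₗ.[ℂ] F) :
    WithLp 2 (E × F) →ₗ.[ℂ] WithLp 2 (E × F) :=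
  let p : blockDomain a b c d →ₗ[ℂ] E × F :=
    (WithLp.linearEquiv 2 ℂ (E × F) : WithLp 2 (E × F) →ₗ[ℂ] E × F).domRestrict _
  let p₁ := LinearMap.fst ℂ E F ∘ₗ p
  let p₂ := LinearMap.snd ℂ E F ∘ₗ p
  { domain := blockDomain a b c d
    toFun := ((WithLp.linearEquiv 2 ℂ (E × F)).symm : E × F →ₗ[ℂ] WithLp 2 (E × F)) ∘ₗ
      ((a.toFun ∘ₗ p₁.codRestrict a.domain fun x => x.2.1.1)
        + b.toFun ∘ₗ p₂.codRestrict b.domain fun x => x.2.2.1).prod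
      ((c.toFun ∘ₗ p₁.codRestrict c.domain fun x => x.2.1.2)
        + d.toFun ∘ₗ p₂.codRestrict d.domain fun x => x.2.2.2) }

end DirectSum

/-! ### Tensoring with a finite dimensional Hilbert space -/

section Tensor

variable {H : Type*} [NormedAddCommGroup H] [InnerProductSpace ℂ H]
  (V : Type*) [NormedAddCommGroup V] [InnerProductSpace ℂ V]

/-- As `V` is finite dimensional, the algebraic tensor product `H ⊗ V` is a Hilbert space. -/
instance completeSpace_tensor [CompleteSpace H] [FiniteDimensional ℂ V] :
    CompleteSpace (H ⊗[ℂ] V) := by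
  let b := stdOrthonormalBasis ℂ V
  let n := Module.finrank ℂ V
  let f : (Fin n → H) →L[ℂ] H ⊗[ℂ] V :=
    ∑ i, ((TensorProduct.mkL ℂ H V).flip (b i)) ∘L ContinuousLinearMap.proj i
  let g : H ⊗[ℂ] V →L[ℂ] (Fin n → H) := ContinuousLinearMap.pi fun i =>
    ((TensorProduct.ridIsometry ℂ H).toContinuousLinearEquiv : H ⊗[ℂ] ℂ →L[ℂ] H) ∘L
      (ContinuousLinearMap.lTensor H (innerSL ℂ (b i)))
  have hgf : Function.LeftInverse g f := by
    intro x
    ext i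
    simp [f, g, b.inner_eq_ite, Finset.sum_ite_eq]
  have hfg : Function.RightInverse g f := by
    intro x
    induction x using TensorProduct.induction_on with
    | zero => simp
    | add x y hx hy => rw [map_add, map_add, hx, hy]
    | tmul h v =>
      conv_rhs => rw [← b.sum_repr' v]
      simp [f, g, TensorProduct.tmul_sum]
  let e : (Fin n → H) ≃L[ℂ] H ⊗[ℂ] V := ContinuousLinearEquiv.equivOfInverse f g hgf hfg
  exact (completeSpace_congr (e := e.toEquiv) e.isUniformEmbedding).mp inferInstance

/-- The amplification `π ⊗ 1_V` of a representation. -/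
def ampl {A : Type*} [CStarAlgebra A] [CompleteSpace H] [FiniteDimensional ℂ V] [CompleteSpace V]
    (π : A →⋆ₐ[ℂ] (H →L[ℂ] H)) : A →⋆ₐ[ℂ] (H ⊗[ℂ] V →L[ℂ] H ⊗[ℂ] V) where
  toFun a := (π a).rTensor V
  map_one' := by simp
  map_mul' a b := by rw [map_mul, ContinuousLinearMap.rTensor_mul]
  map_zero' := by simp
  map_add' a b := by simp
  commutes' c := by
    rw [AlgHomClass.commutes, Algebra.algebraMap_eq_smul_one, Algebra.algebraMap_eq_smul_one]
    simp
  map_star' a := by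
    rw [map_star, ContinuousLinearMap.star_eq_adjoint, ContinuousLinearMap.star_eq_adjoint,
      ContinuousLinearMap.adjoint_rTensor]

/-- The unbounded operator `D ⊗ 1_V` with domain `dom D ⊗ V`, given by its graph. -/
def tensorOp {K : Type*} [NormedAddCommGroup K] [InnerProductSpace ℂ K] (D : H →ₗ.[ℂ] K) :
    H ⊗[ℂ] V →ₗ.[ℂ] K ⊗[ℂ] V :=
  (Submodule.span ℂ {p : (H ⊗[ℂ] V) × (K ⊗[ℂ] V) |
    ∃ (ξ : D.domain) (v : V), p = ((ξ : H) ⊗ₜ[ℂ] v, D ξ ⊗ₜ[ℂ] v)}).toLinearPMap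

end Tensor

/-! ### Operators on `ℓ²(G, K)` -/

/-- The Hilbert space `ℓ²(G, K) = K ⊗ ℓ²(G)`. -/
abbrev L2 (G K : Type*) [NormedAddCommGroup K] : Type _ := lp (fun _ : G => K) 2

section EllTwo

variable {G : Type*} {K : Type*} [NormedAddCommGroup K] [InnerProductSpace ℂ K]
  {K' : Type*} [NormedAddCommGroup K'] [InnerProductSpace ℂ K']

/-- The direct sum over `G` of a family of unbounded operators: `(T ξ)(y) = T_y (ξ(y))`, on the
domain of all `ξ ∈ ℓ²(G, K)` with `ξ(y) ∈ dom T_y` and `(T_y (ξ(y)))_y ∈ ℓ²(G, K')`. -/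
def diagOp (T : G → K →ₗ.[ℂ] K') : L2 G K →ₗ.[ℂ] L2 G K' :=
  Submodule.toLinearPMap
    { carrier := {p : L2 G K × L2 G K' | ∀ y, (p.1 y, p.2 y) ∈ (T y).graph}
      add_mem' := fun hp hq y => (T y).graph.add_mem (hp y) (hq y)
      zero_mem' := fun y => (T y).graph.zero_mem
      smul_mem' := fun z _ hp y => (T y).graph.smul_mem z (hp y) }

variable [Group G]

set_option linter.unusedSectionVars false in
theorem summable_shift (x : G) (ξ : L2 G K) : Summable fun y : G => ‖ξ (x⁻¹ * y)‖ ^ 2 := by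
  have h := (memℓp_gen_iff (p := 2) (by norm_num)).1 (lp.memℓp ξ)
  have h' : Summable fun y : G => ‖ξ y‖ ^ 2 := by simpa using h
  exact (Equiv.mulLeft x⁻¹).summable_iff (f := fun y => ‖ξ y‖ ^ 2) |>.2 h'

theorem wshift_le (x : G) (T : G → K →L[ℂ] K) (C : ℝ) (hT : ∀ y, ‖T y‖ ≤ C) (ξ : L2 G K) (y : G) :
    ‖T y (ξ (x⁻¹ * y))‖ ^ 2 ≤ C ^ 2 * ‖ξ (x⁻¹ * y)‖ ^ 2 := by
  rw [← mul_pow]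
  gcongr
  exact (T y).le_of_opNorm_le (hT y) _

theorem summable_wshift (x : G) (T : G → K →L[ℂ] K) (C : ℝ) (hT : ∀ y, ‖T y‖ ≤ C) (ξ : L2 G K) :
    Summable fun y : G => ‖T y (ξ (x⁻¹ * y))‖ ^ 2 :=
  Summable.of_nonneg_of_le (fun _ => by positivity) (wshift_le x T C hT ξ)
    ((summable_shift x ξ).mul_left (C ^ 2))

theorem memℓp_wshift (x : G) (T : G → K →L[ℂ] K) (C : ℝ) (hT : ∀ y, ‖T y‖ ≤ C) (ξ : L2 G K) :
    Memℓp (fun y : G => T y (ξ (x⁻¹ * y))) 2 :=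
  memℓp_gen (by simpa using summable_wshift x T C hT ξ)

theorem norm_wshift_le (x : G) (T : G → K →L[ℂ] K) (C : ℝ) (hT : ∀ y, ‖T y‖ ≤ C) (ξ : L2 G K) :
    ‖(⟨_, memℓp_wshift x T C hT ξ⟩ : L2 G K)‖ ≤ C * ‖ξ‖ := by
  have hC : 0 ≤ C := (norm_nonneg _).trans (hT 1)
  refine lp.norm_le_of_tsum_le (p := 2) (by norm_num) (by positivity) ?_
  have h2 : ‖ξ‖ ^ 2 = ∑' y, ‖ξ y‖ ^ 2 := by
    simpa using lp.norm_rpow_eq_tsum (p := 2) (by norm_num) ξ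
  have h3 : ∑' y, ‖ξ (x⁻¹ * y)‖ ^ 2 = ∑' y, ‖ξ y‖ ^ 2 :=
    (Equiv.mulLeft x⁻¹).tsum_eq fun y => ‖ξ y‖ ^ 2
  have h4 : ∑' y, ‖T y (ξ (x⁻¹ * y))‖ ^ 2 ≤ (C * ‖ξ‖) ^ 2 := by
    rw [mul_pow, h2, ← h3, ← tsum_mul_left]
    exact (summable_wshift x T C hT ξ).tsum_le_tsum (wshift_le x T C hT ξ)
      ((summable_shift x ξ).mul_left (C ^ 2))
  simpa using h4

/-- The bounded operator `ξ ⊗ δ_y ↦ T_{xy} ξ ⊗ δ_{xy}` on `ℓ²(G, K)`, for a bounded family `T`. -/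
def wshift (x : G) (T : G → K →L[ℂ] K) (C : ℝ) (hT : ∀ y, ‖T y‖ ≤ C) : L2 G K →L[ℂ] L2 G K :=
  LinearMap.mkContinuous
    { toFun := fun ξ => ⟨fun y => T y (ξ (x⁻¹ * y)), memℓp_wshift x T C hT ξ⟩
      map_add' := fun ξ η => by ext y; exact (T y).map_add _ _
      map_smul' := fun z ξ => by ext y; exact (T y).map_smul _ _ }
    C (norm_wshift_le x T C hT)

theorem wshift_apply (x : G) (T : G → K →L[ℂ] K) (C : ℝ) (hT : ∀ y, ‖T y‖ ≤ C) (ξ : L2 G K)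
    (y : G) : wshift x T C hT ξ y = T y (ξ (x⁻¹ * y)) := rfl

end EllTwo

/-! ### Twisted actions and reduced twisted crossed products -/

/-- A twisted action (twisting pair) of the discrete group `G` on the C*-algebra `A`. -/
structure TwistedAction (G A : Type*) [Group G] [CStarAlgebra A] where
  ρ : G → (A ≃⋆ₐ[ℂ] A)
  σ : G → G → unitary A
  cocycle : ∀ x y z : G,
    ρ x (σ y z : A) = (σ x y : A) * (σ (x * y) z : A) * star (σ x (y * z) : A)
  twist : ∀ (x y : G) (a : A), ρ x (ρ y a) = (σ x y : A) * ρ (x * y) a * star (σ x y : A)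
  σ_right : ∀ x : G, σ x 1 = 1
  σ_left : ∀ x : G, σ 1 x = 1
  ρ_one : ∀ a : A, ρ 1 a = a

section Crossed

variable {G A : Type*} [Group G] [CStarAlgebra A] (α : TwistedAction G A)
  {K : Type*} [NormedAddCommGroup K] [InnerProductSpace ℂ K] [CompleteSpace K]
  (π : A →⋆ₐ[ℂ] (K →L[ℂ] K))

/-- The twisted action is smooth: it restricts to a twisted action on `𝒜`. -/
structure TwistedAction.IsSmooth (𝒜 : StarSubalgebra ℂ A) : Prop where
  ρ_mem_iff : ∀ (x : G) (a : A), α.ρ x a ∈ 𝒜 ↔ a ∈ 𝒜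
  σ_mem : ∀ x y : G, (α.σ x y : A) ∈ 𝒜

theorem TwistedAction.isSmooth_top : α.IsSmooth ⊤ := ⟨fun _ _ => by simp, fun _ _ => by simp⟩

theorem norm_coeff_le (a : A) (x y : G) :
    ‖π (α.ρ y⁻¹ a * (α.σ y⁻¹ x : A))‖ ≤ ‖a‖ := by
  refine (NonUnitalStarAlgHom.norm_apply_le π _).trans ?_
  rw [CStarRing.norm_mul_coe_unitary]
  exact NonUnitalStarAlgHom.norm_apply_le (α.ρ y⁻¹) a

/-- The operator `Π(a δ_x)` of the left regular representation induced by `π`: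
`Π(a δ_x)(ξ ⊗ δ_y) = π(ρ_{y⁻¹x⁻¹}(a) σ_{y⁻¹x⁻¹,x}) ξ ⊗ δ_{xy}`. -/
def regSingle (x : G) (a : A) : L2 G K →L[ℂ] L2 G K :=
  wshift x (fun y => π (α.ρ y⁻¹ a * (α.σ y⁻¹ x : A))) ‖a‖ (norm_coeff_le α π a x)

theorem regSingle_apply (x : G) (a : A) (ξ : L2 G K) (y : G) :
    regSingle α π x a ξ y = π (α.ρ y⁻¹ a * (α.σ y⁻¹ x : A)) (ξ (x⁻¹ * y)) := rfl

/-- `Π(f) = ∑ₓ Π(f(x) δ_x)` for a finitely supported function `f : G → A`. -/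
def regRep (f : G →₀ A) : L2 G K →L[ℂ] L2 G K := f.sum fun x a => regSingle α π x a

theorem regSingle_zero (x : G) : regSingle α π x 0 = 0 := by
  ext ξ y
  rw [regSingle_apply]
  simp

theorem regSingle_add (x : G) (a b : A) :
    regSingle α π x (a + b) = regSingle α π x a + regSingle α π x b := by
  ext ξ y
  change π _ _ = π _ _ + π _ _
  rw [map_add, add_mul, map_add]
  rfl

theorem regSingle_smul (x : G) (c : ℂ) (a : A) :
    regSingle α π x (c • a) = c • regSingle α π x a := by
  ext ξ y
  change π _ _ = c • π _ _
  rw [map_smul, smul_mul_assoc, map_smul]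
  rfl

theorem regSingle_algebraMap (c : ℂ) :
    regSingle α π 1 (algebraMap ℂ A c) = algebraMap ℂ (L2 G K →L[ℂ] L2 G K) c := by
  ext ξ y
  rw [regSingle_apply, α.σ_right, AlgHomClass.commutes, inv_one, one_mul,
    Algebra.algebraMap_eq_smul_one]
  simp

/-- `Π` turns the twisted convolution `(a δ_x) ⋆ (b δ_y) = a ρ_x(b) σ_{x,y} δ_{xy}` into the
product of operators. -/
theorem regSingle_mul (x y : G) (a b : A) :
    regSingle α π x a * regSingle α π y b
      = regSingle α π (x * y) (a * α.ρ x b * (α.σ x y : A)) := by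
  ext ξ z
  have h1 : star (α.σ z⁻¹ x : A) * (α.σ z⁻¹ x : A) = 1 := Unitary.coe_star_mul_self _
  have h2 : star (α.σ z⁻¹ (x * y) : A) * (α.σ z⁻¹ (x * y) : A) = 1 := Unitary.coe_star_mul_self _
  have hc : α.ρ z⁻¹ (a * α.ρ x b * (α.σ x y : A)) * (α.σ z⁻¹ (x * y) : A)
      = α.ρ z⁻¹ a * (α.σ z⁻¹ x : A) * (α.ρ (x⁻¹ * z)⁻¹ b * (α.σ (x⁻¹ * z)⁻¹ y : A)) := by
    rw [mul_inv_rev, inv_inv, map_mul, map_mul, α.twist, α.cocycle]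
    simp only [mul_assoc, h2, mul_one]
    rw [← mul_assoc (star (α.σ z⁻¹ x : A)), h1, one_mul]
  have hi : (x * y)⁻¹ * z = y⁻¹ * (x⁻¹ * z) := by group
  rw [regSingle_apply, hc, hi, map_mul]
  rfl

/-- `Π` turns the involution `(a δ_x)* = σ_{x⁻¹,x}* ρ_{x⁻¹}(a*) δ_{x⁻¹}` into the adjoint. -/
theorem regSingle_star (x : G) (a : A) :
    star (regSingle α π x a)
      = regSingle α π x⁻¹ (star (α.σ x⁻¹ x : A) * α.ρ x⁻¹ (star a)) := by
  symm
  rw [ContinuousLinearMap.star_eq_adjoint, ContinuousLinearMap.eq_adjoint_iff]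
  intro η ξ
  have hc : ∀ y : G, α.ρ y⁻¹ (star (α.σ x⁻¹ x : A) * α.ρ x⁻¹ (star a)) * (α.σ y⁻¹ x⁻¹ : A)
      = star (α.ρ (x * y)⁻¹ a * (α.σ (x * y)⁻¹ x : A)) := fun y => by
    have h1 : star (α.σ y⁻¹ x⁻¹ : A) * (α.σ y⁻¹ x⁻¹ : A) = 1 := Unitary.coe_star_mul_self _
    rw [map_mul, map_star, α.cocycle, α.twist, inv_mul_cancel, α.σ_right, mul_inv_rev, map_star]
    simp only [star_mul, star_star, mul_assoc, h1, mul_one, OneMemClass.coe_one, one_mul]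
    rw [← mul_assoc (star (α.σ y⁻¹ x⁻¹ : A)), h1, one_mul]
  rw [lp.inner_eq_tsum, lp.inner_eq_tsum,
    ← (Equiv.mulLeft x).tsum_eq fun y => inner ℂ (η y) (regSingle α π x a ξ y)]
  refine tsum_congr fun y => ?_
  rw [regSingle_apply, regSingle_apply, hc, map_star, ContinuousLinearMap.star_eq_adjoint,
    ContinuousLinearMap.adjoint_inner_left, inv_inv, Equiv.coe_mulLeft]
  change inner ℂ (η (x * y)) (π _ (ξ y)) = inner ℂ (η (x * y)) (π _ (ξ (x⁻¹ * (x * y))))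
  rw [inv_mul_cancel_left]

theorem regRep_single (x : G) (a : A) :
    regRep α π (Finsupp.single x a) = regSingle α π x a :=
  Finsupp.sum_single_index (regSingle_zero α π x)

theorem regRep_add (f g : G →₀ A) : regRep α π (f + g) = regRep α π f + regRep α π g :=
  Finsupp.sum_add_index' (regSingle_zero α π) (regSingle_add α π)

/-- The `*`-algebra of all operators `Π(f)`, where `f` runs through the twisted convolution algebra
`C_c(G, 𝒜)` of finitely supported functions from `G` to `𝒜`. -/
def convAlgebra (𝒜 : StarSubalgebra ℂ A) (h : α.IsSmooth 𝒜) :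
    StarSubalgebra ℂ (L2 G K →L[ℂ] L2 G K) where
  carrier := {T | ∃ f : G →₀ A, (∀ x, f x ∈ 𝒜) ∧ T = regRep α π f}
  add_mem' := by
    rintro _ _ ⟨f, hf, rfl⟩ ⟨g, hg, rfl⟩
    exact ⟨f + g, fun x => add_mem (hf x) (hg x), (regRep_add α π f g).symm⟩
  algebraMap_mem' c := by
    classical
    refine ⟨Finsupp.single 1 (algebraMap ℂ A c), fun x => ?_, ?_⟩
    · rw [Finsupp.single_apply]
      split_ifs
      exacts [algebraMap_mem 𝒜 c, zero_mem 𝒜]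
    · rw [regRep_single, regSingle_algebraMap]
  mul_mem' := by
    classical
    rintro _ _ ⟨f, hf, rfl⟩ ⟨g, hg, rfl⟩
    refine ⟨∑ x ∈ f.support, ∑ y ∈ g.support,
      Finsupp.single (x * y) (f x * α.ρ x (g y) * (α.σ x y : A)), fun z => ?_, ?_⟩
    · rw [Finsupp.finsetSum_apply]
      refine sum_mem fun x _ => ?_
      rw [Finsupp.finsetSum_apply]
      refine sum_mem fun y _ => ?_
      rw [Finsupp.single_apply]
      split_ifs
      exacts [mul_mem (mul_mem (hf x) ((h.ρ_mem_iff x _).2 (hg y))) (h.σ_mem x y), zero_mem 𝒜]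
    · have hs : ∀ (s : Finset G) (F : G → G →₀ A),
          regRep α π (∑ x ∈ s, F x) = ∑ x ∈ s, regRep α π (F x) := fun s F =>
        map_sum (AddMonoidHom.mk' (regRep α π) (regRep_add α π)) F s
      simp only [hs, regRep_single, ← regSingle_mul]
      simp only [regRep, Finsupp.sum, Finset.sum_mul_sum]
  star_mem' := by
    classical
    rintro _ ⟨f, hf, rfl⟩
    refine ⟨∑ x ∈ f.support,
      Finsupp.single x⁻¹ (star (α.σ x⁻¹ x : A) * α.ρ x⁻¹ (star (f x))), fun z => ?_, ?_⟩
    · rw [Finsupp.finsetSum_apply]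
      refine sum_mem fun x _ => ?_
      rw [Finsupp.single_apply]
      split_ifs
      exacts [mul_mem (star_mem (h.σ_mem _ _)) ((h.ρ_mem_iff _ _).2 (star_mem (hf x))), zero_mem 𝒜]
    · have hs : ∀ (s : Finset G) (F : G → G →₀ A),
          regRep α π (∑ x ∈ s, F x) = ∑ x ∈ s, regRep α π (F x) := fun s F =>
        map_sum (AddMonoidHom.mk' (regRep α π) (regRep_add α π)) F s
      simp only [hs, regRep_single, ← regSingle_star]
      simp only [regRep, Finsupp.sum, star_sum]

/-- The reduced twisted crossed product `A ⋊_r G`: the C*-algebra of operators on `ℓ²(G, K)`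
generated by the left regular representation induced by the (faithful) representation `π`. -/
def crossedProduct : StarSubalgebra ℂ (L2 G K →L[ℂ] L2 G K) :=
  (convAlgebra α π ⊤ α.isSmooth_top).topologicalClosure

instance isClosed_crossedProduct :
    IsClosed (crossedProduct α π : Set (L2 G K →L[ℂ] L2 G K)) :=
  StarSubalgebra.isClosed_topologicalClosure _

theorem regRep_mem_crossedProduct (f : G →₀ A) : regRep α π f ∈ crossedProduct α π :=
  StarSubalgebra.le_topologicalClosure _ ⟨f, fun _ => by simp, rfl⟩

/-- The element of the reduced twisted crossed product given by `f ∈ C_c(G, A)`. -/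
def toCrossed (f : G →₀ A) : crossedProduct α π := ⟨regRep α π f, regRep_mem_crossedProduct α π f⟩

/-- The smooth subalgebra `C_c(G, 𝒜)` of the reduced twisted crossed product. -/
def smoothCrossed (𝒜 : StarSubalgebra ℂ A) (h : α.IsSmooth 𝒜) :
    StarSubalgebra ℂ (crossedProduct α π) :=
  (convAlgebra α π 𝒜 h).comap (crossedProduct α π).subtype

/-- The uniform boundedness condition `sup_x ‖[D, π(ρ_x(a) σ_{x,y})]‖ < ∞` for all `a ∈ 𝒜` and
`y ∈ G`. -/
def UniformlyBounded (𝒜 : StarSubalgebra ℂ A) (D : K →ₗ.[ℂ] K) : Prop :=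
  ∀ a ∈ 𝒜, ∀ y : G, ∃ C : ℝ, ∀ x : G, ∃ T : K →L[ℂ] K,
    IsCommutator D (π (α.ρ x a * (α.σ x y : A))) T ∧ ‖T‖ ≤ C

end Crossed

/-! ### Matrix-valued length functions -/

section Length

variable {G : Type*} [Group G]
  {V : Type*} [NormedAddCommGroup V] [InnerProductSpace ℂ V] [CompleteSpace V]
  (ℓ : G → selfAdjoint (V →L[ℂ] V))

def TranslationBounded : Prop :=
  ∀ y : G, ∃ C : ℝ, ∀ x : G, ‖(ℓ x : V →L[ℂ] V) - (ℓ (y⁻¹ * x) : V →L[ℂ] V)‖ ≤ C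

/-- The union of the spectra of the operators `ℓ(x)`. -/
def spectra : Set ℝ := ⋃ x : G, spectrum ℝ (ℓ x : V →L[ℂ] V)

/-- Properness; "discrete set in `ℝ`" means that there are no accumulation points in `ℝ`. -/
structure IsProperLength : Prop where
  eq_zero_iff : ∀ g : G, ℓ g = 0 ↔ g = 1
  discrete : ∀ t : ℝ, ¬ AccPt t (𝓟 (spectra ℓ))
  finite_fiber : ∀ t ∈ spectra ℓ, {x : G | t ∈ spectrum ℝ (ℓ x : V →L[ℂ] V)}.Finite

/-- `B_n = {g : min Sp |ℓ(g)| ≤ n}`. -/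
def ball (n : ℕ) : Set G :=
  {g | sInf (spectrum ℝ (CFC.abs (ℓ g : V →L[ℂ] V))) ≤ n}

/-- `#B_n` grows at most polynomially. -/
def PolynomialGrowth : Prop :=
  ∃ (C : ℝ) (k : ℕ), ∀ n : ℕ, 1 ≤ n → (ball ℓ n).Finite ∧ ((ball ℓ n).ncard : ℝ) ≤ C * (n : ℝ) ^ k

/-- The growth `d_G = limsup_n log #B_n / log n`. -/
def growth : ℝ := limsup (fun n : ℕ => Real.log (ball ℓ n).ncard / Real.log n) atTop

end Length

/-! ### The Dirac operators on the crossed product -/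

section Dirac

variable {G : Type*} [Group G]
  {V : Type*} [NormedAddCommGroup V] [InnerProductSpace ℂ V] [CompleteSpace V]
  (ℓ : G → selfAdjoint (V →L[ℂ] V))

/-- The operator `D ⊗ 1_{ℓ²(G)} ⊗ 1_V` from `H ⊗ ℓ²(G) ⊗ V` to `K ⊗ ℓ²(G) ⊗ V`. -/
def liftOp (G V : Type*) [NormedAddCommGroup V] [InnerProductSpace ℂ V]
    {H K : Type*} [NormedAddCommGroup H] [InnerProductSpace ℂ H]
    [NormedAddCommGroup K] [InnerProductSpace ℂ K] (D : H →ₗ.[ℂ] K) :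
    L2 G (H ⊗[ℂ] V) →ₗ.[ℂ] L2 G (K ⊗[ℂ] V) :=
  diagOp fun _ : G => tensorOp V D

/-- The operator `1_H ⊗ M_ℓ` on `H ⊗ ℓ²(G) ⊗ V`: `ξ ⊗ δ_y ⊗ v ↦ ξ ⊗ δ_y ⊗ ℓ(y) v`. -/
def lengthOp (H : Type*) [NormedAddCommGroup H] [InnerProductSpace ℂ H] :
    L2 G (H ⊗[ℂ] V) →ₗ.[ℂ] L2 G (H ⊗[ℂ] V) :=
  diagOp fun y : G =>
    (((ℓ y : V →L[ℂ] V).lTensor H : H ⊗[ℂ] V →L[ℂ] H ⊗[ℂ] V) :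
      H ⊗[ℂ] V →ₗ[ℂ] H ⊗[ℂ] V).toPMap ⊤

/-- The Dirac operator of the odd-to-even case,
`(0, D ⊗ 1 ⊗ 1 - i 1 ⊗ M_ℓ; D ⊗ 1 ⊗ 1 + i 1 ⊗ M_ℓ, 0)`. -/
def diracOddToEven {H : Type*} [NormedAddCommGroup H] [InnerProductSpace ℂ H] (D : H →ₗ.[ℂ] H) :
    WithLp 2 (L2 G (H ⊗[ℂ] V) × L2 G (H ⊗[ℂ] V)) →ₗ.[ℂ]
      WithLp 2 (L2 G (H ⊗[ℂ] V) × L2 G (H ⊗[ℂ] V)) :=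
  blockOp 0 (liftOp G V D - Complex.I • lengthOp ℓ H)
    (liftOp G V D + Complex.I • lengthOp ℓ H) 0

/-- The Dirac operator of the even-to-odd case,
`(1 ⊗ M_ℓ, D⁻ ⊗ 1 ⊗ 1; D⁺ ⊗ 1 ⊗ 1, -1 ⊗ M_ℓ)`. -/
def diracEvenToOdd {Hp Hm : Type*} [NormedAddCommGroup Hp] [InnerProductSpace ℂ Hp]
    [NormedAddCommGroup Hm] [InnerProductSpace ℂ Hm]
    (Dp : Hp →ₗ.[ℂ] Hm) (Dm : Hm →ₗ.[ℂ] Hp) :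
    WithLp 2 (L2 G (Hp ⊗[ℂ] V) × L2 G (Hm ⊗[ℂ] V)) →ₗ.[ℂ]
      WithLp 2 (L2 G (Hp ⊗[ℂ] V) × L2 G (Hm ⊗[ℂ] V)) :=
  blockOp (lengthOp ℓ Hp) (liftOp G V Dm) (liftOp G V Dp) (-lengthOp ℓ Hm)

end Dirac

end TwistedTriple

end

noncomputable section

namespace TwistedTriple

/-! ### Bounded operators which are diagonal with respect to a Hilbert basis -/

section Diagonal

variable {E : Type*} [NormedAddCommGroup E] [InnerProductSpace ℂ E]

/-! Both Dirac operators are instances of one model: up to a unitary they equal `D ⊗ 1 + J ⊗ M_ℓ` on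
`ℓ²(G, X ⊗ V)`, where `J` is a self-adjoint unitary on `X` which anticommutes with `D` and commutes
with the representation (`IsDiracModel`, `IsAnticommuting`). In the even case `X = H⁺ ⊕ H⁻` and `J`
is the grading. In the odd case `X = H ⊕ H`, `D` is replaced by `(0 D; D 0)` and `J = (0 -i; i 0)`;
the doubling only repeats each eigenvalue of `D²`, so it preserves compactness, summability and
abscissa (`double_properties`).

Anticommutation makes the cross terms of the square cancel, so the model operator `T` satisfies `T²
= D² ⊗ 1 + 1 ⊗ M_ℓ²`. Since `D` has compact resolvent, `D²` has an eigenbasis `e_i` with eigenvalues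
`κ_i`; each `ℓ(y)` has an eigenbasis `v_{y,j}` with eigenvalues `μ_{y,j}`. Hence the `e_i ⊗ δ_y ⊗
v_{y,j}` form an eigenbasis of `T²` with eigenvalues `κ_i + μ_{y,j}²`
(`IsDiracModel.exists_sqDiagonal_single`). A closed symmetric operator whose square has an
eigenbasis is self-adjoint (`SqDiagonal.isSelfAdjoint`), its resolvent is compact once only finitely
many eigenvalues lie below each bound, and its zeta function is the sum of `(1 + κ_i +
μ_{y,j}²)^(-t/2)`.

The commutator with `a δ_x` splits into a part with coefficients `[D, π(ρ(a)σ)]`, bounded by the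
uniformity hypothesis, and a part with coefficients `ℓ(y) - ℓ(x⁻¹y)`, bounded by translation
boundedness (`IsDiracModel.isCommutator_regSingle`). If the commutator with `Π(f)` vanishes, testing
it on `δ_e` and using `J` to separate the two parts gives `f(y) = 0` for `y ≠ e` and `[D, π(f(e))] =
0` (`IsDiracModel.commutator_eq_zero`).

For the abscissa, splitting the exponent bounds the double sum by a product of a `D`-sum and a
length sum, the latter estimated dyadically (`tsum_add_lt_top`, `tsum_length_lt_top`). Conversely,
keeping for each `i` only the group elements in the ball of radius about `√(1 + κ_i)` recovers the
`D`-sum with exponent lowered by the growth rate (`tsum_lt_top_of_add`). -/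

theorem hasSum_norm_inner_sq {ι : Type*} (w : HilbertBasis ι ℂ E) (x : E) :
    HasSum (fun k => ‖inner ℂ (w k) x‖ ^ 2) (‖x‖ ^ 2) := by
  have h := w.hasSum_inner_mul_inner x x
  have h2 := Complex.hasSum_re h
  have h3 : (inner ℂ x x).re = ‖x‖ ^ 2 := by
    rw [inner_self_eq_norm_sq_to_K]
    norm_cast
  rw [h3] at h2
  refine h2.congr_fun fun k => ?_
  rw [← inner_conj_symm x (w k), mul_comm, Complex.mul_conj, Complex.normSq_eq_norm_sq]
  norm_cast

theorem dense_span_hilbertBasis {ι : Type*} (w : HilbertBasis ι ℂ E) :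
    Dense (Submodule.span ℂ (Set.range w) : Set E) :=
  Submodule.dense_iff_topologicalClosure_eq_top.2 w.dense_span

theorem inner_diagonal {ι : Type*} (w : HilbertBasis ι ℂ E) {t : ι → ℝ} {S : E →L[ℂ] E}
    (hS : ∀ k, S (w k) = (t k : ℂ) • w k) (k : ι) (x : E) :
    inner ℂ (w k) (S x) = (t k : ℂ) * inner ℂ (w k) x := by
  have : innerSL ℂ (w k) ∘L S = (t k : ℂ) • innerSL ℂ (w k) := by
    refine ContinuousLinearMap.ext_on (dense_span_hilbertBasis w) ?_
    rintro _ ⟨j, rfl⟩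
    by_cases h : k = j
    · subst h
      simp [hS]
    · simp [hS, w.orthonormal.2 h]
  simpa using congrArg (fun f => f x) this

theorem norm_diagonal_le {ι : Type*} (w : HilbertBasis ι ℂ E) {t : ι → ℝ} {S : E →L[ℂ] E}
    (hS : ∀ k, S (w k) = (t k : ℂ) • w k) {ε : ℝ} (hε : 0 ≤ ε) (ht : ∀ k, |t k| ≤ ε) :
    ‖S‖ ≤ ε := by
  refine S.opNorm_le_bound hε fun x => ?_
  rw [← sq_le_sq₀ (by positivity) (by positivity), mul_pow]
  refine hasSum_le (fun k => ?_) (hasSum_norm_inner_sq w (S x))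
    ((hasSum_norm_inner_sq w x).mul_left (ε ^ 2))
  rw [inner_diagonal w hS, norm_mul, mul_pow, Complex.norm_real, Real.norm_eq_abs]
  gcongr
  exact ht k

/-- The operator is the norm limit of its finite rank truncations, because the remainder is diagonal
with small entries. -/
theorem isCompactOperator_diagonal [CompleteSpace E] {ι : Type*} (w : HilbertBasis ι ℂ E)
    {t : ι → ℝ} {S : E →L[ℂ] E} (hS : ∀ k, S (w k) = (t k : ℂ) • w k)
    (ht : ∀ ε > 0, {k | ε < |t k|}.Finite) : IsCompactOperator S := by
  classical
  let F : Finset ι → E →L[ℂ] E := fun s =>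
    ∑ k ∈ s, (innerSL ℂ (w k)).smulRight ((t k : ℂ) • w k)
  have hF : ∀ s, IsCompactOperator (F s) := fun s => by
    have : F s ∈ compactOperator (RingHom.id ℂ) E E := by
      refine sum_mem fun k _ => ?_
      change IsCompactOperator _
      have h1 : IsCompactOperator (innerSL ℂ (w k)) :=
        (isCompactOperator_id (E := ℂ)).comp_clm (innerSL ℂ (w k))
      exact h1.clm_comp (ContinuousLinearMap.toSpanSingleton ℂ ((t k : ℂ) • w k))
    exact this
  refine isCompactOperator_of_tendsto (l := atTop) (F := F) ?_ (Eventually.of_forall hF)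
  rw [Metric.tendsto_atTop]
  intro ε hε
  refine ⟨(ht (ε / 2) (by positivity)).toFinset, fun s hs => ?_⟩
  rw [dist_eq_norm, norm_sub_rev]
  -- `S - F s` is diagonal with the entries in `s` deleted; the remaining ones are at most `ε / 2`,
  -- since `s` contains all larger ones.
  refine (norm_diagonal_le w (t := fun k => if k ∈ s then 0 else t k) (fun j => ?_)
    (by positivity : 0 ≤ ε / 2) fun k => ?_).trans_lt (by linarith)
  · have hFj : F s (w j) = if j ∈ s then (t j : ℂ) • w j else 0 := by
      simp only [F, sum_apply, ContinuousLinearMap.smulRight_apply,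
        innerSL_apply_apply, orthonormal_iff_ite.1 w.orthonormal, ite_smul, one_smul, zero_smul]
      rw [Finset.sum_ite_eq' s j]
    rw [sub_apply, hS, hFj]
    by_cases h : j ∈ s <;> simp [h]
  · split_ifs with h
    · simp; positivity
    · by_contra hk
      exact h (hs (by simpa using hk))

/-- Images of distinct basis vectors are orthogonal, so infinitely many entries of size at least `ε`
would give a sequence in a compact set with mutual distances at least `ε`. -/
theorem finite_of_isCompactOperator_diagonal {ι : Type*} (w : HilbertBasis ι ℂ E)
    {t : ι → ℝ} {S : E →L[ℂ] E} (hS : ∀ k, S (w k) = (t k : ℂ) • w k)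
    (hc : IsCompactOperator S) {ε : ℝ} (hε : 0 < ε) : {k | ε ≤ |t k|}.Finite := by
  by_contra hinf
  have hinf : {k | ε ≤ |t k|}.Infinite := hinf
  let f := hinf.natEmbedding
  let x : ℕ → E := fun n => S (w (f n))
  obtain ⟨K, hK, hSK⟩ := hc.image_closedBall_subset_compact (𝕜₁ := ℂ) (𝕜₂ := ℂ) 1
  have hx : ∀ n, x n ∈ K := fun n => hSK ⟨w (f n), by simp [w.orthonormal.1], rfl⟩
  obtain ⟨a, -, φ, hφ, hlim⟩ := hK.tendsto_subseq hx
  obtain ⟨N, hN⟩ := Metric.cauchySeq_iff.1 hlim.cauchySeq ε hε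
  have h := hN N le_rfl (N + 1) (by simp)
  set i := f (φ N) with hi
  set j := f (φ (N + 1)) with hj
  have hij : (i : ι) ≠ j := fun h => by
    have := hφ.injective (f.injective (Subtype.ext h))
    omega
  have hd : dist ((x ∘ φ) N) ((x ∘ φ) (N + 1)) ^ 2 = |t i| ^ 2 + |t j| ^ 2 := by
    change dist (S (w i)) (S (w j)) ^ 2 = _
    rw [hS, hS, dist_eq_norm, @norm_sub_sq ℂ, inner_smul_left, inner_smul_right,
      w.orthonormal.2 hij, norm_smul, norm_smul, w.orthonormal.1, w.orthonormal.1]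
    simp
  have h1 : ε ≤ |t i| := i.2
  have h2 := sq_lt_sq₀ dist_nonneg hε.le |>.2 h
  rw [hd] at h2
  have h3 := (sq_le_sq₀ hε.le (abs_nonneg _)).2 h1
  have := sq_nonneg |t j|
  linarith

/-- `posTrace` is computed in an unspecified basis. Parseval in `w` expands each of its terms,
Tonelli in `[0, ∞]` exchanges the sums, and Parseval in the unspecified basis collapses the inner
one. -/
theorem posTrace_diagonal [CompleteSpace E] {ι : Type*} (w : HilbertBasis ι ℂ E)
    {t : ι → ℝ} {S : E →L[ℂ] E} (hS : ∀ k, S (w k) = (t k : ℂ) • w k) (ht : ∀ k, 0 ≤ t k) :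
    posTrace S = ∑' k, ENNReal.ofReal (t k) := by
  have hx : ∀ x : E, ENNReal.ofReal (inner ℂ x (S x)).re
      = ∑' k, ENNReal.ofReal (t k) * ENNReal.ofReal (‖inner ℂ x (w k)‖ ^ 2) := fun x => by
    have h := Complex.hasSum_re (w.hasSum_inner_mul_inner x (S x))
    have he : ∀ k, (inner ℂ x (w k) * inner ℂ (w k) (S x)).re
        = t k * ‖inner ℂ x (w k)‖ ^ 2 := fun k => by
      rw [inner_diagonal w hS, ← inner_conj_symm (w k) x, mul_left_comm, Complex.mul_conj,
        Complex.normSq_eq_norm_sq]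
      norm_cast
    simp only [he] at h
    rw [← h.tsum_eq, ENNReal.ofReal_tsum_of_nonneg (fun k => mul_nonneg (ht k) (by positivity))
      h.summable]
    exact tsum_congr fun k => ENNReal.ofReal_mul (ht k)
  rw [posTrace]
  simp only [hx]
  rw [ENNReal.tsum_comm]
  refine tsum_congr fun k => ?_
  rw [ENNReal.tsum_mul_left, ← ENNReal.ofReal_tsum_of_nonneg (fun _ => by positivity)
    (hasSum_norm_inner_sq _ (w k)).summable,
    (hasSum_norm_inner_sq _ (w k)).tsum_eq, w.orthonormal.1]
  simp

/-- The functions for which the formula holds contain the constants and the identity, are closed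
under sums and products, and form a closed set; Stone–Weierstrass finishes. -/
theorem cfc_apply_of_eigenvector [CompleteSpace E] {a : E →L[ℂ] E} (ha : IsSelfAdjoint a) {r : ℝ}
    {v : E} (hv : a v = (r : ℂ) • v) {f : ℝ → ℝ} (hf : ContinuousOn f (spectrum ℝ a)) :
    cfc f a v = (f r : ℂ) • v := by
  -- Only for `v ≠ 0` does the eigenvector equation force `r` into the spectrum, where the
  -- restricted functions can be evaluated.
  rcases eq_or_ne v 0 with rfl | hv0
  · simp
  have hr : r ∈ spectrum ℝ a := by
    rw [spectrum.mem_iff]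
    intro hu
    refine hv0 ?_
    have hz : (algebraMap ℝ (E →L[ℂ] E) r - a) v = 0 := by
      rw [sub_apply, hv, Algebra.algebraMap_eq_smul_one]
      simp
    obtain ⟨u, hu⟩ := hu
    rw [← hu] at hz
    have := congrArg (fun z => (↑u⁻¹ : E →L[ℂ] E) z) hz
    simpa [← mul_apply_eq_comp] using this
  rw [cfc_apply f a ha hf]
  have key : ∀ g : C(spectrum ℝ a, ℝ), cfcHom ha g v = (g ⟨r, hr⟩ : ℂ) • v := by
    intro g
    induction g using ContinuousMap.induction_on_of_compact with
    | const c =>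
      have : (ContinuousMap.const (spectrum ℝ a) c) = algebraMap ℝ _ c := rfl
      rw [this, AlgHomClass.commutes, Algebra.algebraMap_eq_smul_one]
      simp
    | id => rw [cfcHom_id]; exact hv
    | star_id =>
      rw [map_star, cfcHom_id, ha.star_eq]; exact hv
    | add f g hf hg =>
      rw [map_add, add_apply, hf, hg, ContinuousMap.add_apply,
        Complex.ofReal_add, add_smul]
    | mul f g hf hg =>
      rw [map_mul, mul_apply_eq_comp, hg, map_smul, hf, ContinuousMap.mul_apply,
        Complex.ofReal_mul, smul_smul, mul_comm]
    | frequently f h =>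
      have hcl : IsClosed {g : C(spectrum ℝ a, ℝ) | cfcHom ha g v = (g ⟨r, hr⟩ : ℂ) • v} := by
        refine isClosed_eq ?_ ?_
        · exact (ContinuousLinearMap.apply ℂ E v).continuous.comp (cfcHom_continuous ha)
        · exact (Complex.continuous_ofReal.comp (continuous_eval_const _)).smul
            continuous_const
      exact hcl.closure_subset (mem_closure_iff_frequently.2 h)
  exact key _

theorem rpow_apply_of_eigenvector [CompleteSpace E] {a : E →L[ℂ] E} (ha : 0 ≤ a) {r : ℝ}
    {v : E} (hv : a v = (r : ℂ) • v) {s : ℝ} (hs : 0 ≤ s) :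
    (a ^ s) v = ((r ^ s : ℝ) : ℂ) • v := by
  rw [CFC.rpow_eq_cfc_real ha]
  exact cfc_apply_of_eigenvector (IsSelfAdjoint.of_nonneg ha) hv
    (Real.continuous_rpow_const hs).continuousOn

theorem mem_orthogonal_of_hilbertBasis {E : Type*} [NormedAddCommGroup E]
    [InnerProductSpace ℂ E] (F : Submodule ℂ E) {ι : Type*} (b : HilbertBasis ι ℂ F) {x : E}
    (hx : ∀ i, inner ℂ x (b i : E) = 0) : x ∈ Fᗮ := by
  have h0 : innerSL ℂ x ∘L F.subtypeL = 0 := by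
    refine ContinuousLinearMap.ext_on (dense_span_hilbertBasis b) ?_
    rintro _ ⟨i, rfl⟩
    simpa using hx i
  rw [Submodule.mem_orthogonal']
  intro u hu
  simpa using congrArg (fun f => f ⟨u, hu⟩) h0

/-- A compact self-adjoint operator has a Hilbert basis of eigenvectors. -/
theorem exists_hilbertBasis_eigenvectors.{u} {E : Type u} [NormedAddCommGroup E]
    [InnerProductSpace ℂ E] [CompleteSpace E] {R : E →L[ℂ] E}
    (hc : IsCompactOperator R) (hR : IsSelfAdjoint R) :
    ∃ (ι : Type u) (w : HilbertBasis ι ℂ E) (r : ι → ℝ), ∀ k, R (w k) = (r k : ℂ) • w k := by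
  have hsymm : (R : E →ₗ[ℂ] E).IsSymmetric := hR.isSymmetric
  obtain ⟨F, hF⟩ : ∃ F : ℂ → Submodule ℂ E,
      F = fun μ => Module.End.eigenspace (R : E →ₗ[ℂ] E) μ := ⟨_, rfl⟩
  have hFmem : ∀ μ x, x ∈ F μ ↔ R x = μ • x := fun μ x => by
    rw [hF]
    exact Module.End.mem_eigenspace_iff
  have hcl : ∀ μ, IsClosed (F μ : Set E) := fun μ => by
    have : (F μ : Set E) = {x | R x = μ • x} := Set.ext fun x => hFmem μ x
    rw [this]
    exact isClosed_eq R.continuous (continuous_const_smul μ)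
  have : ∀ μ, CompleteSpace (F μ) := fun μ => (hcl μ).completeSpace_coe
  have hfam : OrthogonalFamily ℂ (fun μ => F μ) fun μ => (F μ).subtypeₗᵢ := by
    rw [hF]
    exact hsymm.orthogonalFamily_eigenspaces
  have hperp : (⨆ μ, F μ)ᗮ = ⊥ := by
    rw [hF]
    exact ContinuousLinearMap.orthogonalComplement_iSup_eigenspaces_eq_bot hc hsymm
  choose s b hb using fun μ => exists_hilbertBasis ℂ (F μ)
  have hv : Orthonormal ℂ fun a : (Σ μ, s μ) => ((b a.1 a.2 : F a.1) : E) :=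
    hfam.orthonormal_sigma_orthonormal fun μ => (b μ).orthonormal
  have hbot : (Submodule.span ℂ (Set.range fun a : (Σ μ, s μ) => ((b a.1 a.2 : F a.1) : E)))ᗮ
      = ⊥ := by
    rw [eq_bot_iff, ← hperp]
    intro x hx
    rw [← Submodule.iInf_orthogonal, Submodule.mem_iInf]
    exact fun μ => mem_orthogonal_of_hilbertBasis (F μ) (b μ) fun i =>
      (Submodule.mem_orthogonal' _ _).1 hx _ (Submodule.subset_span ⟨⟨μ, i⟩, rfl⟩)
  -- The eigenspaces are indexed by complex numbers. Those with a nonzero vector have real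
  -- eigenvalue by symmetry, so taking the real part loses nothing.
  refine ⟨_, HilbertBasis.mkOfOrthogonalEqBot hv hbot, fun a => a.1.re, fun a => ?_⟩
  rw [HilbertBasis.coe_mkOfOrthogonalEqBot]
  have hmem : R (b a.1 a.2 : F a.1) = a.1 • ((b a.1 a.2 : F a.1) : E) :=
    (hFmem _ _).1 (b a.1 a.2).2
  have hne : ((b a.1 a.2 : F a.1) : E) ≠ 0 := hv.ne_zero a
  have hev : Module.End.HasEigenvalue (R : E →ₗ[ℂ] E) a.1 :=
    Module.End.hasEigenvalue_of_hasEigenvector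
      (Module.End.hasEigenvector_iff.2 ⟨Module.End.mem_eigenspace_iff.2 hmem, hne⟩)
  have hre := Complex.conj_eq_iff_re.1 (hsymm.conj_eigenvalue_eq_self hev)
  rw [hmem, hre]

end Diagonal

/-! ### Unbounded operators whose square is diagonal with respect to a Hilbert basis -/

section SqDiagonal

variable {E : Type*} [NormedAddCommGroup E] [InnerProductSpace ℂ E]

/-- Symmetry of an unbounded operator, in terms of its graph. -/
def IsSymmGraph (T : E →ₗ.[ℂ] E) : Prop :=
  ∀ x x' y y' : E, (x, x') ∈ T.graph → (y, y') ∈ T.graph → inner ℂ x' y = inner ℂ x y'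

theorem graph_adjoint_eq_of_isSelfAdjoint [CompleteSpace E] {T : E →ₗ.[ℂ] E}
    (hT : IsSelfAdjoint T) : T.graph.adjoint = T.graph := by
  conv_rhs => rw [← LinearPMap.isSelfAdjoint_def.mp hT]
  exact (LinearPMap.adjoint_graph_eq_graph_adjoint hT.dense_domain).symm

theorem isSymmGraph_of_isSelfAdjoint [CompleteSpace E] {T : E →ₗ.[ℂ] E}
    (hT : IsSelfAdjoint T) : IsSymmGraph T := by
  intro x x' y y' hx hy
  rw [← graph_adjoint_eq_of_isSelfAdjoint hT, Submodule.mem_adjoint_iff] at hy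
  exact sub_eq_zero.1 (hy x x' hx)

/-- The difference `d` of two solutions of `(1 + T²)x = η` satisfies `T²d = -d`, and symmetry turns
this into `‖Td‖² = -‖d‖²`. The value of the inverse can thus be checked on a candidate. -/
theorem IsSymmGraph.eq_of_isInvOneAddSq {T : E →ₗ.[ℂ] E} (hT : IsSymmGraph T) {R : E →L[ℂ] E}
    (hR : IsInvOneAddSq T R) {x u η : E} (h1 : (x, u) ∈ T.graph) (h2 : (u, η - x) ∈ T.graph) :
    R η = x := by
  obtain ⟨ζ, h3, h4⟩ := hR η
  have h5 : (R η - x, ζ - u) ∈ T.graph := T.graph.sub_mem h3 h1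
  have h6 : (ζ - u, -(R η - x)) ∈ T.graph := by
    have := T.graph.sub_mem h4 h2
    simpa using this
  have h7 := hT _ _ _ _ h5 h6
  rw [inner_neg_right, inner_self_eq_norm_sq_to_K, inner_self_eq_norm_sq_to_K] at h7
  have h8 : ‖ζ - u‖ ^ 2 = -‖R η - x‖ ^ 2 := by exact_mod_cast h7
  have h9 : ‖R η - x‖ ^ 2 = 0 := by nlinarith [sq_nonneg ‖ζ - u‖, sq_nonneg ‖R η - x‖]
  exact sub_eq_zero.1 (norm_eq_zero.1 (pow_eq_zero_iff two_ne_zero |>.1 h9))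

/-- Positivity comes from `⟨Rη, η⟩ = ‖TRη‖² + ‖Rη‖²`; it is what gives real powers of `R` their
meaning. -/
theorem IsSymmGraph.nonneg_of_isInvOneAddSq [CompleteSpace E] {T : E →ₗ.[ℂ] E}
    (hT : IsSymmGraph T) {R : E →L[ℂ] E} (hR : IsInvOneAddSq T R) : 0 ≤ R := by
  rw [ContinuousLinearMap.nonneg_iff_isPositive]
  refine ⟨fun η θ => ?_, fun η => ?_⟩
  · obtain ⟨z, h1, h2⟩ := hR η
    obtain ⟨s, h3, h4⟩ := hR θ
    have h5 := hT _ _ _ _ h1 h4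
    have h6 := hT _ _ _ _ h2 h3
    rw [inner_sub_right] at h5
    rw [inner_sub_left] at h6
    change inner ℂ (R η) θ = inner ℂ η (R θ)
    linear_combination -h6 - h5
  · obtain ⟨z, h1, h2⟩ := hR η
    have h5 := hT _ _ _ _ h1 h2
    rw [inner_sub_right, inner_self_eq_norm_sq_to_K, inner_self_eq_norm_sq_to_K] at h5
    have h6 : inner ℂ (R η) η = ((‖z‖ ^ 2 + ‖R η‖ ^ 2 : ℝ) : ℂ) := by
      push_cast
      linear_combination -h5
    rw [ContinuousLinearMap.reApplyInnerSelf_apply, h6]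
    rw [show ((‖z‖ ^ 2 + ‖R η‖ ^ 2 : ℝ) : ℂ) = RCLike.ofReal (‖z‖ ^ 2 + ‖R η‖ ^ 2) from rfl,
      RCLike.ofReal_re]
    positivity

/-- `T` is a closed symmetric operator and `w` is a Hilbert basis with `T² w_k = κ_k w_k`. -/
structure SqDiagonal {ι : Type*} (T : E →ₗ.[ℂ] E) (w : HilbertBasis ι ℂ E) (κ : ι → ℝ) : Prop where
  symm : IsSymmGraph T
  closed : IsClosed (T.graph : Set (E × E))
  sq : ∀ k, ∃ u, (w k, u) ∈ T.graph ∧ (u, (κ k : ℂ) • w k) ∈ T.graph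

namespace SqDiagonal

variable {ι : Type*} {T : E →ₗ.[ℂ] E} {w : HilbertBasis ι ℂ E} {κ : ι → ℝ}

theorem nonneg (h : SqDiagonal T w κ) (k : ι) : 0 ≤ κ k := by
  obtain ⟨u, h1, h2⟩ := h.sq k
  have h3 := h.symm _ _ _ _ h1 h2
  rw [inner_smul_right, inner_self_eq_norm_sq_to_K, inner_self_eq_norm_sq_to_K,
    w.orthonormal.1] at h3
  have h4 : ‖u‖ ^ 2 = κ k := by
    have : ((‖u‖ ^ 2 : ℝ) : ℂ) = κ k := by push_cast; simpa using h3
    exact_mod_cast this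
  rw [← h4]
  positivity

theorem dense_domain (h : SqDiagonal T w κ) : Dense (T.domain : Set E) := by
  refine (dense_span_hilbertBasis w).mono ?_
  have : Submodule.span ℂ (Set.range w) ≤ T.domain := by
    rw [Submodule.span_le]
    rintro _ ⟨k, rfl⟩
    obtain ⟨u, h1, -⟩ := h.sq k
    exact LinearPMap.mem_domain_of_mem_graph h1
  exact this

/-- This is surjectivity of `T + c` for `c = ±i`. Symmetry gives `‖(T + c)x‖² = ‖Tx‖² + ‖x‖²`, so
the range is closed because the graph is complete. The range is dense because `(T + c)(T - c) = T² +
1` multiplies `w_k` by `1 + κ_k ≠ 0`. -/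
theorem exists_add_smul_eq [CompleteSpace E] (h : SqDiagonal T w κ) {c : ℂ} (hc : c * c = -1)
    (hc' : star c = -c) (z : E) : ∃ x x', (x, x') ∈ T.graph ∧ x' + c • x = z := by
  have hcn : ‖c‖ = 1 := by
    have := congrArg norm hc
    rw [norm_mul, norm_neg, norm_one] at this
    nlinarith [norm_nonneg c]
  let Φ : T.graph →L[ℂ] E :=
    (ContinuousLinearMap.snd ℂ E E + c • ContinuousLinearMap.fst ℂ E E) ∘L T.graph.subtypeL
  have hΦ : ∀ p : T.graph, Φ p = (p : E × E).2 + c • (p : E × E).1 := fun p => rfl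
  have hnorm : ∀ p : T.graph, ‖p‖ ≤ ‖Φ p‖ := by
    rintro ⟨⟨x, x'⟩, hp⟩
    have hs := h.symm _ _ _ _ hp hp
    have h1 : ‖x' + c • x‖ ^ 2 = ‖x'‖ ^ 2 + ‖x‖ ^ 2 := by
      rw [@norm_add_sq ℂ, inner_smul_right, norm_smul, hcn, one_mul]
      have h2 : RCLike.re (c * inner ℂ x' x) = 0 := by
        have h3 : star (c * inner ℂ x' x) = -(c * inner ℂ x' x) := by
          rw [star_mul', hc']
          change -c * (starRingEnd ℂ) (inner ℂ x' x) = _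
          rw [inner_conj_symm, hs, neg_mul]
        have h4 := congrArg Complex.re h3
        rw [Complex.star_def, Complex.conj_re, Complex.neg_re] at h4
        change Complex.re _ = 0
        linarith
      rw [h2]
      ring
    change max ‖x‖ ‖x'‖ ≤ ‖x' + c • x‖
    refine max_le ?_ ?_ <;>
    · rw [← sq_le_sq₀ (norm_nonneg _) (norm_nonneg _), h1]
      nlinarith [sq_nonneg ‖x‖, sq_nonneg ‖x'‖]
  have : CompleteSpace T.graph := h.closed.completeSpace_coe
  have hanti : AntilipschitzWith 1 Φ :=
    AddMonoidHomClass.antilipschitz_of_bound Φ fun p => by simpa using hnorm p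
  have hcl : IsClosed (Set.range Φ) := hanti.isClosed_range Φ.uniformContinuous
  have hle : Submodule.span ℂ (Set.range w) ≤ LinearMap.range (Φ : T.graph →ₗ[ℂ] E) := by
    rw [Submodule.span_le]
    rintro _ ⟨k, rfl⟩
    obtain ⟨u, h1, h2⟩ := h.sq k
    have hk : (1 + κ k : ℂ) ≠ 0 := by
      have := h.nonneg k
      have h3 : (1 + κ k : ℝ) ≠ 0 := by linarith
      exact_mod_cast h3
    have h3 : (u - c • w k, (κ k : ℂ) • w k - c • u) ∈ T.graph :=
      T.graph.sub_mem h2 (T.graph.smul_mem c h1)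
    refine ⟨(1 + κ k : ℂ)⁻¹ • ⟨_, h3⟩, ?_⟩
    change Φ _ = _
    rw [map_smul, hΦ]
    have h4 : (κ k : ℂ) • w k - c • u + c • (u - c • w k) = (1 + κ k : ℂ) • w k := by
      rw [smul_sub, smul_smul, hc]
      module
    rw [h4, smul_smul, inv_mul_cancel₀ hk, one_smul]
  have hrange : Set.range Φ = Set.univ := by
    refine hcl.closure_eq.symm.trans ?_
    exact ((dense_span_hilbertBasis w).mono hle).closure_eq
  obtain ⟨p, hp⟩ : z ∈ Set.range Φ := by rw [hrange]; trivial
  exact ⟨_, _, p.2, hp⟩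

/-- The basic criterion: a symmetric densely defined operator for which `T + i` and `T - i` are onto
is self-adjoint. -/
theorem isSelfAdjoint [CompleteSpace E] (h : SqDiagonal T w κ) : IsSelfAdjoint T := by
  rw [LinearPMap.isSelfAdjoint_def]
  refine LinearPMap.eq_of_eq_graph ?_
  rw [LinearPMap.adjoint_graph_eq_graph_adjoint h.dense_domain]
  refine le_antisymm ?_ ?_
  · rintro ⟨y, y'⟩ hy
    obtain ⟨x, x', hx, hxy⟩ := h.exists_add_smul_eq Complex.I_mul_I (by simp) (y' + Complex.I • y)
    -- With `(T + i)x = (T* + i)y`, the vector `y - x` is in the kernel of `T* + i`, hence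
    -- orthogonal to the range of `T - i`. It is itself written as `(T - i)a`, so its norm vanishes.
    have hz : y - x = 0 := by
      obtain ⟨a, a', ha, haz⟩ := h.exists_add_smul_eq (c := -Complex.I) (by simp) (by simp) (y - x)
      have h1 := sub_eq_zero.1 ((Submodule.mem_adjoint_iff _ _).1 hy a a' ha)
      have h2 := h.symm _ _ _ _ ha hx
      have h3 : x' = y' + Complex.I • y - Complex.I • x := eq_sub_of_add_eq hxy
      rw [← inner_self_eq_zero (𝕜 := ℂ)]
      nth_rewrite 1 [← haz]
      simp only at h1
      rw [h3, inner_sub_right, inner_add_right, inner_smul_right, inner_smul_right] at h2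
      rw [inner_add_left, inner_smul_left, inner_sub_right, inner_sub_right]
      simp only [map_neg, Complex.conj_I, neg_neg]
      linear_combination h1 - h2
    have hyx : y = x := sub_eq_zero.1 hz
    subst hyx
    have : x' = y' := add_right_cancel hxy
    rwa [← this]
  · rintro ⟨y, y'⟩ hy
    rw [Submodule.mem_adjoint_iff]
    intro a b hab
    exact sub_eq_zero.2 (h.symm _ _ _ _ hab hy)

theorem one_add_pos (h : SqDiagonal T w κ) (k : ι) : 0 < 1 + κ k := by
  have := h.nonneg k
  linarith

theorem invOneAddSq_apply [CompleteSpace E] (h : SqDiagonal T w κ) (k : ι) :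
    invOneAddSq T (w k) = (((1 + κ k)⁻¹ : ℝ) : ℂ) • w k := by
  obtain ⟨u, h1, h2⟩ := h.sq k
  refine h.symm.eq_of_isInvOneAddSq (isInvOneAddSq_invOneAddSq h.isSelfAdjoint)
    (T.graph.smul_mem _ h1) ?_
  have h3 := T.graph.smul_mem (((1 + κ k)⁻¹ : ℝ) : ℂ) h2
  convert! h3 using 1
  refine Prod.ext rfl ?_
  change w k - (((1 + κ k)⁻¹ : ℝ) : ℂ) • w k = (((1 + κ k)⁻¹ : ℝ) : ℂ) • (κ k : ℂ) • w k
  have hk : (1 + κ k : ℂ) ≠ 0 := by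
    have := (h.one_add_pos k).ne'
    exact_mod_cast this
  rw [sub_eq_iff_eq_add, smul_smul, ← add_smul]
  conv_lhs => rw [← one_smul ℂ (w k)]
  congr 1
  push_cast
  field_simp
  ring

theorem rpow_apply [CompleteSpace E] (h : SqDiagonal T w κ) {s : ℝ} (hs : 0 ≤ s) (k : ι) :
    (invOneAddSq T ^ s) (w k) = (((1 + κ k) ^ (-s) : ℝ) : ℂ) • w k := by
  rw [rpow_apply_of_eigenvector
    (h.symm.nonneg_of_isInvOneAddSq (isInvOneAddSq_invOneAddSq h.isSelfAdjoint))
    (h.invOneAddSq_apply k) hs, Real.inv_rpow (h.one_add_pos k).le,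
    Real.rpow_neg (h.one_add_pos k).le]

theorem zeta_eq [CompleteSpace E] (h : SqDiagonal T w κ) {t : ℝ} (ht : 0 < t) :
    zeta T t = ∑' k, ENNReal.ofReal ((1 + κ k) ^ (-(t / 2))) :=
  posTrace_diagonal w (h.rpow_apply (by positivity))
    fun k => Real.rpow_nonneg (h.one_add_pos k).le _

theorem isCompactOperator [CompleteSpace E] (h : SqDiagonal T w κ)
    (hf : ∀ C, {k | κ k ≤ C}.Finite) : IsCompactOperator (invOneAddSq T ^ (1 / 2 : ℝ)) := by
  refine isCompactOperator_diagonal w (h.rpow_apply (by positivity)) fun ε hε => ?_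
  -- `ε < (1 + κ)^(-1/2)` amounts to `1 + κ < ε⁻²`.
  refine (hf (ε⁻¹ ^ 2)).subset fun k hk => ?_
  have hpos := h.one_add_pos k
  have h1 : ε < (1 + κ k) ^ (-(1 / 2 : ℝ)) := by
    have h2 : ε < |(1 + κ k) ^ (-(1 / 2 : ℝ))| := hk
    rwa [abs_of_nonneg (Real.rpow_nonneg hpos.le _)] at h2
  rw [Real.rpow_neg hpos.le, ← Real.sqrt_eq_rpow, lt_inv_comm₀ hε (Real.sqrt_pos.2 hpos)] at h1
  have h3 := (Real.sqrt_lt' (by positivity)).1 h1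
  change κ k ≤ _
  linarith

theorem finite_le [CompleteSpace E] (h : SqDiagonal T w κ)
    (hc : IsCompactOperator (invOneAddSq T ^ (1 / 2 : ℝ))) (C : ℝ) : {k | κ k ≤ C}.Finite := by
  -- The absolute value keeps the base positive for negative `C`.
  have hC : (0 : ℝ) < 1 + |C| := by positivity
  refine (finite_of_isCompactOperator_diagonal w (h.rpow_apply (by positivity)) hc
    (Real.rpow_pos_of_pos hC (-(1 / 2)))).subset fun k hk => ?_
  have hpos := h.one_add_pos k
  change _ ≤ |(1 + κ k) ^ (-(1 / 2 : ℝ))|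
  rw [abs_of_nonneg (Real.rpow_nonneg hpos.le _)]
  refine Real.rpow_le_rpow_of_nonpos hpos ?_ (by norm_num)
  have hk : κ k ≤ C := hk
  linarith [le_abs_self C]

end SqDiagonal

/-- A self-adjoint operator with compact resolvent is diagonalizable. -/
theorem exists_sqDiagonal.{u} {E : Type u} [NormedAddCommGroup E] [InnerProductSpace ℂ E]
    [CompleteSpace E] {T : E →ₗ.[ℂ] E} (hT : IsSelfAdjoint T)
    (hc : IsCompactOperator (invOneAddSq T ^ (1 / 2 : ℝ))) :
    ∃ (ι : Type u) (w : HilbertBasis ι ℂ E) (κ : ι → ℝ), SqDiagonal T w κ := by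
  have hsymm := isSymmGraph_of_isSelfAdjoint hT
  have hinv := isInvOneAddSq_invOneAddSq hT
  have hpos := hsymm.nonneg_of_isInvOneAddSq hinv
  -- The resolvent is the product of its compact square root with itself.
  have hcR : IsCompactOperator (invOneAddSq T) := by
    have h1 : invOneAddSq T = invOneAddSq T ^ (1 / 2 : ℝ) * invOneAddSq T ^ (1 / 2 : ℝ) := by
      rw [← CFC.sqrt_eq_rpow, CFC.sqrt_mul_sqrt_self _ hpos]
    rw [h1]
    exact hc.comp_clm (invOneAddSq T ^ (1 / 2 : ℝ))
  obtain ⟨ι, w, r, hr⟩ := exists_hilbertBasis_eigenvectors hcR (IsSelfAdjoint.of_nonneg hpos)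
  -- An eigenvalue `r` of `(1 + T²)⁻¹` corresponds to the eigenvalue `1/r - 1` of `T²`.
  refine ⟨ι, w, fun k => (r k)⁻¹ - 1, hsymm, hT.isClosed, fun k => ?_⟩
  obtain ⟨ζ, h1, h2⟩ := hinv (w k)
  -- The inverse of `1 + T²` is injective: if `R w = 0` then `T R w = 0`, and `w = R w + T(T R w)`
  -- vanishes.
  have hr0 : (r k : ℂ) ≠ 0 := by
    intro h0
    rw [hr, h0, zero_smul] at h1 h2
    have hζ : ζ = 0 := T.graph_fst_eq_zero_snd h1 rfl
    rw [hζ, sub_zero] at h2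
    exact w.orthonormal.ne_zero k (T.graph_fst_eq_zero_snd h2 rfl)
  refine ⟨(r k : ℂ)⁻¹ • ζ, ?_, ?_⟩
  · have := T.graph.smul_mem (r k : ℂ)⁻¹ h1
    rwa [hr, Prod.smul_mk, smul_smul, inv_mul_cancel₀ hr0, one_smul] at this
  · have := T.graph.smul_mem (r k : ℂ)⁻¹ h2
    rw [hr] at this
    convert! this using 1
    refine Prod.ext rfl ?_
    change _ = (r k : ℂ)⁻¹ • (w k - (r k : ℂ) • w k)
    rw [smul_sub, smul_smul, inv_mul_cancel₀ hr0, one_smul]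
    push_cast
    rw [sub_smul, one_smul]

end SqDiagonal

/-! ### Slices of tensors -/

section Slice

variable {X : Type*} [NormedAddCommGroup X] [InnerProductSpace ℂ X]
  {Y : Type*} [NormedAddCommGroup Y] [InnerProductSpace ℂ Y]
  {V : Type*} [NormedAddCommGroup V] [InnerProductSpace ℂ V]

/-- The slice map `x ⊗ u ↦ ⟨v, u⟩ x`. -/
def slice (v : V) : X ⊗[ℂ] V →L[ℂ] X :=
  ((TensorProduct.ridIsometry ℂ X).toContinuousLinearEquiv : X ⊗[ℂ] ℂ →L[ℂ] X) ∘L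
    (innerSL ℂ v).lTensor X

@[simp]
theorem slice_tmul (v u : V) (x : X) : slice v (x ⊗ₜ[ℂ] u) = inner ℂ v u • x := by
  simp [slice]

theorem sum_slice_tmul {n : Type*} [Fintype n] (b : OrthonormalBasis n ℂ V) (z : X ⊗[ℂ] V) :
    ∑ i, slice (b i) z ⊗ₜ[ℂ] b i = z := by
  induction z using TensorProduct.induction_on with
  | zero => simp
  | add x y hx hy =>
    simp only [map_add, TensorProduct.add_tmul, Finset.sum_add_distrib, hx, hy]
  | tmul h v =>
    simp only [slice_tmul, TensorProduct.smul_tmul, ← TensorProduct.tmul_sum]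
    rw [b.sum_repr' v]

theorem eq_zero_of_slice [FiniteDimensional ℂ V] {z : X ⊗[ℂ] V} (h : ∀ v : V, slice v z = 0) :
    z = 0 := by
  rw [← sum_slice_tmul (stdOrthonormalBasis ℂ V) z]
  simp [h]

theorem inner_tmul_left_eq (x : X) (v : V) (z : X ⊗[ℂ] V) :
    inner ℂ (x ⊗ₜ[ℂ] v) z = inner ℂ x (slice v z) := by
  induction z using TensorProduct.induction_on with
  | zero => simp
  | add x y hx hy => simp only [map_add, inner_add_right, hx, hy]
  | tmul y u => rw [TensorProduct.inner_tmul, slice_tmul, inner_smul_right, mul_comm]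

theorem inner_eq_sum_slice {n : Type*} [Fintype n] (b : OrthonormalBasis n ℂ V)
    (z z' : X ⊗[ℂ] V) : inner ℂ z z' = ∑ i, inner ℂ (slice (b i) z) (slice (b i) z') := by
  conv_lhs => rw [← sum_slice_tmul b z]
  rw [sum_inner]
  exact Finset.sum_congr rfl fun i _ => inner_tmul_left_eq _ _ _

theorem slice_rTensor (S : X →L[ℂ] Y) (v : V) (z : X ⊗[ℂ] V) :
    slice v (S.rTensor V z) = S (slice v z) := by
  induction z using TensorProduct.induction_on with
  | zero => simp
  | add x y hx hy => simp only [map_add, hx, hy]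
  | tmul y u =>
    rw [ContinuousLinearMap.rTensor_tmul, slice_tmul, slice_tmul, map_smul]

theorem slice_lTensor [CompleteSpace V] (L : V →L[ℂ] V) (v : V) (z : X ⊗[ℂ] V) :
    slice v (L.lTensor X z) = slice (ContinuousLinearMap.adjoint L v) z := by
  induction z using TensorProduct.induction_on with
  | zero => simp
  | add x y hx hy => simp only [map_add, hx, hy]
  | tmul y u =>
    rw [ContinuousLinearMap.lTensor_tmul, slice_tmul, slice_tmul,
      ContinuousLinearMap.adjoint_inner_left]

theorem rTensor_lTensor_apply (S : X →L[ℂ] Y) (L : V →L[ℂ] V) (z : X ⊗[ℂ] V) :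
    S.rTensor V (L.lTensor X z) = L.lTensor Y (S.rTensor V z) := by
  induction z using TensorProduct.induction_on with
  | zero => simp
  | add x y hx hy => simp only [map_add, hx, hy]
  | tmul y u => rfl

variable [FiniteDimensional ℂ V]

/-- The graph of `D ⊗ 1_V` consists of the pairs whose slices lie in the graph of `D`. -/
theorem mem_graph_tensorOp {D : X →ₗ.[ℂ] Y} {p : (X ⊗[ℂ] V) × (Y ⊗[ℂ] V)} :
    p ∈ (tensorOp V D).graph ↔ ∀ v : V, (slice v p.1, slice v p.2) ∈ D.graph := by
  set Γ := Submodule.span ℂ {p : (X ⊗[ℂ] V) × (Y ⊗[ℂ] V) |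
    ∃ (ξ : D.domain) (v : V), p = ((ξ : X) ⊗ₜ[ℂ] v, D ξ ⊗ₜ[ℂ] v)} with hΓ
  have h1 : ∀ p ∈ Γ, ∀ v : V, (slice v p.1, slice v p.2) ∈ D.graph := by
    intro p hp v
    induction hp using Submodule.span_induction with
    | mem p hp =>
      obtain ⟨ξ, u, rfl⟩ := hp
      simp only [slice_tmul]
      exact D.graph.smul_mem (inner ℂ v u) (D.mem_graph ξ)
    | zero => simp
    | add p q _ _ hp hq => simpa using D.graph.add_mem hp hq
    | smul c p _ hp => simpa using D.graph.smul_mem c hp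
  -- `toLinearPMap` has the given submodule as its graph only if that submodule is single valued;
  -- the slices reduce this to `D`.
  have h2 : ∀ p ∈ Γ, p.1 = 0 → p.2 = 0 := fun p hp h0 => eq_zero_of_slice fun v =>
    D.graph_fst_eq_zero_snd (h1 p hp v) (by rw [h0, map_zero])
  have h3 : (tensorOp V D).graph = Γ := Submodule.toLinearPMap_graph_eq Γ h2
  rw [h3]
  refine ⟨h1 p, fun h => ?_⟩
  let b := stdOrthonormalBasis ℂ V
  have h4 : p = ∑ i, (slice (b i) p.1 ⊗ₜ[ℂ] b i, slice (b i) p.2 ⊗ₜ[ℂ] b i) := by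
    refine Prod.ext ?_ ?_
    · rw [Prod.fst_sum, sum_slice_tmul]
    · rw [Prod.snd_sum, sum_slice_tmul]
  rw [h4]
  refine sum_mem fun i _ => Submodule.subset_span ?_
  obtain ⟨x, hx1, hx2⟩ := D.mem_graph_iff.1 (h (b i))
  exact ⟨x, b i, by rw [hx1, hx2]⟩

theorem tmul_mem_graph_tensorOp {D : X →ₗ.[ℂ] Y} {x : X} {x' : Y} (h : (x, x') ∈ D.graph)
    (v : V) : (x ⊗ₜ[ℂ] v, x' ⊗ₜ[ℂ] v) ∈ (tensorOp V D).graph := by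
  rw [mem_graph_tensorOp]
  intro u
  simp only [slice_tmul]
  exact D.graph.smul_mem _ h

/-- By the slice description the graph is an intersection of preimages of a closed set under
continuous maps. -/
theorem isClosed_graph_tensorOp {D : X →ₗ.[ℂ] Y} (h : IsClosed (D.graph : Set (X × Y))) :
    IsClosed ((tensorOp V D).graph : Set ((X ⊗[ℂ] V) × (Y ⊗[ℂ] V))) := by
  have : ((tensorOp V D).graph : Set ((X ⊗[ℂ] V) × (Y ⊗[ℂ] V)))
      = ⋂ v : V, (fun p => (slice v p.1, slice v p.2)) ⁻¹' D.graph := by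
    ext p
    rw [Set.mem_iInter]
    exact mem_graph_tensorOp
  rw [this]
  exact isClosed_iInter fun v => h.preimage (by fun_prop)

theorem IsSymmGraph.tensorOp {D : X →ₗ.[ℂ] X} (h : IsSymmGraph D) :
    IsSymmGraph (tensorOp V D) := by
  intro x x' y y' hx hy
  rw [inner_eq_sum_slice (stdOrthonormalBasis ℂ V), inner_eq_sum_slice (stdOrthonormalBasis ℂ V)]
  exact Finset.sum_congr rfl fun i _ =>
    h _ _ _ _ (mem_graph_tensorOp.1 hx _) (mem_graph_tensorOp.1 hy _)

end Slice

/-! ### Pointwise operators on `ℓ²(G, K)` -/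

section Pointwise

variable {G : Type*} {K : Type*} [NormedAddCommGroup K] [InnerProductSpace ℂ K]
  {K' : Type*} [NormedAddCommGroup K'] [InnerProductSpace ℂ K']

theorem summable_norm_sq {K : Type*} [NormedAddCommGroup K] (ξ : L2 G K) : Summable fun y => ‖ξ y‖ ^ 2 := by
  simpa using (memℓp_gen_iff (p := 2) (by norm_num)).1 (lp.memℓp ξ)

theorem norm_sq_eq_tsum {K : Type*} [NormedAddCommGroup K] (ξ : L2 G K) : ‖ξ‖ ^ 2 = ∑' y, ‖ξ y‖ ^ 2 := by
  simpa using lp.norm_rpow_eq_tsum (p := 2) (by norm_num) ξ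

/-- The operator `1_{ℓ²(G)} ⊗ S` on `ℓ²(G, K)`. -/
def lmap (S : K →L[ℂ] K') : L2 G K →L[ℂ] L2 G K' :=
  LinearMap.mkContinuous
    { toFun := fun ξ => ⟨fun y => S (ξ y), memℓp_gen (p := 2) (by
        have h : Summable fun y => ‖S (ξ y)‖ ^ 2 :=
          Summable.of_nonneg_of_le (fun _ => by positivity)
            (fun y => by rw [← mul_pow]; gcongr; exact S.le_opNorm _)
            ((summable_norm_sq ξ).mul_left (‖S‖ ^ 2))
        simpa using h)⟩
      map_add' := fun ξ η => by ext y; exact S.map_add _ _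
      map_smul' := fun z ξ => by ext y; exact S.map_smul _ _ }
    ‖S‖ fun ξ => by
      rw [← sq_le_sq₀ (norm_nonneg _) (by positivity), mul_pow, norm_sq_eq_tsum, norm_sq_eq_tsum,
        ← tsum_mul_left]
      refine Summable.tsum_le_tsum (fun y => ?_) (summable_norm_sq _)
        ((summable_norm_sq ξ).mul_left (‖S‖ ^ 2))
      rw [← mul_pow]
      gcongr
      exact S.le_opNorm _

@[simp]
theorem lmap_apply (S : K →L[ℂ] K') (ξ : L2 G K) (y : G) : lmap S ξ y = S (ξ y) := rfl

theorem inner_lmap [CompleteSpace K] [CompleteSpace K'] (S : K →L[ℂ] K') (ξ : L2 G K)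
    (η : L2 G K') :
    inner ℂ (lmap S ξ) η = inner ℂ ξ (lmap (ContinuousLinearMap.adjoint S) η) := by
  rw [lp.inner_eq_tsum, lp.inner_eq_tsum]
  exact tsum_congr fun y => (ContinuousLinearMap.adjoint_inner_right _ _ _).symm

theorem lmap_single [DecidableEq G] (S : K →L[ℂ] K') (y : G) (x : K) :
    lmap S (lp.single 2 y x : L2 G K) = lp.single 2 y (S x) := by
  ext z
  rw [lmap_apply, lp.single_apply, lp.single_apply]
  by_cases h : z = y
  · subst h; simp
  · simp [h]

end Pointwise

/-- In graph form the domain condition becomes plain membership in a subspace, which passes easily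
through sums, slices, direct sums and unitaries. -/
theorem isCommutator_iff {H : Type*} [NormedAddCommGroup H] [InnerProductSpace ℂ H]
    {D : H →ₗ.[ℂ] H} {S T : H →L[ℂ] H} :
    IsCommutator D S T ↔ ∀ x x', (x, x') ∈ D.graph → (S x, S x' + T x) ∈ D.graph := by
  constructor
  · intro h x x' hx
    obtain ⟨y, rfl, rfl⟩ := D.mem_graph_iff.1 hx
    obtain ⟨hy, hy'⟩ := h y
    rw [← hy', add_sub_cancel]
    exact D.mem_graph ⟨_, hy⟩
  · intro h ξ
    have h1 := h _ _ (D.mem_graph ξ)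
    obtain ⟨y, hy, hy'⟩ := D.mem_graph_iff.1 h1
    have hm : S ξ ∈ D.domain := LinearPMap.mem_domain_of_mem_graph h1
    refine ⟨hm, ?_⟩
    have : (⟨S ξ, hm⟩ : D.domain) = y := Subtype.ext hy.symm
    rw [this, hy', add_sub_cancel_left]

theorem isCommutator_sum {H : Type*} [NormedAddCommGroup H] [InnerProductSpace ℂ H]
    {D : H →ₗ.[ℂ] H} {ι : Type*} (s : Finset ι) {S T : ι → H →L[ℂ] H}
    (h : ∀ i ∈ s, IsCommutator D (S i) (T i)) :
    IsCommutator D (∑ i ∈ s, S i) (∑ i ∈ s, T i) := by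
  rw [isCommutator_iff]
  intro x x' hx
  have : ((∑ i ∈ s, S i) x, (∑ i ∈ s, S i) x' + (∑ i ∈ s, T i) x)
      = ∑ i ∈ s, (S i x, S i x' + T i x) := by
    refine Prod.ext ?_ ?_
    · simp [Prod.fst_sum]
    · simp [Prod.snd_sum, Finset.sum_add_distrib]
  rw [this]
  exact sum_mem fun i hi => isCommutator_iff.1 (h i hi) _ _ hx

/-! ### The Dirac operator `D ⊗ 1 + J ⊗ M_ℓ` -/

section Model

set_option linter.unusedSectionVars false

variable {G : Type*} {X : Type*} [NormedAddCommGroup X] [InnerProductSpace ℂ X] [CompleteSpace X]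
  {V : Type*} [NormedAddCommGroup V] [InnerProductSpace ℂ V] [FiniteDimensional ℂ V]
  [CompleteSpace V]
  {E : Type*} [NormedAddCommGroup E] [InnerProductSpace ℂ E]

/-- `J` is a self-adjoint unitary which anticommutes with `D`. -/
structure IsAnticommuting (D : X →ₗ.[ℂ] X) (J : X →L[ℂ] X) : Prop where
  adjoint : ContinuousLinearMap.adjoint J = J
  sq : ∀ x, J (J x) = x
  anticomm : ∀ x x', (x, x') ∈ D.graph → (J x, -J x') ∈ D.graph

/-- The unitary `U` transforms `T` to the operator `D ⊗ 1 + J ⊗ M_ℓ` on `ℓ²(G, X ⊗ V)`, with domain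
the intersection of the domains of `D ⊗ 1` and `1 ⊗ M_ℓ`. -/
def IsDiracModel (ℓ : G → selfAdjoint (V →L[ℂ] V)) (D : X →ₗ.[ℂ] X) (J : X →L[ℂ] X)
    (T : E →ₗ.[ℂ] E) (U : E ≃ₗᵢ[ℂ] L2 G (X ⊗[ℂ] V)) : Prop :=
  ∀ ξ ξ', (ξ, ξ') ∈ T.graph ↔ ∃ u m : L2 G (X ⊗[ℂ] V),
    (∀ y, (U ξ y, u y) ∈ (tensorOp V D).graph) ∧
    (∀ y, m y = (ℓ y : V →L[ℂ] V).lTensor X (U ξ y)) ∧ U ξ' = u + lmap (J.rTensor V) m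

variable {D : X →ₗ.[ℂ] X} {J : X →L[ℂ] X}

theorem IsAnticommuting.mem_graph_rTensor (hJ : IsAnticommuting D J) {z z' : X ⊗[ℂ] V}
    (h : (z, z') ∈ (tensorOp V D).graph) :
    (J.rTensor V z, -J.rTensor V z') ∈ (tensorOp V D).graph := by
  rw [mem_graph_tensorOp] at h ⊢
  intro v
  simpa only [map_neg, slice_rTensor] using hJ.anticomm _ _ (h v)

theorem mem_graph_lTensor (L : V →L[ℂ] V) {z z' : X ⊗[ℂ] V}
    (h : (z, z') ∈ (tensorOp V D).graph) :
    (L.lTensor X z, L.lTensor X z') ∈ (tensorOp V D).graph := by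
  rw [mem_graph_tensorOp] at h ⊢
  intro v
  simpa only [slice_lTensor] using h (ContinuousLinearMap.adjoint L v)

theorem IsAnticommuting.adjoint_rTensor (hJ : IsAnticommuting D J) :
    ContinuousLinearMap.adjoint (J.rTensor V) = J.rTensor V := by
  rw [ContinuousLinearMap.adjoint_rTensor, hJ.adjoint]

theorem IsAnticommuting.rTensor_sq (hJ : IsAnticommuting D J) (z : X ⊗[ℂ] V) :
    J.rTensor V (J.rTensor V z) = z := by
  induction z using TensorProduct.induction_on with
  | zero => simp
  | add x y hx hy => simp only [map_add, hx, hy]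
  | tmul y u => rw [ContinuousLinearMap.rTensor_tmul, ContinuousLinearMap.rTensor_tmul, hJ.sq]

theorem IsAnticommuting.inner_rTensor_lTensor (hJ : IsAnticommuting D J)
    (L : selfAdjoint (V →L[ℂ] V)) (z z' : X ⊗[ℂ] V) :
    inner ℂ (J.rTensor V ((L : V →L[ℂ] V).lTensor X z)) z'
      = inner ℂ z (J.rTensor V ((L : V →L[ℂ] V).lTensor X z')) := by
  have hL : ContinuousLinearMap.adjoint (L : V →L[ℂ] V) = L := L.2
  rw [← ContinuousLinearMap.adjoint_inner_right, hJ.adjoint_rTensor,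
    ← ContinuousLinearMap.adjoint_inner_right, ContinuousLinearMap.adjoint_lTensor, hL,
    rTensor_lTensor_apply]

theorem IsAnticommuting.inner_lmap_eq (hJ : IsAnticommuting D J) (ξ η : L2 G (X ⊗[ℂ] V)) :
    inner ℂ (lmap (J.rTensor V) ξ) η = inner ℂ ξ (lmap (J.rTensor V) η) := by
  rw [inner_lmap, hJ.adjoint_rTensor]

theorem IsAnticommuting.norm_lmap_eq (hJ : IsAnticommuting D J) (ξ : L2 G (X ⊗[ℂ] V)) :
    ‖lmap (J.rTensor V) ξ‖ = ‖ξ‖ := by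
  rw [← sq_eq_sq₀ (norm_nonneg _) (norm_nonneg _), ← inner_self_eq_norm_sq (𝕜 := ℂ),
    ← inner_self_eq_norm_sq (𝕜 := ℂ), hJ.inner_lmap_eq]
  congr 2
  ext y
  exact hJ.rTensor_sq _

variable {ℓ : G → selfAdjoint (V →L[ℂ] V)} {T : E →ₗ.[ℂ] E} {U : E ≃ₗᵢ[ℂ] L2 G (X ⊗[ℂ] V)}

theorem IsDiracModel.isSymmGraph (hT : IsDiracModel ℓ D J T U) (hJ : IsAnticommuting D J)
    (hD : IsSymmGraph D) : IsSymmGraph T := by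
  intro x x' y y' hx hy
  obtain ⟨u, m, hu, hm, hx'⟩ := (hT _ _).1 hx
  obtain ⟨v, n, hv, hn, hy'⟩ := (hT _ _).1 hy
  rw [← U.inner_map_map, ← U.inner_map_map x, hx', hy', inner_add_left, inner_add_right]
  congr 1
  · rw [lp.inner_eq_tsum, lp.inner_eq_tsum]
    exact tsum_congr fun z => hD.tensorOp _ _ _ _ (hu z) (hv z)
  · rw [lp.inner_eq_tsum, lp.inner_eq_tsum]
    refine tsum_congr fun z => ?_
    rw [lmap_apply, lmap_apply, hm, hn]
    exact hJ.inner_rTensor_lTensor _ _ _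

/-- `D ⊗ 1` and `J ⊗ M_ℓ` anticommute fibre by fibre, where `ℓ(y)` is bounded and preserves the
domain, so the cross term is purely imaginary. The graph norm of the sum therefore controls both
summands separately. -/
theorem norm_add_lmap_sq (hJ : IsAnticommuting D J) (hD : IsSymmGraph D)
    {ξ u m : L2 G (X ⊗[ℂ] V)} (hu : ∀ y, (ξ y, u y) ∈ (tensorOp V D).graph)
    (hm : ∀ y, m y = (ℓ y : V →L[ℂ] V).lTensor X (ξ y)) :
    ‖u + lmap (J.rTensor V) m‖ ^ 2 = ‖u‖ ^ 2 + ‖m‖ ^ 2 := by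
  have h0 : inner ℂ u (lmap (J.rTensor V) m) = -inner ℂ (lmap (J.rTensor V) m) u := by
    rw [lp.inner_eq_tsum, lp.inner_eq_tsum, ← tsum_neg]
    refine tsum_congr fun y => ?_
    have h1 := hJ.mem_graph_rTensor (mem_graph_lTensor (ℓ y : V →L[ℂ] V) (hu y))
    have h2 := hD.tensorOp _ _ _ _ (hu y) h1
    rw [lmap_apply, hm, h2, inner_neg_right, hJ.inner_rTensor_lTensor]
  have h3 : RCLike.re (inner ℂ u (lmap (J.rTensor V) m)) = 0 := by
    have h4 := congrArg RCLike.re h0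
    rw [map_neg, inner_re_symm (lmap (J.rTensor V) m) u] at h4
    linarith
  rw [@norm_add_sq ℂ, h3, hJ.norm_lmap_eq]
  ring

/-- The graph is the image of the closed space of triples `(ξ, (D ⊗ 1)ξ, (1 ⊗ M_ℓ)ξ)` under a
bounded map which is bounded below by `norm_add_lmap_sq`; such an image is closed. -/
theorem IsDiracModel.isClosed_graph (hT : IsDiracModel ℓ D J T U) (hJ : IsAnticommuting D J)
    (hD : IsSymmGraph D) (hDc : IsClosed (D.graph : Set (X × X))) :
    IsClosed (T.graph : Set (E × E)) := by
  let L := L2 G (X ⊗[ℂ] V)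
  let W : Submodule ℂ (L × L × L) :=
    { carrier := {p | (∀ y, (p.1 y, p.2.1 y) ∈ (tensorOp V D).graph) ∧
        ∀ y, p.2.2 y = (ℓ y : V →L[ℂ] V).lTensor X (p.1 y)}
      add_mem' := fun hp hq => ⟨fun y => (tensorOp V D).graph.add_mem (hp.1 y) (hq.1 y), fun y => by
        change _ + _ = ContinuousLinearMap.lTensor X _ (_ + _)
        rw [map_add, hp.2, hq.2]⟩
      zero_mem' := ⟨fun y => (tensorOp V D).graph.zero_mem, fun y => (map_zero _).symm⟩
      smul_mem' := fun c p hp => ⟨fun y => (tensorOp V D).graph.smul_mem c (hp.1 y), fun y => by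
        change c • p.2.2 y = ContinuousLinearMap.lTensor X _ (c • p.1 y)
        rw [map_smul, hp.2]⟩ }
  have hev : ∀ y : G, Continuous fun ξ : L => ξ y := fun y =>
    (lp.evalCLM ℂ (fun _ : G => X ⊗[ℂ] V) 2 y).continuous
  have hWc : IsClosed (W : Set (L × L × L)) := by
    have : (W : Set (L × L × L)) = (⋂ y, (fun p : L × L × L => (p.1 y, p.2.1 y)) ⁻¹'
        (tensorOp V D).graph) ∩ ⋂ y, {p : L × L × L |
          p.2.2 y = (ℓ y : V →L[ℂ] V).lTensor X (p.1 y)} := by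
      ext p
      rw [Set.mem_inter_iff, Set.mem_iInter, Set.mem_iInter]
      rfl
    rw [this]
    refine (isClosed_iInter fun y => ?_).inter (isClosed_iInter fun y => ?_)
    · exact (isClosed_graph_tensorOp hDc).preimage
        (((hev y).comp continuous_fst).prodMk ((hev y).comp (continuous_fst.comp continuous_snd)))
    · exact isClosed_eq ((hev y).comp (continuous_snd.comp continuous_snd))
        (((ℓ y : V →L[ℂ] V).lTensor X).continuous.comp ((hev y).comp continuous_fst))
  have : CompleteSpace W := hWc.completeSpace_coe
  let Φ : W →L[ℂ] E × E :=
    (((U.symm : L →L[ℂ] E) ∘L ContinuousLinearMap.fst ℂ L (L × L)).prod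
      ((U.symm : L →L[ℂ] E) ∘L (ContinuousLinearMap.fst ℂ L L
        + lmap (J.rTensor V) ∘L ContinuousLinearMap.snd ℂ L L) ∘L
        ContinuousLinearMap.snd ℂ L (L × L))) ∘L W.subtypeL
  have hΦ : ∀ p : W, Φ p = (U.symm (p : L × L × L).1,
      U.symm ((p : L × L × L).2.1 + lmap (J.rTensor V) (p : L × L × L).2.2)) := fun p => rfl
  have hnorm : ∀ p : W, ‖p‖ ≤ ‖Φ p‖ := by
    rintro ⟨⟨ξ, u, m⟩, hu, hm⟩
    have h1 := norm_add_lmap_sq hJ hD hu hm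
    rw [hΦ]
    change max ‖ξ‖ (max ‖u‖ ‖m‖) ≤ max ‖U.symm ξ‖ ‖U.symm (u + lmap (J.rTensor V) m)‖
    rw [U.symm.norm_map, U.symm.norm_map]
    refine max_le_max le_rfl (max_le ?_ ?_) <;>
    · rw [← sq_le_sq₀ (norm_nonneg _) (norm_nonneg _)]
      exact h1 ▸ (by nlinarith [sq_nonneg ‖u‖, sq_nonneg ‖m‖])
  have hanti : AntilipschitzWith 1 Φ :=
    AddMonoidHomClass.antilipschitz_of_bound Φ fun p => by simpa using hnorm p
  have hcl : IsClosed (Set.range Φ) := hanti.isClosed_range Φ.uniformContinuous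
  convert hcl
  ext ⟨ξ, ξ'⟩
  refine (hT ξ ξ').trans ⟨?_, ?_⟩
  · rintro ⟨u, m, hu, hm, h⟩
    refine ⟨⟨(U ξ, u, m), hu, hm⟩, ?_⟩
    rw [hΦ]
    change (U.symm (U ξ), U.symm (u + _)) = _
    rw [← h, U.symm_apply_apply, U.symm_apply_apply]
  · rintro ⟨⟨⟨ζ, u, m⟩, hu, hm⟩, hp⟩
    rw [hΦ, Prod.mk.injEq] at hp
    obtain ⟨rfl, rfl⟩ := hp
    refine ⟨u, m, ?_, ?_, U.apply_symm_apply _⟩ <;> rw [U.apply_symm_apply]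
    exacts [hu, hm]

theorem IsDiracModel.single_mem_graph [DecidableEq G] (hT : IsDiracModel ℓ D J T U) (y : G)
    {a b : X ⊗[ℂ] V} (h : (a, b) ∈ (tensorOp V D).graph) :
    (U.symm (lp.single 2 y a), U.symm (lp.single 2 y
      (b + J.rTensor V ((ℓ y : V →L[ℂ] V).lTensor X a)))) ∈ T.graph := by
  rw [hT]
  refine ⟨lp.single 2 y b, lp.single 2 y ((ℓ y : V →L[ℂ] V).lTensor X a), fun z => ?_,
    fun z => ?_, ?_⟩
  · rw [U.apply_symm_apply, lp.single_apply, lp.single_apply]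
    by_cases hz : z = y
    · subst hz; simpa using h
    · simp [hz]
  · rw [U.apply_symm_apply, lp.single_apply, lp.single_apply]
    by_cases hz : z = y
    · subst hz; simp
    · simp [hz]
  · rw [U.apply_symm_apply, lmap_single, lp.single_add]

/-- The Hilbert basis `δ_y ⊗ e_i ⊗ v_{y,j}` of `ℓ²(G, X ⊗ V)`. -/
theorem exists_hilbertBasis_single [DecidableEq G] [CompleteSpace E]
    (U : E ≃ₗᵢ[ℂ] L2 G (X ⊗[ℂ] V)) {ι n : Type*} [Fintype n]
    (e : HilbertBasis ι ℂ X) (v : G → OrthonormalBasis n ℂ V) :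
    ∃ w : HilbertBasis (ι × G × n) ℂ E,
      ∀ i y j, w (i, y, j) = U.symm (lp.single 2 y (e i ⊗ₜ[ℂ] v y j)) := by
  classical
  let w : ι × G × n → E := fun k => U.symm (lp.single 2 k.2.1 (e k.1 ⊗ₜ[ℂ] v k.2.1 k.2.2))
  have hw : Orthonormal ℂ w := by
    rw [orthonormal_iff_ite]
    rintro ⟨i, y, j⟩ ⟨i', y', j'⟩
    simp only [w, LinearIsometryEquiv.inner_map_map, lp.inner_single_left, lp.single_apply]
    by_cases hy : y = y'
    · subst hy
      simp only [Pi.single_eq_same, TensorProduct.inner_tmul, orthonormal_iff_ite.1 e.orthonormal,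
        (v y).inner_eq_ite, Prod.mk.injEq, true_and]
      by_cases h1 : i = i' <;> by_cases h2 : j = j' <;> simp [h1, h2]
    · simp [hy]
  refine ⟨HilbertBasis.mkOfOrthogonalEqBot hw ?_, fun i y j => ?_⟩
  · rw [eq_bot_iff]
    intro x hx
    rw [Submodule.mem_bot, ← U.map_eq_zero_iff]
    ext1
    funext y
    change U x y = 0
    rw [← sum_slice_tmul (v y) (U x y)]
    refine Finset.sum_eq_zero fun j _ => ?_
    have h0 : slice (v y j) (U x y) = 0 := by
      have : e.repr (slice (v y j) (U x y)) = 0 := by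
        ext i
        rw [e.repr_apply_apply, ← inner_tmul_left_eq]
        have := (Submodule.mem_orthogonal _ _).1 hx _ (Submodule.subset_span ⟨(i, y, j), rfl⟩)
        rw [← U.inner_map_map] at this
        simp only [w, U.apply_symm_apply, lp.inner_single_left] at this
        exact this
      simpa using this
    rw [h0, TensorProduct.zero_tmul]
  · rw [HilbertBasis.coe_mkOfOrthogonalEqBot]

/-- On elementary tensors `T²` can be computed inside a single fibre, where it is `D² ⊗ 1 + 1 ⊗
ℓ(y)²` by anticommutation. Symmetry and closedness are inherited from `D`. -/
theorem IsDiracModel.exists_sqDiagonal_single [CompleteSpace E] (hT : IsDiracModel ℓ D J T U)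
    (hJ : IsAnticommuting D J) {ι n : Type*} [Fintype n] {e : HilbertBasis ι ℂ X} {κ : ι → ℝ}
    (hD : SqDiagonal D e κ) {v : G → OrthonormalBasis n ℂ V} {μ : G → n → ℝ}
    (hv : ∀ y j, (ℓ y : V →L[ℂ] V) (v y j) = (μ y j : ℂ) • v y j) :
    ∃ w : HilbertBasis (ι × G × n) ℂ E,
      SqDiagonal T w fun k => κ k.1 + μ k.2.1 k.2.2 ^ 2 := by
  classical
  obtain ⟨w, hw⟩ := exists_hilbertBasis_single U e v
  refine ⟨w, hT.isSymmGraph hJ hD.symm, hT.isClosed_graph hJ hD.symm hD.closed, ?_⟩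
  rintro ⟨i, y, j⟩
  rw [hw]
  obtain ⟨u, h1, h2⟩ := hD.sq i
  have h3 := tmul_mem_graph_tensorOp h1 (v y j)
  have h4 := tmul_mem_graph_tensorOp h2 (v y j)
  -- For `a = e ⊗ v` and `b = De ⊗ v`, applying `D ⊗ 1` to `b + Jℓa` gives `κ a - Jℓb`; the last
  -- term cancels against the `Jℓb` produced by `J ⊗ ℓ`.
  have h5 := (tensorOp V D).graph.add_mem h4
    (hJ.mem_graph_rTensor (mem_graph_lTensor (ℓ y : V →L[ℂ] V) h3))
  refine ⟨_, hT.single_mem_graph y h3, ?_⟩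
  convert! hT.single_mem_graph y h5 using 2
  rw [← map_smul, ← lp.single_smul]
  congr 2
  rw [map_add, map_add, ← rTensor_lTensor_apply, hJ.rTensor_sq]
  simp only [ContinuousLinearMap.lTensor_tmul, ContinuousLinearMap.rTensor_tmul, hv, map_smul,
    TensorProduct.tmul_smul, ← TensorProduct.smul_tmul', smul_smul]
  push_cast
  module

end Model

/-! ### Commutators of the Dirac operator with the crossed product -/

section Commutators

set_option linter.unusedSectionVars false

variable {A : Type*} [CStarAlgebra A] {G : Type*} [Group G]
  {X : Type*} [NormedAddCommGroup X] [InnerProductSpace ℂ X] [CompleteSpace X]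
  {V : Type*} [NormedAddCommGroup V] [InnerProductSpace ℂ V] [FiniteDimensional ℂ V]
  [CompleteSpace V]
  {E : Type*} [NormedAddCommGroup E] [InnerProductSpace ℂ E]
  {D : X →ₗ.[ℂ] X} {J : X →L[ℂ] X}
  {ℓ : G → selfAdjoint (V →L[ℂ] V)} {T : E →ₗ.[ℂ] E} {U : E ≃ₗᵢ[ℂ] L2 G (X ⊗[ℂ] V)}
  {α : TwistedAction G A} {π : A →⋆ₐ[ℂ] (X →L[ℂ] X)}

theorem mem_graph_of_isCommutator {S B : X →L[ℂ] X} (h : IsCommutator D S B) {z z' : X ⊗[ℂ] V}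
    (hz : (z, z') ∈ (tensorOp V D).graph) :
    (S.rTensor V z, S.rTensor V z' + B.rTensor V z) ∈ (tensorOp V D).graph := by
  rw [mem_graph_tensorOp] at hz ⊢
  intro v
  simpa only [map_add, slice_rTensor] using isCommutator_iff.1 h _ _ (hz v)

/-- The operator `U⁻¹ S U`. -/
def conjBy (U : E ≃ₗᵢ[ℂ] L2 G (X ⊗[ℂ] V)) (S : L2 G (X ⊗[ℂ] V) →L[ℂ] L2 G (X ⊗[ℂ] V)) :
    E →L[ℂ] E :=
  (U.symm : L2 G (X ⊗[ℂ] V) →L[ℂ] E) ∘L S ∘L (U : E →L[ℂ] L2 G (X ⊗[ℂ] V))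

theorem conjBy_apply (S : L2 G (X ⊗[ℂ] V) →L[ℂ] L2 G (X ⊗[ℂ] V)) (ξ : E) :
    conjBy U S ξ = U.symm (S (U ξ)) := rfl

/-- `Π(a δ_x)` is a weighted shift. Commuting it with `D ⊗ 1` differentiates the weights, giving
`B₁`. Commuting it with `1 ⊗ M_ℓ` compares `ℓ` at the two ends of the shift, giving `B₂`, and `J`
passes through because it commutes with `π`. Both are weighted shifts with uniformly bounded
weights. -/
theorem IsDiracModel.isCommutator_regSingle (hT : IsDiracModel ℓ D J T U)
    (hπ : ∀ a, π a * J = J * π a) (hℓ : TranslationBounded ℓ) (x : G) (a : A) {C : ℝ}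
    (hC : ∀ y : G, ∃ B : X →L[ℂ] X,
      IsCommutator D (π (α.ρ y a * (α.σ y x : A))) B ∧ ‖B‖ ≤ C) :
    ∃ B : E →L[ℂ] E, IsCommutator T (conjBy U (regSingle α (ampl V π) x a)) B := by
  choose B hB hBC using fun y : G => hC y⁻¹
  obtain ⟨C', hC'⟩ := hℓ x
  let P : G → X →L[ℂ] X := fun y => π (α.ρ y⁻¹ a * (α.σ y⁻¹ x : A))
  let B₁ := wshift x (fun y => (B y).rTensor V) C
    fun y => (ContinuousLinearMap.norm_rTensor_le _ _).trans (hBC y)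
  let F : G → X ⊗[ℂ] V →L[ℂ] X ⊗[ℂ] V := fun y =>
    (P y).rTensor V ∘L ((ℓ y : V →L[ℂ] V) - (ℓ (x⁻¹ * y) : V →L[ℂ] V)).lTensor X
  have hF : ∀ y, ‖F y‖ ≤ ‖a‖ * C' := fun y => by
    refine (ContinuousLinearMap.opNorm_comp_le _ _).trans ?_
    refine mul_le_mul ?_ ?_ (norm_nonneg _) (norm_nonneg _)
    · exact (ContinuousLinearMap.norm_rTensor_le _ _).trans (norm_coeff_le α π a x y)
    · exact (ContinuousLinearMap.norm_lTensor_le _ _).trans (hC' y)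
  let B₂ := wshift x F (‖a‖ * C') hF
  refine ⟨conjBy U (B₁ + lmap (J.rTensor V) ∘L B₂), isCommutator_iff.2 fun ξ ξ' hξ => ?_⟩
  obtain ⟨u, m, hu, hm, hξ'⟩ := (hT _ _).1 hξ
  rw [hT]
  set S := regSingle α (ampl V π) x a with hS
  -- These are the two components of `T` on the image vector; in particular both remain square
  -- summable, so the domain is preserved.
  refine ⟨S u + B₁ (U ξ), S m + B₂ (U ξ), fun y => ?_, fun y => ?_, ?_⟩
  · rw [conjBy_apply, U.apply_symm_apply]
    exact mem_graph_of_isCommutator (hB y) (hu (x⁻¹ * y))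
  · rw [conjBy_apply, U.apply_symm_apply]
    change (P y).rTensor V (m (x⁻¹ * y)) + (P y).rTensor V
      (((ℓ y : V →L[ℂ] V) - (ℓ (x⁻¹ * y) : V →L[ℂ] V)).lTensor X (U ξ (x⁻¹ * y)))
      = (ℓ y : V →L[ℂ] V).lTensor X ((P y).rTensor V (U ξ (x⁻¹ * y)))
    rw [hm, ← map_add, ← rTensor_lTensor_apply]
    congr 1
    rw [ContinuousLinearMap.lTensor_sub, sub_apply, add_sub_cancel]
  · rw [map_add, conjBy_apply, conjBy_apply, U.apply_symm_apply, U.apply_symm_apply, hξ']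
    have hcomm : S (lmap (J.rTensor V) m) = lmap (J.rTensor V) (S m) := by
      ext y
      change (P y).rTensor V (J.rTensor V (m (x⁻¹ * y))) = J.rTensor V ((P y).rTensor V _)
      rw [← mul_apply_eq_comp, ← mul_apply_eq_comp, ← ContinuousLinearMap.rTensor_mul,
        ← ContinuousLinearMap.rTensor_mul, hπ]
    rw [map_add, hcomm, map_add]
    simp only [add_apply, ContinuousLinearMap.comp_apply]
    abel

theorem IsDiracModel.exists_isCommutator (hT : IsDiracModel ℓ D J T U)
    (hπ : ∀ a, π a * J = J * π a) (hℓ : TranslationBounded ℓ) {𝒜 : StarSubalgebra ℂ A}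
    (hub : UniformlyBounded α π 𝒜 D) {f : G →₀ A} (hf : ∀ x, f x ∈ 𝒜) :
    ∃ B : E →L[ℂ] E, IsCommutator T (conjBy U (regRep α (ampl V π) f)) B := by
  have h : ∀ x, ∃ B : E →L[ℂ] E,
      IsCommutator T (conjBy U (regSingle α (ampl V π) x (f x))) B := fun x => by
    obtain ⟨C, hC⟩ := hub (f x) (hf x) x
    exact hT.isCommutator_regSingle hπ hℓ x (f x) hC
  choose B hB using h
  refine ⟨∑ x ∈ f.support, B x, ?_⟩
  have : conjBy U (regRep α (ampl V π) f)
      = ∑ x ∈ f.support, conjBy U (regSingle α (ampl V π) x (f x)) := by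
    ext ξ
    simp [conjBy_apply, regRep, Finsupp.sum, sum_apply]
  rw [this]
  exact isCommutator_sum _ fun x _ => hB x

/-- The matrix coefficient of `Π(f)` at `(y, e)` is `ρ_{y⁻¹}(f(y)) σ_{y⁻¹,y}`. -/
theorem regRep_single_one [DecidableEq G] {K : Type*} [NormedAddCommGroup K]
    [InnerProductSpace ℂ K] [CompleteSpace K] (π : A →⋆ₐ[ℂ] (K →L[ℂ] K)) (f : G →₀ A) (k : K)
    (y : G) :
    regRep α π f (lp.single 2 1 k) y = π (α.ρ y⁻¹ (f y) * (α.σ y⁻¹ y : A)) k := by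
  rw [regRep, Finsupp.sum, sum_apply, lp.coeFn_sum, Finset.sum_apply]
  simp only [regSingle_apply, lp.single_apply]
  rw [Finset.sum_eq_single y]
  · simp
  · intro x _ hx
    have : x⁻¹ * y ≠ 1 := fun h => hx (inv_mul_eq_one.1 h)
    rw [Pi.single_eq_of_ne this, map_zero]
  · intro hy
    rw [Finsupp.notMem_support_iff.1 hy]
    simp

/-- On `x ⊗ δ_1 ⊗ v` the length term vanishes at the source because `ℓ(1) = 0`. At the target `y`
the matrix coefficient of `Π(f)` must then satisfy a relation mixing `D` and `ℓ(y)`, and conjugation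
by `J` separates the two. -/
theorem IsDiracModel.commutator_eq_zero (hT : IsDiracModel ℓ D J T U)
    (hJ : IsAnticommuting D J) (hπ : ∀ a, π a * J = J * π a) (hinj : Function.Injective π)
    (hdense : Dense (D.domain : Set X)) [Nontrivial V]
    (hℓ : ∀ g, ℓ g = 0 ↔ g = 1) {f : G →₀ A}
    (h : IsCommutator T (conjBy U (regRep α (ampl V π) f)) 0) :
    (∀ y, y ≠ 1 → f y = 0) ∧ IsCommutator D (π (f 1)) 0 := by
  classical
  have hℓ1 : (ℓ 1 : V →L[ℂ] V) = 0 := by rw [(hℓ 1).2 rfl]; rfl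
  let c : G → A := fun y => α.ρ y⁻¹ (f y) * (α.σ y⁻¹ y : A)
  -- The `y`-component of the commutator identity, solved for the `D ⊗ 1` part.
  have key : ∀ (y : G) (x x' : X) (v : V), (x, x') ∈ D.graph →
      ((π (c y) x) ⊗ₜ[ℂ] v, (π (c y) x') ⊗ₜ[ℂ] v - (J (π (c y) x)) ⊗ₜ[ℂ] (ℓ y : V →L[ℂ] V) v)
        ∈ (tensorOp V D).graph := by
    intro y x x' v hx
    have h1 := hT.single_mem_graph 1 (tmul_mem_graph_tensorOp hx v)
    rw [hℓ1] at h1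
    have h2 := isCommutator_iff.1 h _ _ h1
    obtain ⟨u, m, hu, hm, hum⟩ := (hT _ _).1 h2
    have h3 : U (conjBy U (regRep α (ampl V π) f) (U.symm (lp.single 2 1 (x ⊗ₜ[ℂ] v)))) y
        = (π (c y) x) ⊗ₜ[ℂ] v := by
      rw [conjBy_apply, U.apply_symm_apply, U.apply_symm_apply, regRep_single_one]
      rfl
    have h4 : u y = (π (c y) x') ⊗ₜ[ℂ] v
        - (J (π (c y) x)) ⊗ₜ[ℂ] (ℓ y : V →L[ℂ] V) v := by
      rw [conjBy_apply, U.apply_symm_apply, zero_apply, add_zero, U.apply_symm_apply] at hum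
      have h5 := congrArg (fun g : L2 G (X ⊗[ℂ] V) => g y) hum
      simp only [ContinuousLinearMap.lTensor_zero, zero_apply, map_zero, add_zero] at h5
      rw [regRep_single_one, lp.coeFn_add, Pi.add_apply, lmap_apply, hm, h3] at h5
      exact eq_sub_of_add_eq h5.symm
    have h6 := hu y
    rw [h3, h4] at h6
    exact h6
  have hzero : ∀ (y : G) (x x' : X) (v : V), (x, x') ∈ D.graph →
      (π (c y) x) ⊗ₜ[ℂ] (ℓ y : V →L[ℂ] V) v = 0 := by
    intro y x x' v hx
    have hcomm : ∀ z, π (c y) (J z) = J (π (c y) z) := fun z =>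
      congrArg (fun S : X →L[ℂ] X => S z) (hπ (c y))
    have h1 := key y x x' v hx
    -- Using the relation for `Jx` and transporting it back by `J` gives the same first component,
    -- but the opposite sign on the `ℓ(y)` term. Since the graph is single valued, twice that term
    -- is zero.
    have h2 := hJ.mem_graph_rTensor (key y _ _ v (hJ.anticomm _ _ hx))
    simp only [map_sub, map_neg, ContinuousLinearMap.rTensor_tmul, hcomm, hJ.sq,
      TensorProduct.neg_tmul] at h2
    have h3 := LinearPMap.mem_graph_snd_inj _ h1 h2 rfl
    have h4 : (2 : ℂ) • ((J (π (c y) x)) ⊗ₜ[ℂ] (ℓ y : V →L[ℂ] V) v) = 0 := by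
      rw [two_smul]
      have := sub_eq_zero.2 h3
      rw [← neg_eq_zero, ← this]
      abel
    have h5 := (smul_eq_zero.1 h4).resolve_left two_ne_zero
    have h6 := congrArg (J.rTensor V) h5
    rwa [ContinuousLinearMap.rTensor_tmul, hJ.sq, map_zero] at h6
  have hcoef : ∀ y, y ≠ 1 → f y = 0 := by
    intro y hy
    have hne : (ℓ y : V →L[ℂ] V) ≠ 0 := fun h0 => hy ((hℓ y).1 (Subtype.ext h0))
    obtain ⟨v, hv⟩ : ∃ v, (ℓ y : V →L[ℂ] V) v ≠ 0 := by
      by_contra hall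
      push Not at hall
      exact hne (ContinuousLinearMap.ext hall)
    have hπ0 : π (c y) = 0 := by
      have hsp : Dense (Submodule.span ℂ (D.domain : Set X) : Set X) := by
        rwa [Submodule.span_eq]
      refine ContinuousLinearMap.ext_on hsp fun x hx => ?_
      have h1 := hzero y x _ v (D.mem_graph ⟨x, hx⟩)
      have h2 := congrArg norm h1
      rw [TensorProduct.norm_tmul, norm_zero] at h2
      rw [zero_apply]
      exact norm_eq_zero.1 ((mul_eq_zero.1 h2).resolve_right (norm_ne_zero_iff.2 hv))
    have hc0 : c y = 0 := hinj (by rw [hπ0, map_zero])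
    have h1 : α.ρ y⁻¹ (f y) = 0 := by
      have h2 : c y * star (α.σ y⁻¹ y : A) = 0 := by rw [hc0, zero_mul]
      have h3 : (α.σ y⁻¹ y : A) * star (α.σ y⁻¹ y : A) = 1 := Unitary.coe_mul_star_self _
      simpa only [c, mul_assoc, h3, mul_one] using h2
    exact (map_eq_zero_iff _ (α.ρ y⁻¹).injective).1 h1
  refine ⟨hcoef, isCommutator_iff.2 fun x x' hx => ?_⟩
  have hc1 : c 1 = f 1 := by
    simp [c, α.σ_right, α.ρ_one]
  -- Slicing along a nonzero `v` and dividing by `⟨v, v⟩` returns from `D ⊗ 1_V` to `D`.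
  obtain ⟨v, hv⟩ := exists_ne (0 : V)
  have h1 := key 1 x x' v hx
  rw [hℓ1, zero_apply, TensorProduct.tmul_zero, sub_zero, hc1, mem_graph_tensorOp] at h1
  have h2 := h1 v
  simp only [slice_tmul] at h2
  have h3 := D.graph.smul_mem (inner ℂ v v)⁻¹ h2
  have hvv : inner ℂ v v ≠ 0 := inner_self_ne_zero.2 hv
  rwa [Prod.smul_mk, smul_smul, smul_smul, inv_mul_cancel₀ hvv, one_smul, one_smul,
    ← add_zero (π (f 1) x'), ← zero_apply (F := X →L[ℂ] X) x] at h3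

end Commutators

/-! ### Spectra of the values of a length function -/

section Spectra

set_option linter.unusedSectionVars false

variable {V : Type*} [NormedAddCommGroup V] [InnerProductSpace ℂ V] [FiniteDimensional ℂ V]
  [CompleteSpace V]

theorem exists_eigenbasis (L : selfAdjoint (V →L[ℂ] V)) :
    ∃ (v : OrthonormalBasis (Fin (Module.finrank ℂ V)) ℂ V) (μ : Fin (Module.finrank ℂ V) → ℝ),
      ∀ j, (L : V →L[ℂ] V) (v j) = (μ j : ℂ) • v j := by
  have hL : IsSelfAdjoint (L : V →L[ℂ] V) := L.2
  have hsymm : ((L : V →L[ℂ] V) : V →ₗ[ℂ] V).IsSymmetric := hL.isSymmetric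
  exact ⟨hsymm.eigenvectorBasis rfl, hsymm.eigenvalues rfl,
    fun j => hsymm.apply_eigenvectorBasis rfl j⟩

theorem spectrum_eq_range {n : Type*} [Fintype n] {L : V →L[ℂ] V} {v : OrthonormalBasis n ℂ V}
    {μ : n → ℝ} (hv : ∀ j, L (v j) = (μ j : ℂ) • v j) : spectrum ℝ L = Set.range μ := by
  have hM : ∀ r x, (algebraMap ℝ (V →L[ℂ] V) r - L) x = (r : ℂ) • x - L x := fun r x => by
    rw [sub_apply, Algebra.algebraMap_eq_smul_one]
    simp
  ext r
  rw [spectrum.mem_iff]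
  constructor
  · contrapose!
    intro hr
    have hinj : Function.Injective ((algebraMap ℝ (V →L[ℂ] V) r - L : V →L[ℂ] V) : V →ₗ[ℂ] V) := by
      rw [injective_iff_map_eq_zero]
      intro x hx
      have hx' : (r : ℂ) • x - L x = 0 := (hM r x).symm.trans hx
      rw [← v.sum_repr' x]
      refine Finset.sum_eq_zero fun j _ => smul_eq_zero_of_left ?_ _
      have h1 := inner_diagonal v.toHilbertBasis (S := L) (t := μ) (by simpa using hv) j x
      rw [OrthonormalBasis.coe_toHilbertBasis] at h1
      have h2 := congrArg (inner ℂ (v j)) hx'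
      rw [inner_sub_right, inner_smul_right, h1, inner_zero_right, ← sub_mul] at h2
      refine (mul_eq_zero.1 h2).resolve_left fun h3 => hr ⟨j, ?_⟩
      exact_mod_cast (sub_eq_zero.1 h3).symm
    let e := (LinearEquiv.ofInjectiveEndo _ hinj).toContinuousLinearEquiv
    exact ⟨e.toUnit, ContinuousLinearMap.ext fun x => rfl⟩
  · rintro ⟨j, rfl⟩ ⟨u, hu⟩
    have hz : (u : V →L[ℂ] V) (v j) = 0 := by rw [hu, hM, hv, sub_self]
    have h1 := congrArg (fun z => (↑u⁻¹ : V →L[ℂ] V) z) hz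
    have h2 : v j = 0 := by simpa [← mul_apply_eq_comp] using h1
    exact v.orthonormal.ne_zero j h2

variable {G : Type*} [Group G] {ℓ : G → selfAdjoint (V →L[ℂ] V)}
  {n : Type*} [Fintype n] {v : G → OrthonormalBasis n ℂ V} {μ : G → n → ℝ}

/-- `|ℓ(g)|` has the same eigenvectors, with eigenvalues `|μ g j|`, and the infimum of a finite
nonempty set is attained. Nonemptiness excludes the default value `sInf ∅ = 0`. -/
theorem mem_ball_iff [Nonempty n]
    (hv : ∀ y j, (ℓ y : V →L[ℂ] V) (v y j) = (μ y j : ℂ) • v y j) (N : ℕ) (g : G) :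
    g ∈ ball ℓ N ↔ ∃ j, |μ g j| ≤ N := by
  have hL : IsSelfAdjoint (ℓ g : V →L[ℂ] V) := (ℓ g).2
  have habs : spectrum ℝ (CFC.abs (ℓ g : V →L[ℂ] V)) = Set.range fun j => |μ g j| := by
    refine spectrum_eq_range (v := v g) fun j => ?_
    rw [CFC.abs_eq_cfc_norm _ hL]
    exact cfc_apply_of_eigenvector hL (hv g j) continuous_norm.continuousOn
  change sInf _ ≤ (N : ℝ) ↔ _
  rw [habs]
  constructor
  · intro h
    obtain ⟨j, hj⟩ := (Set.range_nonempty fun j => |μ g j|).csInf_mem (Set.finite_range _)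
    exact ⟨j, hj.le.trans h⟩
  · rintro ⟨j, hj⟩
    exact (csInf_le (Set.finite_range _).bddBelow ⟨j, rfl⟩).trans hj

/-- An infinite part of the spectra in a compact interval would accumulate. So only finitely many
values occur there, each for finitely many group elements. -/
theorem finite_eigenvalue_le (hℓ : IsProperLength ℓ)
    (hv : ∀ y j, (ℓ y : V →L[ℂ] V) (v y j) = (μ y j : ℂ) • v y j) (C : ℝ) :
    {k : G × n | μ k.1 k.2 ^ 2 ≤ C}.Finite := by
  have hsp : ∀ y, spectrum ℝ (ℓ y : V →L[ℂ] V) = Set.range (μ y) := fun y =>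
    spectrum_eq_range (hv y)
  let S : Set ℝ := spectra ℓ ∩ Set.Icc (-√C) √C
  have hS : S.Finite := by
    by_contra hinf
    obtain ⟨t, -, ht⟩ := Set.Infinite.exists_accPt_of_subset_isCompact hinf isCompact_Icc
      Set.inter_subset_right
    exact hℓ.discrete t (ht.mono (principal_mono.2 Set.inter_subset_left))
  have hfin : (⋃ t ∈ S, {y : G | t ∈ spectrum ℝ (ℓ y : V →L[ℂ] V)}).Finite :=
    hS.biUnion fun t ht => hℓ.finite_fiber t ht.1
  refine (hfin.prod (Set.finite_univ (α := n))).subset ?_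
  rintro ⟨y, j⟩ hk
  have hk : μ y j ^ 2 ≤ C := hk
  have hmem : μ y j ∈ spectrum ℝ (ℓ y : V →L[ℂ] V) := by rw [hsp]; exact ⟨j, rfl⟩
  refine ⟨Set.mem_biUnion (x := μ y j) ⟨Set.mem_iUnion.2 ⟨y, hmem⟩, ?_⟩ hmem, trivial⟩
  exact abs_le.1 (Real.abs_le_sqrt hk)

end Spectra

/-! ### Summation estimates -/

section Sums

variable {ι G n : Type*} {κ : ι → ℝ} {μ : G → n → ℝ} {B : ℕ → Set G}

theorem tsum_indicator_const {s : Set G} (hs : s.Finite) (c : ℝ≥0∞) :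
    ∑' y, s.indicator (fun _ => c) y = s.ncard * c := by
  classical
  rw [tsum_eq_sum (s := hs.toFinset) fun y hy =>
    Set.indicator_of_notMem (fun h => hy (hs.mem_toFinset.2 h)) _]
  rw [Finset.sum_congr rfl fun y hy => Set.indicator_of_mem (hs.mem_toFinset.1 hy) _,
    Finset.sum_const, Set.ncard_eq_toFinset_card s hs, nsmul_eq_mul]

theorem exists_mem_dyadic_ball [Nonempty n] (hB : ∀ N g, g ∈ B N ↔ ∃ j, |μ g j| ≤ N) (y : G) :
    ∃ k : ℕ, y ∈ B (2 ^ k) := by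
  let j := Classical.arbitrary n
  obtain ⟨k, hk⟩ := pow_unbounded_of_one_lt |μ y j| (one_lt_two (α := ℝ))
  exact ⟨k, (hB _ _).2 ⟨j, by push_cast; exact hk.le⟩⟩

/-- Missing the ball of radius `2^(k-1)` means that every eigenvalue exceeds it in size. The factor
`2^q` pays for the shift from `k - 1` to `k`, and is harmless for `k = 0`, where only the bound `1`
is available. -/
theorem rpow_le_dyadic (hB : ∀ N g, g ∈ B N ↔ ∃ j, |μ g j| ≤ N) {q : ℝ} (hq : 0 < q) {y : G}
    {k : ℕ} (hk : ∀ m < k, y ∉ B (2 ^ m)) (j : n) :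
    (1 + μ y j ^ 2) ^ (-(q / 2)) ≤ (2 : ℝ) ^ q * ((2 : ℝ) ^ (-q)) ^ k := by
  cases k with
  | zero =>
    rw [pow_zero, mul_one]
    refine (Real.rpow_le_one_of_one_le_of_nonpos ?_ ?_).trans (Real.one_le_rpow one_le_two hq.le)
    · nlinarith [sq_nonneg (μ y j)]
    · linarith
  | succ m =>
    have h1 : (2 : ℝ) ^ m < |μ y j| := by
      by_contra h
      exact hk m (Nat.lt_succ_self m) ((hB _ _).2 ⟨j, by push_cast; linarith⟩)
    have h2 : ((2 : ℝ) ^ m) ^ 2 ≤ 1 + μ y j ^ 2 := by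
      rw [← sq_abs (μ y j)]
      nlinarith [pow_pos (two_pos (α := ℝ)) m]
    refine (Real.rpow_le_rpow_of_nonpos (by positivity) h2 (by linarith)).trans (le_of_eq ?_)
    rw [← pow_mul, ← Real.rpow_natCast, ← Real.rpow_natCast, ← Real.rpow_mul two_pos.le,
      ← Real.rpow_mul two_pos.le, ← Real.rpow_add two_pos]
    congr 1
    push_cast
    ring

/-- Each group element is charged to the first dyadic ball containing it. The ball of radius `2^k`
has at most `2^(kq')` elements for large `k`, each of weight of order `2^(-kq)`, so a geometric
series dominates. -/
theorem tsum_length_lt_top [Fintype n] [Nonempty n] (hB : ∀ N g, g ∈ B N ↔ ∃ j, |μ g j| ≤ N)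
    (hfin : ∀ N, 1 ≤ N → (B N).Finite) {q q' : ℝ} (hq : 0 < q) (hq' : q' < q)
    (hev : ∀ᶠ N : ℕ in atTop, ((B N).ncard : ℝ) ≤ (N : ℝ) ^ q') :
    ∑' k : G × n, ENNReal.ofReal ((1 + μ k.1 k.2 ^ 2) ^ (-(q / 2))) < ∞ := by
  classical
  let c : ℕ → ℝ := fun k => (2 : ℝ) ^ q * ((2 : ℝ) ^ (-q)) ^ k
  have hc : ∀ k, 0 ≤ c k := fun k => by positivity
  have hsum : Summable fun k : ℕ => ((B (2 ^ k)).ncard : ℝ) * c k := by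
    have hgeo : Summable fun k : ℕ => (2 : ℝ) ^ q * ((2 : ℝ) ^ (q' - q)) ^ k :=
      (summable_geometric_of_lt_one (by positivity)
        (Real.rpow_lt_one_of_one_lt_of_neg one_lt_two (by linarith))).mul_left _
    refine Summable.of_norm_bounded_eventually_nat hgeo ?_
    have htend : Tendsto (fun k : ℕ => 2 ^ k) atTop atTop :=
      tendsto_pow_atTop_atTop_of_one_lt one_lt_two
    filter_upwards [htend.eventually hev] with k hk
    rw [Real.norm_of_nonneg (mul_nonneg (Nat.cast_nonneg _) (hc k))]
    refine (mul_le_mul_of_nonneg_right hk (hc k)).trans (le_of_eq ?_)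
    have hpow : ((2 : ℝ) ^ k) ^ q' = ((2 : ℝ) ^ q') ^ k := by
      rw [← Real.rpow_natCast, ← Real.rpow_natCast, ← Real.rpow_mul two_pos.le,
        ← Real.rpow_mul two_pos.le, mul_comm]
    push_cast
    rw [hpow, sub_eq_add_neg, Real.rpow_add two_pos, mul_pow]
    ring
  have hpt : ∀ y j, ENNReal.ofReal ((1 + μ y j ^ 2) ^ (-(q / 2)))
      ≤ ∑' k, (B (2 ^ k)).indicator (fun _ => ENNReal.ofReal (c k)) y := fun y j => by
    have hex := exists_mem_dyadic_ball hB y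
    refine le_trans ?_ (ENNReal.le_tsum (Nat.find hex))
    rw [Set.indicator_of_mem (Nat.find_spec hex)]
    exact ENNReal.ofReal_le_ofReal (rpow_le_dyadic hB hq (fun m hm => Nat.find_min hex hm) j)
  calc ∑' k : G × n, ENNReal.ofReal ((1 + μ k.1 k.2 ^ 2) ^ (-(q / 2)))
      ≤ ∑' p : G × n, ∑' k, (B (2 ^ k)).indicator (fun _ => ENNReal.ofReal (c k)) p.1 :=
        ENNReal.tsum_le_tsum fun p => hpt p.1 p.2
    _ = Fintype.card n * ∑' k, ENNReal.ofReal (((B (2 ^ k)).ncard : ℝ) * c k) := by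
        rw [ENNReal.tsum_prod' (f := fun p : G × n =>
          ∑' k, (B (2 ^ k)).indicator (fun _ => ENNReal.ofReal (c k)) p.1)]
        simp only [tsum_fintype, Finset.sum_const, Finset.card_univ, nsmul_eq_mul]
        rw [ENNReal.tsum_mul_left, ENNReal.tsum_comm]
        congr 1
        refine tsum_congr fun k => ?_
        rw [tsum_indicator_const (hfin _ Nat.one_le_two_pow), ENNReal.ofReal_mul (Nat.cast_nonneg _),
          ENNReal.ofReal_natCast]
    _ < ∞ := ENNReal.mul_lt_top (ENNReal.natCast_lt_top _) hsum.tsum_ofReal_lt_top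

/-- `1 + κ + μ²` dominates both `1 + κ` and `1 + μ²`; splitting the exponent bounds the double sum
by a product of sums. -/
theorem tsum_add_lt_top [Fintype n] (hκ : ∀ i, 0 ≤ κ i) {p q : ℝ} (hp : 0 ≤ p) (hq : 0 ≤ q)
    (h1 : ∑' i, ENNReal.ofReal ((1 + κ i) ^ (-(p / 2))) < ∞)
    (h2 : ∑' k : G × n, ENNReal.ofReal ((1 + μ k.1 k.2 ^ 2) ^ (-(q / 2))) < ∞) :
    ∑' k : ι × G × n, ENNReal.ofReal ((1 + (κ k.1 + μ k.2.1 k.2.2 ^ 2)) ^ (-((p + q) / 2))) < ∞ := by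
  calc ∑' k : ι × G × n, ENNReal.ofReal ((1 + (κ k.1 + μ k.2.1 k.2.2 ^ 2)) ^ (-((p + q) / 2)))
      ≤ ∑' k : ι × G × n, ENNReal.ofReal ((1 + κ k.1) ^ (-(p / 2)))
          * ENNReal.ofReal ((1 + μ k.2.1 k.2.2 ^ 2) ^ (-(q / 2))) := by
        refine ENNReal.tsum_le_tsum fun k => ?_
        have ha := hκ k.1
        have hb := sq_nonneg (μ k.2.1 k.2.2)
        rw [← ENNReal.ofReal_mul (by positivity)]
        refine ENNReal.ofReal_le_ofReal ?_
        rw [show -((p + q) / 2) = -(p / 2) + -(q / 2) by ring, Real.rpow_add (by positivity)]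
        gcongr ?_ * ?_
        · exact Real.rpow_le_rpow_of_nonpos (by positivity) (by linarith) (by linarith)
        · exact Real.rpow_le_rpow_of_nonpos (by positivity) (by linarith) (by linarith)
    _ = (∑' i, ENNReal.ofReal ((1 + κ i) ^ (-(p / 2))))
          * ∑' k : G × n, ENNReal.ofReal ((1 + μ k.1 k.2 ^ 2) ^ (-(q / 2))) := by
        rw [ENNReal.tsum_prod' (f := fun k : ι × G × n => ENNReal.ofReal ((1 + κ k.1) ^ (-(p / 2)))
          * ENNReal.ofReal ((1 + μ k.2.1 k.2.2 ^ 2) ^ (-(q / 2))))]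
        simp only [ENNReal.tsum_mul_left, ENNReal.tsum_mul_right]
    _ < ∞ := ENNReal.mul_lt_top h1 h2

/-- Each element of the ball contributes at least one eigenvalue of size at most `N`, and one
suffices. -/
theorem ncard_mul_le_tsum (hB : ∀ N g, g ∈ B N ↔ ∃ j, |μ g j| ≤ N) {a t : ℝ} (ha : 0 ≤ a)
    (ht : 0 ≤ t) {N : ℕ} (hfin : (B N).Finite) :
    (B N).ncard * ENNReal.ofReal ((1 + (a + (N : ℝ) ^ 2)) ^ (-(t / 2)))
      ≤ ∑' k : G × n, ENNReal.ofReal ((1 + (a + μ k.1 k.2 ^ 2)) ^ (-(t / 2))) := by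
  rw [← tsum_indicator_const hfin, ENNReal.tsum_prod' (f := fun k : G × n =>
    ENNReal.ofReal ((1 + (a + μ k.1 k.2 ^ 2)) ^ (-(t / 2))))]
  refine ENNReal.tsum_le_tsum fun y => ?_
  by_cases hy : y ∈ B N
  · rw [Set.indicator_of_mem hy]
    obtain ⟨j, hj⟩ := (hB _ _).1 hy
    refine le_trans ?_ (ENNReal.le_tsum j)
    refine ENNReal.ofReal_le_ofReal (Real.rpow_le_rpow_of_nonpos ?_ ?_ (by linarith))
    · nlinarith [sq_nonneg (μ y j)]
    · have : μ y j ^ 2 ≤ (N : ℝ) ^ 2 := by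
        rw [← sq_abs (μ y j)]
        gcongr
      linarith
  · rw [Set.indicator_of_notMem hy]
    exact zero_le

/-- For fixed `i` only the ball of radius `N`, about `√(1 + κ_i)`, is kept. There `1 + κ_i + μ²` is
comparable with `1 + κ_i`, and at least `c (1 + κ_i)^(d/2)` elements occur, which lowers the
exponent `t` by `d`. -/
theorem tsum_lt_top_of_add (hB : ∀ N g, g ∈ B N ↔ ∃ j, |μ g j| ≤ N)
    (hfin : ∀ N, 1 ≤ N → (B N).Finite) (hκ : ∀ i, 0 ≤ κ i) {t d c : ℝ} (ht : 0 ≤ t) (hd : 0 ≤ d)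
    (hc : 0 < c) (hlow : ∀ N : ℕ, 1 ≤ N → c * (N : ℝ) ^ d ≤ (B N).ncard)
    (h : ∑' k : ι × G × n, ENNReal.ofReal ((1 + (κ k.1 + μ k.2.1 k.2.2 ^ 2)) ^ (-(t / 2))) < ∞) :
    ∑' i, ENNReal.ofReal ((1 + κ i) ^ (-((t - d) / 2))) < ∞ := by
  have key : ∀ i, ENNReal.ofReal (c * 5 ^ (-(t / 2)))
      * ENNReal.ofReal ((1 + κ i) ^ (-((t - d) / 2)))
      ≤ ∑' k : G × n, ENNReal.ofReal ((1 + (κ i + μ k.1 k.2 ^ 2)) ^ (-(t / 2))) := by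
    intro i
    have hk := hκ i
    set s := √(1 + κ i) with hs
    have hs2 : s ^ 2 = 1 + κ i := Real.sq_sqrt (by linarith)
    have hs1 : 1 ≤ s := Real.one_le_sqrt.2 (by linarith)
    set N := ⌈s⌉₊ with hN
    have hN1 : s ≤ N := Nat.le_ceil s
    have hN2 : (N : ℝ) ≤ 2 * s := by
      have := (Nat.ceil_lt_add_one (by linarith : 0 ≤ s)).le
      linarith
    have hN3 : 1 ≤ N := by
      have : (1 : ℝ) ≤ N := hs1.trans hN1
      exact_mod_cast this
    refine le_trans ?_ (ncard_mul_le_tsum hB hk ht (hfin N hN3))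
    rw [← ENNReal.ofReal_mul (by positivity), ← ENNReal.ofReal_natCast,
      ← ENNReal.ofReal_mul (Nat.cast_nonneg _)]
    refine ENNReal.ofReal_le_ofReal ?_
    -- From `N ≤ 2s` one gets `N² ≤ 4(1 + κ)`, whence the factor `5`.
    have e1 : (5 * (1 + κ i)) ^ (-(t / 2)) ≤ (1 + (κ i + (N : ℝ) ^ 2)) ^ (-(t / 2)) :=
      Real.rpow_le_rpow_of_nonpos (by positivity) (by nlinarith) (by linarith)
    have e2 : (1 + κ i) ^ (d / 2) ≤ (N : ℝ) ^ d := by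
      rw [← hs2, ← Real.rpow_natCast s 2, ← Real.rpow_mul (by linarith)]
      refine le_trans (le_of_eq ?_) (Real.rpow_le_rpow (by linarith) hN1 hd)
      congr 1
      push_cast
      ring
    calc c * 5 ^ (-(t / 2)) * (1 + κ i) ^ (-((t - d) / 2))
        = c * (1 + κ i) ^ (d / 2) * (5 * (1 + κ i)) ^ (-(t / 2)) := by
          rw [Real.mul_rpow (by norm_num) (by linarith),
            show -((t - d) / 2) = d / 2 + -(t / 2) by ring, Real.rpow_add (by linarith)]
          ring
      _ ≤ c * (N : ℝ) ^ d * (1 + (κ i + (N : ℝ) ^ 2)) ^ (-(t / 2)) := by gcongr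
      _ ≤ (B N).ncard * (1 + (κ i + (N : ℝ) ^ 2)) ^ (-(t / 2)) := by
          gcongr
          exact hlow N hN3
  have h1 : ENNReal.ofReal (c * 5 ^ (-(t / 2)))
      * ∑' i, ENNReal.ofReal ((1 + κ i) ^ (-((t - d) / 2))) < ∞ := by
    rw [← ENNReal.tsum_mul_left]
    refine (ENNReal.tsum_le_tsum key).trans_lt ?_
    rwa [ENNReal.tsum_prod' (f := fun k : ι × G × n =>
      ENNReal.ofReal ((1 + (κ k.1 + μ k.2.1 k.2.2 ^ 2)) ^ (-(t / 2))))] at h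
  have h0 : ENNReal.ofReal (c * 5 ^ (-(t / 2))) ≠ 0 :=
    (ENNReal.ofReal_pos.2 (by positivity)).ne'
  exact ENNReal.lt_top_of_mul_ne_top_right h1.ne h0

/-- A single index `i` is enough: the sum bounds a multiple of `#B_N · N^(-t)`, which would diverge
if `d > t`. This keeps the reduced exponents `t - d` positive in the lower estimate of the abscissa.
-/
theorem le_of_tsum_add_lt_top [Nonempty ι] (hB : ∀ N g, g ∈ B N ↔ ∃ j, |μ g j| ≤ N)
    (hfin : ∀ N, 1 ≤ N → (B N).Finite) (hκ : ∀ i, 0 ≤ κ i) {t d : ℝ} (ht : 0 ≤ t)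
    (hlow : ∀ᶠ N : ℕ in atTop, (N : ℝ) ^ d ≤ (B N).ncard)
    (h : ∑' k : ι × G × n, ENNReal.ofReal ((1 + (κ k.1 + μ k.2.1 k.2.2 ^ 2)) ^ (-(t / 2))) < ∞) :
    d ≤ t := by
  by_contra hlt
  push Not at hlt
  let i := Classical.arbitrary ι
  have hk := hκ i
  set Z := ∑' k : ι × G × n, ENNReal.ofReal ((1 + (κ k.1 + μ k.2.1 k.2.2 ^ 2)) ^ (-(t / 2)))
  have hZ : ∀ N : ℕ, 1 ≤ N →
      ((B N).ncard : ℝ) * (1 + (κ i + (N : ℝ) ^ 2)) ^ (-(t / 2)) ≤ Z.toReal := fun N hN => by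
    have h1 := ncard_mul_le_tsum hB hk ht (hfin N hN)
    have h2 : ∑' k : G × n, ENNReal.ofReal ((1 + (κ i + μ k.1 k.2 ^ 2)) ^ (-(t / 2))) ≤ Z := by
      rw [show Z = ∑' i, ∑' k : G × n, ENNReal.ofReal ((1 + (κ i + μ k.1 k.2 ^ 2)) ^ (-(t / 2)))
        from ENNReal.tsum_prod' (f := fun k : ι × G × n =>
          ENNReal.ofReal ((1 + (κ k.1 + μ k.2.1 k.2.2 ^ 2)) ^ (-(t / 2))))]
      exact ENNReal.le_tsum i
    rw [← ENNReal.ofReal_natCast, ← ENNReal.ofReal_mul (Nat.cast_nonneg _)] at h1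
    exact (ENNReal.ofReal_le_iff_le_toReal h.ne).1 (h1.trans h2)
  have hev : ∀ᶠ N : ℕ in atTop, (2 + κ i) ^ (-(t / 2)) * (N : ℝ) ^ (d - t) ≤ Z.toReal := by
    filter_upwards [hlow, eventually_ge_atTop 1] with N hN hN1
    have hN1' : (1 : ℝ) ≤ N := by exact_mod_cast hN1
    refine le_trans ?_ (hZ N hN1)
    have hN2 : (1 : ℝ) ≤ (N : ℝ) ^ 2 := one_le_pow₀ hN1'
    have e1 : ((2 + κ i) * (N : ℝ) ^ 2) ^ (-(t / 2)) ≤ (1 + (κ i + (N : ℝ) ^ 2)) ^ (-(t / 2)) :=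
      Real.rpow_le_rpow_of_nonpos (by positivity) (by nlinarith) (by linarith)
    calc (2 + κ i) ^ (-(t / 2)) * (N : ℝ) ^ (d - t)
        = (N : ℝ) ^ d * ((2 + κ i) * (N : ℝ) ^ 2) ^ (-(t / 2)) := by
          rw [Real.mul_rpow (by linarith) (by positivity), ← Real.rpow_natCast (N : ℝ) 2,
            ← Real.rpow_mul (by linarith), sub_eq_add_neg, Real.rpow_add (by linarith)]
          rw [show ((2 : ℕ) : ℝ) * -(t / 2) = -t by push_cast; ring]
          ring
      _ ≤ _ := by gcongr
  have htend : Tendsto (fun N : ℕ => (2 + κ i) ^ (-(t / 2)) * (N : ℝ) ^ (d - t)) atTop atTop :=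
    ((tendsto_rpow_atTop (by linarith)).comp tendsto_natCast_atTop_atTop).const_mul_atTop
      (by positivity)
  obtain ⟨N, hN1, hN2⟩ := (hev.and (htend.eventually_gt_atTop Z.toReal)).exists
  linarith

end Sums

/-! ### Growth and the abscissa of convergence -/

section Growth

set_option linter.unusedSectionVars false

variable {G : Type*} [Group G]
  {V : Type*} [NormedAddCommGroup V] [InnerProductSpace ℂ V] [FiniteDimensional ℂ V]
  [CompleteSpace V] [Nontrivial V] {ℓ : G → selfAdjoint (V →L[ℂ] V)}

theorem one_mem_ball (hℓ : IsProperLength ℓ) (N : ℕ) : (1 : G) ∈ ball ℓ N := by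
  have h : (ℓ 1 : V →L[ℂ] V) = 0 := by rw [(hℓ.eq_zero_iff 1).2 rfl]; rfl
  change sInf (spectrum ℝ (CFC.abs (ℓ 1 : V →L[ℂ] V))) ≤ N
  rw [h, CFC.abs_zero, spectrum.zero_eq, csInf_singleton]
  exact Nat.cast_nonneg N

theorem one_le_ncard_ball (hℓ : IsProperLength ℓ) (hpg : PolynomialGrowth ℓ) {N : ℕ}
    (hN : 1 ≤ N) : (1 : ℝ) ≤ (ball ℓ N).ncard := by
  obtain ⟨C, k, h⟩ := hpg
  have : 0 < (ball ℓ N).ncard := (Set.ncard_pos (h N hN).1).2 ⟨1, one_mem_ball hℓ N⟩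
  exact_mod_cast this

/-- Boundedness is needed for the real-valued `limsup` in `growth` to have its usual meaning instead
of a default value. -/
theorem isBoundedUnder_growth (hℓ : IsProperLength ℓ) (hpg : PolynomialGrowth ℓ) :
    IsBoundedUnder (· ≤ ·) atTop fun N : ℕ => Real.log (ball ℓ N).ncard / Real.log N := by
  have hone : ∀ N, 1 ≤ N → (1 : ℝ) ≤ (ball ℓ N).ncard := fun N => one_le_ncard_ball hℓ hpg
  obtain ⟨C, k, h⟩ := hpg
  -- This bounds `log (C N^k) / log N` for `N ≥ 2`; smaller `N` are excluded since `log 1 = 0`.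
  refine ⟨|Real.log C| / Real.log 2 + k, ?_⟩
  rw [eventually_map]
  filter_upwards [eventually_ge_atTop 2] with N hN
  have hN' : (2 : ℝ) ≤ N := by exact_mod_cast hN
  have hlog2 : 0 < Real.log 2 := Real.log_pos one_lt_two
  have hlog : Real.log 2 ≤ Real.log N := Real.log_le_log two_pos hN'
  have h1 := hone N (by omega)
  have h2 := (h N (by omega)).2
  have hC : 0 < C := by
    have hp : (0 : ℝ) < (N : ℝ) ^ k := by positivity
    by_contra hC
    push Not at hC
    nlinarith
  have h3 : Real.log (ball ℓ N).ncard ≤ Real.log C + k * Real.log N := by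
    rw [← Real.log_pow, ← Real.log_mul hC.ne' (by positivity)]
    exact Real.log_le_log (by linarith) h2
  rw [div_le_iff₀ (by linarith), add_mul]
  refine h3.trans (add_le_add_left ?_ _)
  refine (le_abs_self _).trans ?_
  rw [div_mul_eq_mul_div, le_div_iff₀ hlog2]
  gcongr

theorem eventually_growth_nonneg (hℓ : IsProperLength ℓ) (hpg : PolynomialGrowth ℓ) :
    ∀ᶠ N : ℕ in atTop, 0 ≤ Real.log (ball ℓ N).ncard / Real.log N := by
  filter_upwards [eventually_ge_atTop 1] with N hN
  exact div_nonneg (Real.log_nonneg (one_le_ncard_ball hℓ hpg hN))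
    (Real.log_nonneg (by exact_mod_cast hN))

theorem growth_nonneg (hℓ : IsProperLength ℓ) (hpg : PolynomialGrowth ℓ) : 0 ≤ growth ℓ :=
  le_limsup_of_frequently_le (eventually_growth_nonneg hℓ hpg).frequently
    (isBoundedUnder_growth hℓ hpg)

theorem eventually_ncard_ball_le (hℓ : IsProperLength ℓ) (hpg : PolynomialGrowth ℓ) {q : ℝ}
    (hq : growth ℓ < q) : ∀ᶠ N : ℕ in atTop, ((ball ℓ N).ncard : ℝ) ≤ (N : ℝ) ^ q := by
  have hev := eventually_lt_of_limsup_lt hq (isBoundedUnder_growth hℓ hpg)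
  filter_upwards [hev, eventually_ge_atTop 2] with N h hN
  have hN' : (2 : ℝ) ≤ N := by exact_mod_cast hN
  have hlog : 0 < Real.log N := Real.log_pos (by linarith)
  have h1 := one_le_ncard_ball hℓ hpg (by omega : 1 ≤ N)
  rw [div_lt_iff₀ hlog] at h
  rw [← Real.log_le_log_iff (by linarith) (by positivity), Real.log_rpow (by linarith)]
  exact h.le

theorem eventually_le_ncard_ball (hℓ : IsProperLength ℓ) (hpg : PolynomialGrowth ℓ) {L d : ℝ}
    (hL : Tendsto (fun N : ℕ => Real.log (ball ℓ N).ncard / Real.log N) atTop (𝓝 L))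
    (hd : d < L) : ∀ᶠ N : ℕ in atTop, (N : ℝ) ^ d ≤ (ball ℓ N).ncard := by
  filter_upwards [hL.eventually_const_lt hd, eventually_ge_atTop 2] with N h hN
  have hN' : (2 : ℝ) ≤ N := by exact_mod_cast hN
  have hlog : 0 < Real.log N := Real.log_pos (by linarith)
  have h1 := one_le_ncard_ball hℓ hpg (by omega : 1 ≤ N)
  rw [lt_div_iff₀ hlog] at h
  rw [← Real.log_le_log_iff (by positivity) (by linarith), Real.log_rpow (by linarith)]
  exact h.le

theorem exists_mul_le_ncard_ball (hℓ : IsProperLength ℓ) (hpg : PolynomialGrowth ℓ) {d : ℝ}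
    (hd : 0 ≤ d) (hev : ∀ᶠ N : ℕ in atTop, (N : ℝ) ^ d ≤ (ball ℓ N).ncard) :
    ∃ c > 0, ∀ N : ℕ, 1 ≤ N → c * (N : ℝ) ^ d ≤ (ball ℓ N).ncard := by
  obtain ⟨M, hM⟩ := eventually_atTop.1 hev
  have hMpos : (0 : ℝ) < M + 1 := by positivity
  have hone : (1 : ℝ) ≤ ((M : ℝ) + 1) ^ d := Real.one_le_rpow (by simp) hd
  -- Beyond `M` any constant at most `1` works; up to `M` the constant pushes the left side below
  -- `1`, and each ball contains the identity.
  refine ⟨(((M : ℝ) + 1) ^ d)⁻¹, by positivity, fun N hN => ?_⟩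
  rcases le_total M N with h | h
  · refine le_trans ?_ (hM N h)
    exact mul_le_of_le_one_left (by positivity) (inv_le_one_of_one_le₀ hone)
  · refine le_trans ?_ (one_le_ncard_ball hℓ hpg hN)
    rw [inv_mul_le_iff₀ (by positivity), mul_one]
    have : (N : ℝ) ≤ M + 1 := by
      have : (N : ℝ) ≤ M := by exact_mod_cast h
      linarith
    gcongr

/-! ### Spectral and summability properties of the model operator -/

variable {X : Type*} [NormedAddCommGroup X] [InnerProductSpace ℂ X] [CompleteSpace X]
  {E : Type*} [NormedAddCommGroup E] [InnerProductSpace ℂ E] [CompleteSpace E]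
  {D : X →ₗ.[ℂ] X} {J : X →L[ℂ] X} {T : E →ₗ.[ℂ] E} {U : E ≃ₗᵢ[ℂ] L2 G (X ⊗[ℂ] V)}

theorem nonempty_of_hilbertBasis [Nontrivial X] {ι : Type*} (e : HilbertBasis ι ℂ X) :
    Nonempty ι := by
  by_contra h
  rw [not_nonempty_iff] at h
  obtain ⟨x, hx⟩ := exists_ne (0 : X)
  refine hx (e.repr.injective ?_)
  ext i
  exact isEmptyElim i

/-- As both terms of `κ_i + μ²` are nonnegative, a bound on the sum bounds each of them and leaves
finitely many index triples. -/
theorem IsDiracModel.isSelfAdjoint_and_compact (hT : IsDiracModel ℓ D J T U)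
    (hJ : IsAnticommuting D J) (hD : IsSelfAdjoint D)
    (hc : IsCompactOperator (invOneAddSq D ^ (1 / 2 : ℝ))) (hℓ : IsProperLength ℓ) :
    IsSelfAdjoint T ∧ IsCompactOperator (invOneAddSq T ^ (1 / 2 : ℝ)) := by
  obtain ⟨ι, e, κ, he⟩ := exists_sqDiagonal hD hc
  choose v μ hv using fun y => exists_eigenbasis (ℓ y)
  obtain ⟨w, hw⟩ := hT.exists_sqDiagonal_single hJ he hv
  refine ⟨hw.isSelfAdjoint, hw.isCompactOperator fun C => ?_⟩
  refine ((he.finite_le hc C).prod (finite_eigenvalue_le hℓ hv C)).subset ?_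
  rintro ⟨i, k⟩ hk
  have hk : κ i + μ k.1 k.2 ^ 2 ≤ C := hk
  have h1 := he.nonneg i
  have h2 := sq_nonneg (μ k.1 k.2)
  exact ⟨show κ i ≤ C by linarith, show μ k.1 k.2 ^ 2 ≤ C by linarith⟩

/-- Every summability exponent of `D` plus any number above the growth is a summability exponent of
`T`. If the growth limit `L` exists, the lower ball bounds let one subtract any `d < L` from a
summability exponent of `T`. -/
theorem IsDiracModel.summability [Nontrivial X] (hT : IsDiracModel ℓ D J T U)
    (hJ : IsAnticommuting D J) (hD : IsSelfAdjoint D)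
    (hc : IsCompactOperator (invOneAddSq D ^ (1 / 2 : ℝ))) (hℓ : IsProperLength ℓ)
    (hfs : FinitelySummable D) (hpg : PolynomialGrowth ℓ) :
    FinitelySummable T ∧ abscissa T ≤ abscissa D + growth ℓ ∧
      ((∃ L : ℝ, Tendsto (fun n : ℕ => Real.log (ball ℓ n).ncard / Real.log n) atTop (𝓝 L)) →
        abscissa T = abscissa D + growth ℓ) := by
  obtain ⟨ι, e, κ, he⟩ := exists_sqDiagonal hD hc
  choose v μ hv using fun y => exists_eigenbasis (ℓ y)
  obtain ⟨w, hw⟩ := hT.exists_sqDiagonal_single hJ he hv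
  have : Nonempty ι := nonempty_of_hilbertBasis e
  have : Nonempty (Fin (Module.finrank ℂ V)) := ⟨⟨0, Module.finrank_pos⟩⟩
  have hB := mem_ball_iff hv
  have hfin : ∀ N, 1 ≤ N → (ball ℓ N).Finite := by
    obtain ⟨C, k, h⟩ := hpg
    exact fun N hN => (h N hN).1
  have hg0 := growth_nonneg hℓ hpg
  have hup : ∀ p q, 0 < p → zeta D p < ∞ → growth ℓ < q → zeta T (p + q) < ∞ := by
    intro p q hp hz hq
    obtain ⟨q', hq1, hq2⟩ := exists_between hq
    have hq0 : 0 < q := hg0.trans_lt hq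
    rw [he.zeta_eq hp] at hz
    rw [hw.zeta_eq (by linarith)]
    exact tsum_add_lt_top he.nonneg hp.le hq0.le hz
      (tsum_length_lt_top hB hfin hq0 hq2 (eventually_ncard_ball_le hℓ hpg hq1))
  have hTbdd : BddBelow {t : ℝ | 0 < t ∧ zeta T t < ∞} := ⟨0, fun t ht => ht.1.le⟩
  have hle : abscissa T ≤ abscissa D + growth ℓ := by
    refine le_of_forall_pos_le_add fun ε hε => ?_
    obtain ⟨p, ⟨hp, hz⟩, hp'⟩ := exists_lt_of_csInf_lt hfs
      (show sInf {t : ℝ | 0 < t ∧ zeta D t < ∞} < abscissa D + ε / 2 by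
        change _ < sInf _ + _
        linarith)
    have := csInf_le hTbdd (a := p + (growth ℓ + ε / 2))
      ⟨by linarith, hup p _ hp hz (by linarith)⟩
    change sInf _ ≤ _
    linarith
  have hfsT : FinitelySummable T := by
    obtain ⟨p, hp, hz⟩ := hfs
    exact ⟨p + (growth ℓ + 1), by linarith, hup p _ hp hz (by linarith)⟩
  refine ⟨hfsT, hle, ?_⟩
  rintro ⟨L, hL⟩
  have hgL : growth ℓ = L := hL.limsup_eq
  rw [hgL] at hle hg0 ⊢
  refine le_antisymm hle (le_csInf hfsT ?_)
  rintro t ⟨ht, hz⟩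
  rw [hw.zeta_eq ht] at hz
  have hLt : L ≤ t := le_of_forall_lt fun d hd => by
    obtain ⟨d', hd1, hd2⟩ := exists_between hd
    exact hd1.trans_le (le_of_tsum_add_lt_top hB hfin he.nonneg ht.le
      (eventually_le_ncard_ball hℓ hpg hL hd2) hz)
  have hlow : ∀ d, 0 ≤ d → d < t → (∀ᶠ N : ℕ in atTop, (N : ℝ) ^ d ≤ (ball ℓ N).ncard) →
      abscissa D ≤ t - d := by
    intro d hd hdt hev
    obtain ⟨c, hc0, hcN⟩ := exists_mul_le_ncard_ball hℓ hpg hd hev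
    have h1 := tsum_lt_top_of_add hB hfin he.nonneg ht.le hd hc0 hcN hz
    refine csInf_le ⟨0, fun t ht => ht.1.le⟩ ⟨by linarith, ?_⟩
    rwa [he.zeta_eq (by linarith)]
  -- For `L = 0` no nonnegative `d < L` exists, so `d = 0` is used directly, with the trivial bound
  -- `#B_N ≥ 1`.
  rcases hg0.eq_or_lt with h0 | hpos
  · have := hlow 0 le_rfl ht (by
      filter_upwards [eventually_ge_atTop 1] with N hN
      rw [Real.rpow_zero]
      exact one_le_ncard_ball hℓ hpg hN)
    linarith
  · refine le_of_forall_pos_le_add fun ε hε => ?_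
    -- The lower estimate requires a nonnegative exponent, hence the truncation at `0`.
    have hm : max (L - ε) 0 < L := max_lt (by linarith) hpos
    have := hlow (max (L - ε) 0) (le_max_right _ _) (hm.trans_le hLt)
      (eventually_le_ncard_ball hℓ hpg hL hm)
    linarith [le_max_left (L - ε) 0]

end Growth

/-! ### Multiples of a representation -/

section Multiples

variable {E F : Type*} [NormedAddCommGroup E] [InnerProductSpace ℂ E] [CompleteSpace E]
  [NormedAddCommGroup F] [InnerProductSpace ℂ F] [CompleteSpace F]
  {n : Type*} [Fintype n] [DecidableEq n]

/-- `S ↦ ∑ₖ Wₖ S Wₖ*`, for isometries `Wₖ` with orthogonal ranges which add up to `F`. -/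
def multipleRep (W : n → E →L[ℂ] F)
    (h1 : ∀ j k, ContinuousLinearMap.adjoint (W j) ∘L W k = if j = k then 1 else 0)
    (h2 : ∑ k, W k ∘L ContinuousLinearMap.adjoint (W k) = 1) :
    (E →L[ℂ] E) →⋆ₐ[ℂ] (F →L[ℂ] F) where
  toFun S := ∑ k, W k ∘L S ∘L ContinuousLinearMap.adjoint (W k)
  map_one' := h2
  map_mul' S T := by
    rw [Finset.sum_mul_sum]
    refine Finset.sum_congr rfl fun j _ => ?_
    rw [Finset.sum_eq_single j]
    · ext x
      have := congrArg (fun Z : E →L[ℂ] E => Z (T (ContinuousLinearMap.adjoint (W j) x))) (h1 j j)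
      simp only [if_true, ContinuousLinearMap.comp_apply, one_apply_eq_self] at this
      simp [this]
    · intro k _ hk
      ext x
      have := congrArg (fun Z : E →L[ℂ] E => Z (T (ContinuousLinearMap.adjoint (W k) x))) (h1 j k)
      simp only [if_neg hk.symm, ContinuousLinearMap.comp_apply, zero_apply] at this
      simp [this]
    · exact fun h => absurd (Finset.mem_univ _) h
  map_zero' := by simp
  map_add' S T := by
    rw [← Finset.sum_add_distrib]
    refine Finset.sum_congr rfl fun k _ => ?_
    ext x
    simp
  commutes' c := by
    rw [Algebra.algebraMap_eq_smul_one, Algebra.algebraMap_eq_smul_one, ← h2, Finset.smul_sum]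
    refine Finset.sum_congr rfl fun k _ => ?_
    ext x
    simp
  map_star' S := by
    rw [star_sum]
    refine Finset.sum_congr rfl fun k _ => ?_
    simp only [ContinuousLinearMap.star_eq_adjoint, ContinuousLinearMap.adjoint_comp,
      ContinuousLinearMap.adjoint_adjoint]
    rfl

variable {W : n → E →L[ℂ] F}
  {h1 : ∀ j k, ContinuousLinearMap.adjoint (W j) ∘L W k = if j = k then 1 else 0}
  {h2 : ∑ k, W k ∘L ContinuousLinearMap.adjoint (W k) = 1}

theorem multipleRep_apply (S : E →L[ℂ] E) :
    multipleRep W h1 h2 S = ∑ k, W k ∘L S ∘L ContinuousLinearMap.adjoint (W k) := rfl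

/-- The ranges of the `W_k` add up to the whole space, so intertwining with every `W_k` determines
the operator. -/
theorem multipleRep_eq {S : E →L[ℂ] E} {S' : F →L[ℂ] F} (h : ∀ k ξ, S' (W k ξ) = W k (S ξ)) :
    multipleRep W h1 h2 S = S' := by
  rw [multipleRep_apply]
  have : S' = S' ∘L ∑ k, W k ∘L ContinuousLinearMap.adjoint (W k) := by rw [h2]; rfl
  rw [this]
  ext x
  simp [sum_apply, h]

theorem multipleRep_injective [Nonempty n] : Function.Injective (multipleRep W h1 h2) := by
  rw [injective_iff_map_eq_zero]
  intro S hS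
  let k := Classical.arbitrary n
  ext ξ
  have h0 : ∑ j, W j (S (ContinuousLinearMap.adjoint (W j) (W k ξ))) = 0 := by
    have := congrArg (fun Z : F →L[ℂ] F => Z (W k ξ)) hS
    simpa [multipleRep_apply, sum_apply] using this
  have hj : ∀ j, ContinuousLinearMap.adjoint (W j) (W k ξ) = if j = k then ξ else 0 := fun j => by
    have := congrArg (fun Z : E →L[ℂ] E => Z ξ) (h1 j k)
    simp only [ContinuousLinearMap.comp_apply] at this
    rw [this]
    split_ifs <;> rfl
  rw [Finset.sum_eq_single k (fun j _ hjk => by rw [hj, if_neg hjk, map_zero, map_zero])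
    (fun h => absurd (Finset.mem_univ _) h), hj, if_pos rfl] at h0
  have h3 := congrArg (ContinuousLinearMap.adjoint (W k)) h0
  have h4 := congrArg (fun Z : E →L[ℂ] E => Z (S ξ)) (h1 k k)
  simp only [if_true, ContinuousLinearMap.comp_apply, one_apply_eq_self] at h4
  rw [h4, map_zero] at h3
  rw [h3]
  rfl

end Multiples

/-! ### Smooth elements of the crossed product -/

section Smooth

variable {A : Type*} [CStarAlgebra A] {G : Type*} [Group G] {α : TwistedAction G A}
  {K : Type*} [NormedAddCommGroup K] [InnerProductSpace ℂ K] [CompleteSpace K]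
  {π : A →⋆ₐ[ℂ] (K →L[ℂ] K)} {𝒜 : StarSubalgebra ℂ A}

theorem norm_regSingle_le (x : G) (a : A) : ‖regSingle α π x a‖ ≤ ‖a‖ :=
  (regSingle α π x a).opNorm_le_bound (norm_nonneg a)
    (norm_wshift_le x _ ‖a‖ (norm_coeff_le α π a x))

/-- By `‖Π(a δ_x)‖ ≤ ‖a‖`, approximating `a` in `𝒜` approximates `a δ_x`; finite sums then reach
`C_c(G, A)`, which is dense by construction. -/
theorem dense_smoothCrossed (hα : α.IsSmooth 𝒜) (h𝒜 : Dense (𝒜 : Set A)) :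
    Dense (smoothCrossed α π 𝒜 hα : Set (crossedProduct α π)) := by
  classical
  have hcont : ∀ x, Continuous (regSingle α π x) := fun x => by
    let Φ : A →ₗ[ℂ] (L2 G K →L[ℂ] L2 G K) :=
      { toFun := regSingle α π x
        map_add' := regSingle_add α π x
        map_smul' := fun c a => regSingle_smul α π x c a }
    exact (Φ.mkContinuous 1 fun a => by
      rw [one_mul]
      exact norm_regSingle_le x a).continuous
  have hsingle : ∀ x a, regSingle α π x a ∈ (convAlgebra α π 𝒜 hα).topologicalClosure := by
    intro x a
    have ha : a ∈ closure (𝒜 : Set A) := h𝒜 a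
    refine map_mem_closure (hcont x) ha fun b hb => ?_
    refine ⟨Finsupp.single x b, fun y => ?_, (regRep_single α π x b).symm⟩
    rw [Finsupp.single_apply]
    split_ifs
    exacts [hb, zero_mem 𝒜]
  have hle : crossedProduct α π ≤ (convAlgebra α π 𝒜 hα).topologicalClosure := by
    refine StarSubalgebra.topologicalClosure_minimal ?_
      (StarSubalgebra.isClosed_topologicalClosure _)
    rintro _ ⟨f, -, rfl⟩
    exact sum_mem fun x _ => hsingle x (f x)
  rintro ⟨T, hT⟩
  rw [Topology.IsInducing.subtypeVal.closure_eq_preimage_closure_image]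
  refine closure_mono ?_ (hle hT)
  rintro _ ⟨f, hf, rfl⟩
  exact ⟨toCrossed α π f, ⟨f, hf, rfl⟩, rfl⟩

theorem exists_of_mem_smoothCrossed {hα : α.IsSmooth 𝒜} {S : crossedProduct α π}
    (h : S ∈ smoothCrossed α π 𝒜 hα) : ∃ f : G →₀ A, (∀ x, f x ∈ 𝒜) ∧ S = toCrossed α π f := by
  obtain ⟨f, hf, hS⟩ := h
  exact ⟨f, hf, Subtype.ext hS⟩

theorem toCrossed_eq_algebraMap {f : G →₀ A} (h : ∀ y, y ≠ 1 → f y = 0) {c : ℂ}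
    (hc : f 1 = algebraMap ℂ A c) :
    toCrossed α π f = algebraMap ℂ (crossedProduct α π) c := by
  classical
  refine Subtype.ext ?_
  change regRep α π f = algebraMap ℂ (L2 G K →L[ℂ] L2 G K) c
  have : f = Finsupp.single 1 (f 1) := by
    ext y
    by_cases hy : y = 1
    · simp [hy]
    · rw [h y hy, Finsupp.single_eq_of_ne hy]
  rw [this, regRep_single, hc, regSingle_algebraMap]

theorem isCommutator_algebraMap {B : Type*} [CStarAlgebra B] {E : Type*} [NormedAddCommGroup E]
    [InnerProductSpace ℂ E] [CompleteSpace E] (ϖ : B →⋆ₐ[ℂ] (E →L[ℂ] E)) (T : E →ₗ.[ℂ] E) (c : ℂ) :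
    IsCommutator T (ϖ (algebraMap ℂ B c)) 0 := by
  rw [isCommutator_iff]
  intro x x' hx
  rw [AlgHomClass.commutes, Algebra.algebraMap_eq_smul_one]
  simpa using T.graph.smul_mem c hx

end Smooth

/-! ### The spectral triple on the crossed product, in the model -/

section ModelTriple

set_option linter.unusedSectionVars false

variable {A : Type*} [CStarAlgebra A] {G : Type*} [Group G]
  {X₀ : Type*} [NormedAddCommGroup X₀] [InnerProductSpace ℂ X₀] [CompleteSpace X₀]
  {X : Type*} [NormedAddCommGroup X] [InnerProductSpace ℂ X] [CompleteSpace X]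
  {V : Type*} [NormedAddCommGroup V] [InnerProductSpace ℂ V] [FiniteDimensional ℂ V]
  [CompleteSpace V]
  {E : Type*} [NormedAddCommGroup E] [InnerProductSpace ℂ E] [CompleteSpace E]
  {U : E ≃ₗᵢ[ℂ] L2 G (X ⊗[ℂ] V)} {α : TwistedAction G A}
  {π₀ : A →⋆ₐ[ℂ] (X₀ →L[ℂ] X₀)} {π : A →⋆ₐ[ℂ] (X →L[ℂ] X)}

/-- The operator `x ↦ x ⊗ v`. -/
def tmulRight (v : V) : X →L[ℂ] X ⊗[ℂ] V := (TensorProduct.mkL ℂ X V).flip v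

theorem adjoint_tmulRight (v : V) :
    ContinuousLinearMap.adjoint (tmulRight v : X →L[ℂ] X ⊗[ℂ] V) = slice v := by
  symm
  rw [ContinuousLinearMap.eq_adjoint_iff]
  intro z x
  have h := congrArg (starRingEnd ℂ) (inner_tmul_left_eq x v z)
  rw [inner_conj_symm (slice v z) x] at h
  exact h.symm.trans (inner_conj_symm (𝕜 := ℂ) z (x ⊗ₜ[ℂ] v))

/-- The representation on the large space is a multiple of the regular one: copies are embedded by
`ξ ↦ ι_k ξ ⊗ b_j`, one for each summand and each basis vector of `V`. Hence it is the restriction of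
a representation of all bounded operators, which settles its extension from `C_c(G, A)` and its
faithfulness at once. -/
theorem exists_multiple_rep {s : Type*} [Fintype s] [DecidableEq s] [Nonempty s] [Nontrivial V]
    (U : E ≃ₗᵢ[ℂ] L2 G (X ⊗[ℂ] V)) (α : TwistedAction G A) (ι : s → X₀ →L[ℂ] X)
    (hι₁ : ∀ j k, ContinuousLinearMap.adjoint (ι j) ∘L ι k = if j = k then 1 else 0)
    (hι₂ : ∑ k, ι k ∘L ContinuousLinearMap.adjoint (ι k) = 1)
    (hπ : ∀ k a x, π a (ι k x) = ι k (π₀ a x)) :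
    ∃ Rep : crossedProduct α π₀ →⋆ₐ[ℂ] (E →L[ℂ] E), Function.Injective Rep ∧
      ∀ f : G →₀ A, Rep (toCrossed α π₀ f) = conjBy U (regRep α (ampl V π) f) := by
  classical
  let b := stdOrthonormalBasis ℂ V
  let w : s × Fin (Module.finrank ℂ V) → X₀ →L[ℂ] X ⊗[ℂ] V := fun k => tmulRight (b k.2) ∘L ι k.1
  let W : s × Fin (Module.finrank ℂ V) → L2 G X₀ →L[ℂ] E := fun k =>
    (U.symm : L2 G (X ⊗[ℂ] V) →L[ℂ] E) ∘L lmap (w k)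
  have hw : ∀ k z, ContinuousLinearMap.adjoint (w k) z
      = ContinuousLinearMap.adjoint (ι k.1) (slice (b k.2) z) := fun k z => by
    rw [ContinuousLinearMap.adjoint_comp, adjoint_tmulRight]
    rfl
  have hW : ∀ k ξ, ContinuousLinearMap.adjoint (W k) ξ
      = lmap (ContinuousLinearMap.adjoint (w k)) (U ξ) := fun k ξ => by
    refine ext_inner_left ℂ fun η => ?_
    rw [ContinuousLinearMap.adjoint_inner_right, ← inner_lmap, ← U.inner_map_map]
    change inner ℂ (U (U.symm (lmap (w k) η))) (U ξ) = _
    rw [U.apply_symm_apply]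
  have hι₁' : ∀ j k x, ContinuousLinearMap.adjoint (ι j) (ι k x) = if j = k then x else 0 := by
    intro j k x
    have := congrArg (fun Z : X₀ →L[ℂ] X₀ => Z x) (hι₁ j k)
    simp only [ContinuousLinearMap.comp_apply] at this
    rw [this]
    split_ifs <;> rfl
  have hι₂' : ∀ x, ∑ k, ι k (ContinuousLinearMap.adjoint (ι k) x) = x := by
    intro x
    have := congrArg (fun Z : X →L[ℂ] X => Z x) hι₂
    simpa [sum_apply] using this
  have h1 : ∀ j k, ContinuousLinearMap.adjoint (W j) ∘L W k = if j = k then 1 else 0 := by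
    intro j k
    ext ξ y
    rw [ContinuousLinearMap.comp_apply, hW]
    change ContinuousLinearMap.adjoint (w j) (U (U.symm (lmap (w k) ξ)) y) = _
    rw [U.apply_symm_apply, hw]
    change ContinuousLinearMap.adjoint (ι j.1) (slice (b j.2) (ι k.1 (ξ y) ⊗ₜ[ℂ] b k.2)) = _
    rw [slice_tmul, map_smul, hι₁', b.inner_eq_ite]
    by_cases hj : j.1 = k.1
    · by_cases hk : j.2 = k.2
      · rw [if_pos hj, if_pos hk, if_pos (Prod.ext hj hk), one_smul]
        rfl
      · rw [if_neg hk, if_neg fun h => hk (congrArg Prod.snd h), zero_smul]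
        rfl
    · rw [if_neg hj, if_neg fun h => hj (congrArg Prod.fst h), smul_zero]
      rfl
  have h2 : ∑ k, W k ∘L ContinuousLinearMap.adjoint (W k) = 1 := by
    ext ξ
    refine U.injective ?_
    ext y
    rw [sum_apply, map_sum, lp.coeFn_sum, Finset.sum_apply]
    have h3 : ∀ k, U ((W k ∘L ContinuousLinearMap.adjoint (W k)) ξ) y
        = ι k.1 (ContinuousLinearMap.adjoint (ι k.1) (slice (b k.2) (U ξ y))) ⊗ₜ[ℂ] b k.2 := by
      intro k
      rw [ContinuousLinearMap.comp_apply, hW]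
      change U (U.symm (lmap (w k) _)) y = _
      rw [U.apply_symm_apply, lmap_apply, lmap_apply, hw]
      rfl
    simp only [h3]
    rw [Fintype.sum_prod_type_right]
    simp only [← TensorProduct.sum_tmul, hι₂']
    exact sum_slice_tmul b _
  have : Nonempty (Fin (Module.finrank ℂ V)) := ⟨⟨0, Module.finrank_pos⟩⟩
  refine ⟨(multipleRep W h1 h2).comp (crossedProduct α π₀).subtype,
    (multipleRep_injective (h1 := h1) (h2 := h2)).comp Subtype.val_injective, fun f => ?_⟩
  change multipleRep W h1 h2 (regRep α π₀ f) = _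
  refine multipleRep_eq fun k ξ => ?_
  rw [conjBy_apply]
  change U.symm (regRep α (ampl V π) f (U (U.symm (lmap (w k) ξ))))
    = U.symm (lmap (w k) (regRep α π₀ f ξ))
  rw [U.apply_symm_apply]
  congr 1
  simp only [regRep, Finsupp.sum, sum_apply, map_sum]
  refine Finset.sum_congr rfl fun x _ => ?_
  ext y
  change (π _ (ι k.1 (ξ (x⁻¹ * y)))) ⊗ₜ[ℂ] b k.2 = (ι k.1 (π₀ _ (ξ (x⁻¹ * y)))) ⊗ₜ[ℂ] b k.2
  rw [hπ]

variable {D : X →ₗ.[ℂ] X} {J : X →L[ℂ] X} {ℓ : G → selfAdjoint (V →L[ℂ] V)} {T : E →ₗ.[ℂ] E}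
  {𝒜 : StarSubalgebra ℂ A}

theorem IsDiracModel.isSpectralTriple [Nontrivial V] (hT : IsDiracModel ℓ D J T U)
    (hJ : IsAnticommuting D J) (hD : IsSelfAdjoint D)
    (hc : IsCompactOperator (invOneAddSq D ^ (1 / 2 : ℝ))) (hℓp : IsProperLength ℓ)
    (hℓb : TranslationBounded ℓ) (hπ : ∀ a, π a * J = J * π a) (hα : α.IsSmooth 𝒜)
    (h𝒜 : Dense (𝒜 : Set A)) (hub : UniformlyBounded α π 𝒜 D)
    {Rep : crossedProduct α π₀ →⋆ₐ[ℂ] (E →L[ℂ] E)}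
    (hRep : ∀ f : G →₀ A, Rep (toCrossed α π₀ f) = conjBy U (regRep α (ampl V π) f)) :
    IsSpectralTriple (smoothCrossed α π₀ 𝒜 hα) Rep T where
  dense := dense_smoothCrossed hα h𝒜
  dense_domain := (hT.isSelfAdjoint_and_compact hJ hD hc hℓp).1.dense_domain
  isSelfAdjoint := (hT.isSelfAdjoint_and_compact hJ hD hc hℓp).1
  compact := (hT.isSelfAdjoint_and_compact hJ hD hc hℓp).2
  commutator S hS := by
    obtain ⟨f, hf, rfl⟩ := exists_of_mem_smoothCrossed hS
    rw [hRep]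
    exact hT.exists_isCommutator hπ hℓb hub hf

theorem IsDiracModel.isNondegenerate [Nontrivial V] (hT : IsDiracModel ℓ D J T U)
    (hJ : IsAnticommuting D J) (hD : IsSelfAdjoint D) (hℓp : IsProperLength ℓ)
    (hπ : ∀ a, π a * J = J * π a) (hinj : Function.Injective π) (hα : α.IsSmooth 𝒜)
    (hnd : ∀ a ∈ 𝒜, IsCommutator D (π a) 0 → ∃ c : ℂ, a = algebraMap ℂ A c)
    {Rep : crossedProduct α π₀ →⋆ₐ[ℂ] (E →L[ℂ] E)} (hRinj : Function.Injective Rep)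
    (hRep : ∀ f : G →₀ A, Rep (toCrossed α π₀ f) = conjBy U (regRep α (ampl V π) f)) :
    IsNondegenerate (smoothCrossed α π₀ 𝒜 hα) Rep T := by
  refine ⟨hRinj, fun S hS => ⟨fun h => ?_, ?_⟩⟩
  · obtain ⟨f, hf, rfl⟩ := exists_of_mem_smoothCrossed hS
    rw [hRep] at h
    obtain ⟨h1, h2⟩ := hT.commutator_eq_zero hJ hπ hinj hD.dense_domain hℓp.eq_zero_iff h
    obtain ⟨c, hc⟩ := hnd _ (hf 1) h2
    exact ⟨c, toCrossed_eq_algebraMap h1 hc⟩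
  · rintro ⟨c, rfl⟩
    exact isCommutator_algebraMap Rep T c

/-- An operator which commutes with `Π(f)` for all `f ∈ C_c(G, A)` commutes with the crossed
product. -/
theorem commute_of_toCrossed {Rep : crossedProduct α π₀ →⋆ₐ[ℂ] (E →L[ℂ] E)} {χ : E →L[ℂ] E}
    (h : ∀ f : G →₀ A, Rep (toCrossed α π₀ f) * χ = χ * Rep (toCrossed α π₀ f))
    (S : crossedProduct α π₀) : Rep S * χ = χ * Rep S := by
  have hcont : Continuous Rep := by
    refine AddMonoidHomClass.continuous_of_bound Rep 1 fun S => ?_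
    rw [one_mul]
    exact NonUnitalStarAlgHom.norm_apply_le Rep S
  have hcl : IsClosed {S : crossedProduct α π₀ | Rep S * χ = χ * Rep S} :=
    isClosed_eq (hcont.mul continuous_const) (continuous_const.mul hcont)
  have hd := dense_smoothCrossed (π := π₀) α.isSmooth_top (by simp [dense_univ])
  refine hcl.closure_subset_iff.2 ?_ (hd S)
  intro S hS
  obtain ⟨f, -, rfl⟩ := exists_of_mem_smoothCrossed hS
  exact h f

end ModelTriple

/-! ### Operators on direct sums -/

section Graphs

variable {E F : Type*} [NormedAddCommGroup E] [InnerProductSpace ℂ E]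
  [NormedAddCommGroup F] [InnerProductSpace ℂ F]

theorem exists_of_mem_graph {f : E →ₗ.[ℂ] F} {x : E} {y : F} (h : (x, y) ∈ f.graph) :
    ∃ hx : x ∈ f.domain, f ⟨x, hx⟩ = y := by
  obtain ⟨⟨z, hz⟩, h1, h2⟩ := (LinearPMap.mem_graph_iff _).1 h
  simp only at h1 h2
  subst h1
  exact ⟨hz, h2⟩

theorem mem_graph_blockOp {a : E →ₗ.[ℂ] E} {b : F →ₗ.[ℂ] E} {c : E →ₗ.[ℂ] F} {d : F →ₗ.[ℂ] F}
    {x x' : WithLp 2 (E × F)} :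
    (x, x') ∈ (blockOp a b c d).graph ↔ ∃ p q r s, (x.fst, p) ∈ a.graph ∧ (x.snd, q) ∈ b.graph ∧
      (x.fst, r) ∈ c.graph ∧ (x.snd, s) ∈ d.graph ∧ x'.fst = p + q ∧ x'.snd = r + s := by
  constructor
  · intro h
    obtain ⟨⟨z, hz⟩, rfl, rfl⟩ := (LinearPMap.mem_graph_iff _).1 h
    exact ⟨a ⟨z.fst, hz.1.1⟩, b ⟨z.snd, hz.2.1⟩, c ⟨z.fst, hz.1.2⟩, d ⟨z.snd, hz.2.2⟩,
      a.mem_graph ⟨z.fst, hz.1.1⟩, b.mem_graph ⟨z.snd, hz.2.1⟩, c.mem_graph ⟨z.fst, hz.1.2⟩,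
      d.mem_graph ⟨z.snd, hz.2.2⟩, rfl, rfl⟩
  · rintro ⟨p, q, r, s, hp, hq, hr, hs, h1, h2⟩
    obtain ⟨hp', rfl⟩ := exists_of_mem_graph hp
    obtain ⟨hq', rfl⟩ := exists_of_mem_graph hq
    obtain ⟨hr', rfl⟩ := exists_of_mem_graph hr
    obtain ⟨hs', rfl⟩ := exists_of_mem_graph hs
    refine (LinearPMap.mem_graph_iff _).2 ⟨⟨x, ⟨hp', hr'⟩, ⟨hq', hs'⟩⟩, rfl, ?_⟩
    exact WithLp.ofLp_injective 2 (Prod.ext h1.symm h2.symm)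

theorem mem_graph_zero {x : E} {y : F} : (x, y) ∈ (0 : E →ₗ.[ℂ] F).graph ↔ y = 0 := by
  rw [LinearPMap.mem_graph_iff]
  constructor
  · rintro ⟨z, -, rfl⟩
    rfl
  · rintro rfl
    exact ⟨⟨x, trivial⟩, rfl, rfl⟩

theorem mem_graph_offDiagonal {b : F →ₗ.[ℂ] E} {c : E →ₗ.[ℂ] F} {x x' : WithLp 2 (E × F)} :
    (x, x') ∈ (blockOp 0 b c 0).graph ↔
      (x.snd, x'.fst) ∈ b.graph ∧ (x.fst, x'.snd) ∈ c.graph := by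
  rw [mem_graph_blockOp]
  simp only [mem_graph_zero]
  constructor
  · rintro ⟨_, q, r, _, rfl, hq, hr, rfl, h1, h2⟩
    rw [h1, h2, zero_add, add_zero]
    exact ⟨hq, hr⟩
  · rintro ⟨h1, h2⟩
    exact ⟨0, _, _, 0, rfl, h1, h2, rfl, (zero_add _).symm, (add_zero _).symm⟩

theorem mem_graph_smul_op {f : E →ₗ.[ℂ] F} {c : ℂ} {x : E} {y : F} :
    (x, y) ∈ (c • f).graph ↔ ∃ p, (x, p) ∈ f.graph ∧ y = c • p := by
  constructor
  · intro h
    obtain ⟨⟨z, hz⟩, rfl, rfl⟩ := (LinearPMap.mem_graph_iff _).1 h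
    exact ⟨f ⟨z, hz⟩, f.mem_graph _, rfl⟩
  · rintro ⟨p, hp, rfl⟩
    obtain ⟨hz, rfl⟩ := exists_of_mem_graph hp
    exact (LinearPMap.mem_graph_iff _).2 ⟨⟨_, hz⟩, rfl, rfl⟩

theorem mem_graph_neg_op {f : E →ₗ.[ℂ] F} {x : E} {y : F} :
    (x, y) ∈ (-f).graph ↔ ∃ p, (x, p) ∈ f.graph ∧ y = -p := by
  constructor
  · intro h
    obtain ⟨⟨z, hz⟩, rfl, rfl⟩ := (LinearPMap.mem_graph_iff _).1 h
    exact ⟨f ⟨z, hz⟩, f.mem_graph _, rfl⟩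
  · rintro ⟨p, hp, rfl⟩
    obtain ⟨hz, rfl⟩ := exists_of_mem_graph hp
    exact (LinearPMap.mem_graph_iff _).2 ⟨⟨_, hz⟩, rfl, rfl⟩

theorem mem_graph_add_op {f g : E →ₗ.[ℂ] F} {x : E} {y : F} :
    (x, y) ∈ (f + g).graph ↔ ∃ p q, (x, p) ∈ f.graph ∧ (x, q) ∈ g.graph ∧ y = p + q := by
  constructor
  · intro h
    obtain ⟨⟨z, hz⟩, rfl, rfl⟩ := (LinearPMap.mem_graph_iff _).1 h
    exact ⟨f ⟨z, hz.1⟩, g ⟨z, hz.2⟩, f.mem_graph ⟨z, hz.1⟩, g.mem_graph ⟨z, hz.2⟩, rfl⟩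
  · rintro ⟨p, q, hp, hq, rfl⟩
    obtain ⟨hz, rfl⟩ := exists_of_mem_graph hp
    obtain ⟨hz', rfl⟩ := exists_of_mem_graph hq
    exact (LinearPMap.mem_graph_iff _).2 ⟨⟨_, hz, hz'⟩, rfl, rfl⟩

theorem mem_graph_sub_op {f g : E →ₗ.[ℂ] F} {x : E} {y : F} :
    (x, y) ∈ (f - g).graph ↔ ∃ p q, (x, p) ∈ f.graph ∧ (x, q) ∈ g.graph ∧ y = p - q := by
  constructor
  · intro h
    obtain ⟨⟨z, hz⟩, rfl, rfl⟩ := (LinearPMap.mem_graph_iff _).1 h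
    exact ⟨f ⟨z, hz.1⟩, g ⟨z, hz.2⟩, f.mem_graph ⟨z, hz.1⟩, g.mem_graph ⟨z, hz.2⟩, rfl⟩
  · rintro ⟨p, q, hp, hq, rfl⟩
    obtain ⟨hz, rfl⟩ := exists_of_mem_graph hp
    obtain ⟨hz', rfl⟩ := exists_of_mem_graph hq
    exact (LinearPMap.mem_graph_iff _).2 ⟨⟨_, hz, hz'⟩, rfl, rfl⟩

theorem mem_graph_diagOp {G : Type*} {T : G → E →ₗ.[ℂ] F} {p : L2 G E × L2 G F} :
    p ∈ (diagOp T).graph ↔ ∀ y, (p.1 y, p.2 y) ∈ (T y).graph := by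
  rw [diagOp, Submodule.toLinearPMap_graph_eq]
  · rfl
  · intro q hq h0
    ext y
    exact (T y).graph_fst_eq_zero_snd (hq y) (by rw [h0]; rfl)

theorem mem_graph_lengthOp {G : Type*} [Group G] {V : Type*} [NormedAddCommGroup V]
    [InnerProductSpace ℂ V] [CompleteSpace V] {ℓ : G → selfAdjoint (V →L[ℂ] V)}
    {ξ m : L2 G (E ⊗[ℂ] V)} :
    (ξ, m) ∈ (lengthOp ℓ E).graph ↔ ∀ y, m y = (ℓ y : V →L[ℂ] V).lTensor E (ξ y) := by
  rw [lengthOp, mem_graph_diagOp]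
  refine forall_congr' fun y => ?_
  rw [LinearPMap.mem_graph_iff]
  constructor
  · rintro ⟨z, h1, h2⟩
    simp only at h1 h2
    rw [← h1, ← h2]
    rfl
  · intro h
    exact ⟨⟨ξ y, trivial⟩, rfl, h.symm⟩

end Graphs

/-! ### The unitary from a direct sum to the model space -/

section Inclusions

set_option linter.unusedSectionVars false

variable (E F : Type*) [NormedAddCommGroup E] [InnerProductSpace ℂ E]
  [NormedAddCommGroup F] [InnerProductSpace ℂ F]

/-- The inclusion of the first summand of `E ⊕ F`. -/
def inlL : E →L[ℂ] WithLp 2 (E × F) :=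
  ((WithLp.prodContinuousLinearEquiv 2 ℂ E F).symm : E × F →L[ℂ] WithLp 2 (E × F)) ∘L
    ContinuousLinearMap.inl ℂ E F

/-- The inclusion of the second summand of `E ⊕ F`. -/
def inrL : F →L[ℂ] WithLp 2 (E × F) :=
  ((WithLp.prodContinuousLinearEquiv 2 ℂ E F).symm : E × F →L[ℂ] WithLp 2 (E × F)) ∘L
    ContinuousLinearMap.inr ℂ E F

/-- The projection of `E ⊕ F` onto the first summand. -/
def fstL : WithLp 2 (E × F) →L[ℂ] E :=
  ContinuousLinearMap.fst ℂ E F ∘L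
    (WithLp.prodContinuousLinearEquiv 2 ℂ E F : WithLp 2 (E × F) →L[ℂ] E × F)

/-- The projection of `E ⊕ F` onto the second summand. -/
def sndL : WithLp 2 (E × F) →L[ℂ] F :=
  ContinuousLinearMap.snd ℂ E F ∘L
    (WithLp.prodContinuousLinearEquiv 2 ℂ E F : WithLp 2 (E × F) →L[ℂ] E × F)

variable {E F}

theorem fstL_apply (x : WithLp 2 (E × F)) : fstL E F x = x.fst := rfl
theorem sndL_apply (x : WithLp 2 (E × F)) : sndL E F x = x.snd := rfl

theorem prod_ext {x y : WithLp 2 (E × F)} (h1 : x.fst = y.fst) (h2 : x.snd = y.snd) : x = y :=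
  WithLp.ofLp_injective 2 (Prod.ext h1 h2)

theorem inlL_add_inrL (x : WithLp 2 (E × F)) : inlL E F x.fst + inrL E F x.snd = x :=
  prod_ext (add_zero _) (zero_add _)

variable [CompleteSpace E] [CompleteSpace F]

theorem adjoint_inlL : ContinuousLinearMap.adjoint (inlL E F) = fstL E F := by
  symm
  rw [ContinuousLinearMap.eq_adjoint_iff]
  intro x y
  rw [WithLp.prod_inner_apply]
  change _ = inner ℂ x.fst y + inner ℂ x.snd (0 : F)
  rw [inner_zero_right, add_zero]
  rfl

theorem adjoint_inrL : ContinuousLinearMap.adjoint (inrL E F) = sndL E F := by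
  symm
  rw [ContinuousLinearMap.eq_adjoint_iff]
  intro x y
  rw [WithLp.prod_inner_apply]
  change _ = inner ℂ x.fst (0 : E) + inner ℂ x.snd y
  rw [inner_zero_right, zero_add]
  rfl

variable {G : Type*} {V : Type*} [NormedAddCommGroup V] [InnerProductSpace ℂ V]

theorem fstL_rTensor_inlL (z : E ⊗[ℂ] V) :
    (fstL E F).rTensor V ((inlL E F).rTensor V z) = z := by
  induction z using TensorProduct.induction_on with
  | zero => simp
  | add x y hx hy => simp only [map_add, hx, hy]
  | tmul y u => rfl

theorem sndL_rTensor_inrL (z : F ⊗[ℂ] V) :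
    (sndL E F).rTensor V ((inrL E F).rTensor V z) = z := by
  induction z using TensorProduct.induction_on with
  | zero => simp
  | add x y hx hy => simp only [map_add, hx, hy]
  | tmul y u => rfl

theorem sndL_rTensor_inlL (z : E ⊗[ℂ] V) :
    (sndL E F).rTensor V ((inlL E F).rTensor V z) = 0 := by
  induction z using TensorProduct.induction_on with
  | zero => simp
  | add x y hx hy => simp only [map_add, hx, hy, add_zero]
  | tmul y u => exact TensorProduct.zero_tmul _ _

theorem fstL_rTensor_inrL (z : F ⊗[ℂ] V) :
    (fstL E F).rTensor V ((inrL E F).rTensor V z) = 0 := by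
  induction z using TensorProduct.induction_on with
  | zero => simp
  | add x y hx hy => simp only [map_add, hx, hy, add_zero]
  | tmul y u => exact TensorProduct.zero_tmul _ _

theorem inlL_rTensor_add_inrL_rTensor (z : WithLp 2 (E × F) ⊗[ℂ] V) :
    (inlL E F).rTensor V ((fstL E F).rTensor V z)
      + (inrL E F).rTensor V ((sndL E F).rTensor V z) = z := by
  induction z using TensorProduct.induction_on with
  | zero => simp
  | add x y hx hy =>
    simp only [map_add]
    rw [add_add_add_comm, hx, hy]
  | tmul y u =>
    simp only [ContinuousLinearMap.rTensor_tmul, ← TensorProduct.add_tmul]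
    rw [fstL_apply, sndL_apply, inlL_add_inrL]

variable [FiniteDimensional ℂ V] [CompleteSpace V]

variable (E F G V) in
/-- The unitary `(E ⊗ ℓ²(G) ⊗ V) ⊕ (F ⊗ ℓ²(G) ⊗ V) ≃ (E ⊕ F) ⊗ ℓ²(G) ⊗ V`. -/
def sumUnitary : WithLp 2 (L2 G (E ⊗[ℂ] V) × L2 G (F ⊗[ℂ] V)) ≃ₗᵢ[ℂ]
    L2 G (WithLp 2 (E × F) ⊗[ℂ] V) :=
  LinearEquiv.isometryOfInner
    { toFun := fun ξ => lmap ((inlL E F).rTensor V) ξ.fst + lmap ((inrL E F).rTensor V) ξ.snd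
      invFun := fun η => WithLp.toLp 2
        (lmap ((fstL E F).rTensor V) η, lmap ((sndL E F).rTensor V) η)
      map_add' := fun ξ η => by
        rw [WithLp.add_fst, WithLp.add_snd, map_add, map_add]
        abel
      map_smul' := fun c ξ => by
        rw [WithLp.smul_fst, WithLp.smul_snd, map_smul, map_smul, smul_add]
        rfl
      left_inv := fun ξ => by
        refine prod_ext ?_ ?_
        · ext y
          change (fstL E F).rTensor V ((inlL E F).rTensor V (ξ.fst y)
            + (inrL E F).rTensor V (ξ.snd y)) = ξ.fst y
          rw [map_add, fstL_rTensor_inlL, fstL_rTensor_inrL, add_zero]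
        · ext y
          change (sndL E F).rTensor V ((inlL E F).rTensor V (ξ.fst y)
            + (inrL E F).rTensor V (ξ.snd y)) = ξ.snd y
          rw [map_add, sndL_rTensor_inlL, sndL_rTensor_inrL, zero_add]
      right_inv := fun η => by
        ext y
        exact inlL_rTensor_add_inrL_rTensor (η y) }
    fun ξ η => by
      change inner ℂ (lmap ((inlL E F).rTensor V) ξ.fst + lmap ((inrL E F).rTensor V) ξ.snd)
        (lmap ((inlL E F).rTensor V) η.fst + lmap ((inrL E F).rTensor V) η.snd) = _
      rw [inner_add_left, inner_lmap, inner_lmap, ContinuousLinearMap.adjoint_rTensor,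
        ContinuousLinearMap.adjoint_rTensor, adjoint_inlL, adjoint_inrL, WithLp.prod_inner_apply]
      congr 2
      · ext y
        change (fstL E F).rTensor V ((inlL E F).rTensor V (η.fst y)
            + (inrL E F).rTensor V (η.snd y)) = η.fst y
        rw [map_add, fstL_rTensor_inlL, fstL_rTensor_inrL, add_zero]
      · ext y
        change (sndL E F).rTensor V ((inlL E F).rTensor V (η.fst y)
            + (inrL E F).rTensor V (η.snd y)) = η.snd y
        rw [map_add, sndL_rTensor_inlL, sndL_rTensor_inrL, zero_add]

theorem sumUnitary_apply (ξ : WithLp 2 (L2 G (E ⊗[ℂ] V) × L2 G (F ⊗[ℂ] V))) (y : G) :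
    sumUnitary E F G V ξ y
      = (inlL E F).rTensor V (ξ.fst y) + (inrL E F).rTensor V (ξ.snd y) := rfl

/-- After slicing, the unitary merely pairs the two components, so identities in `(E ⊕ F) ⊗ V`
reduce to componentwise identities in `E ⊕ F`. -/
theorem slice_sumUnitary (v : V) (ξ : WithLp 2 (L2 G (E ⊗[ℂ] V) × L2 G (F ⊗[ℂ] V))) (y : G) :
    slice v (sumUnitary E F G V ξ y)
      = WithLp.toLp 2 (slice v (ξ.fst y), slice v (ξ.snd y)) := by
  rw [sumUnitary_apply, map_add, slice_rTensor, slice_rTensor]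
  exact prod_ext (add_zero (slice v (ξ.fst y))) (zero_add (slice v (ξ.snd y)))

theorem ext_slice {X : Type*} [NormedAddCommGroup X] [InnerProductSpace ℂ X] {z z' : X ⊗[ℂ] V}
    (h : ∀ v, slice v z = slice v z') : z = z' :=
  sub_eq_zero.1 (eq_zero_of_slice fun v => by rw [map_sub, h, sub_self])

/-- A direct sum of regular representations is the regular representation of the direct sum. -/
theorem dsum_regRep {A : Type*} [CStarAlgebra A] [Group G] (α : TwistedAction G A)
    (πp : A →⋆ₐ[ℂ] (E →L[ℂ] E)) (πm : A →⋆ₐ[ℂ] (F →L[ℂ] F)) (f : G →₀ A) :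
    dsum (regRep α (ampl V πp) f) (regRep α (ampl V πm) f)
      = conjBy (sumUnitary E F G V) (regRep α (ampl V (repSum πp πm)) f) := by
  ext1 ξ
  rw [conjBy_apply, LinearIsometryEquiv.eq_symm_apply]
  ext y
  refine ext_slice fun v => ?_
  rw [slice_sumUnitary]
  change WithLp.toLp 2 (slice v (regRep α (ampl V πp) f ξ.fst y),
    slice v (regRep α (ampl V πm) f ξ.snd y)) = _
  simp only [regRep, Finsupp.sum, sum_apply, lp.coeFn_sum, Finset.sum_apply, map_sum,
    regSingle_apply]
  have h : ∀ (a : A) (z : G), slice v (ampl V (repSum πp πm) a (sumUnitary E F G V ξ z))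
      = WithLp.toLp 2 (slice v (ampl V πp a (ξ.fst z)), slice v (ampl V πm a (ξ.snd z))) := by
    intro a z
    change slice v ((repSum πp πm a).rTensor V _) = WithLp.toLp 2
      (slice v ((πp a).rTensor V _), slice v ((πm a).rTensor V _))
    rw [slice_rTensor, slice_rTensor, slice_rTensor, slice_sumUnitary]
    rfl
  simp only [h]
  rw [← WithLp.toLp_sum]
  congr 1
  exact prod_mk_sum _ _ _

/-- The Dirac operators on the two summands in the model. -/
theorem isDiracModel_sumUnitary [Group G] {ℓ : G → selfAdjoint (V →L[ℂ] V)} {Dp : E →ₗ.[ℂ] F}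
    {Dm : F →ₗ.[ℂ] E} {J : WithLp 2 (E × F) →L[ℂ] WithLp 2 (E × F)}
    {T : WithLp 2 (L2 G (E ⊗[ℂ] V) × L2 G (F ⊗[ℂ] V)) →ₗ.[ℂ]
      WithLp 2 (L2 G (E ⊗[ℂ] V) × L2 G (F ⊗[ℂ] V))}
    (J' : WithLp 2 (L2 G (E ⊗[ℂ] V) × L2 G (F ⊗[ℂ] V)) →
      WithLp 2 (L2 G (E ⊗[ℂ] V) × L2 G (F ⊗[ℂ] V)))
    (hJ : ∀ m (y : G) (v : V), slice v (sumUnitary E F G V (J' m) y)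
      = J (slice v (sumUnitary E F G V m y)))
    (hT : ∀ ξ ξ', (ξ, ξ') ∈ T.graph ↔ ∃ u m : WithLp 2 (L2 G (E ⊗[ℂ] V) × L2 G (F ⊗[ℂ] V)),
      (ξ.fst, u.snd) ∈ (liftOp G V Dp).graph ∧ (ξ.snd, u.fst) ∈ (liftOp G V Dm).graph ∧
      (ξ.fst, m.fst) ∈ (lengthOp ℓ E).graph ∧ (ξ.snd, m.snd) ∈ (lengthOp ℓ F).graph ∧
      ξ' = u + J' m) :
    IsDiracModel ℓ (blockOp 0 Dm Dp 0) J T (sumUnitary E F G V) := by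
  have hJ' : ∀ m, lmap (J.rTensor V) (sumUnitary E F G V m) = sumUnitary E F G V (J' m) := by
    intro m
    ext y
    refine ext_slice fun v => ?_
    rw [lmap_apply, slice_rTensor, hJ]
  have h1 : ∀ ξ u : WithLp 2 (L2 G (E ⊗[ℂ] V) × L2 G (F ⊗[ℂ] V)),
      (∀ y, (sumUnitary E F G V ξ y, sumUnitary E F G V u y)
        ∈ (tensorOp V (blockOp 0 Dm Dp 0)).graph) ↔
      (ξ.fst, u.snd) ∈ (liftOp G V Dp).graph ∧ (ξ.snd, u.fst) ∈ (liftOp G V Dm).graph := by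
    intro ξ u
    simp only [liftOp, mem_graph_diagOp, mem_graph_tensorOp, slice_sumUnitary,
      mem_graph_offDiagonal, WithLp.toLp_fst, WithLp.toLp_snd]
    exact ⟨fun h => ⟨fun y v => (h y v).2, fun y v => (h y v).1⟩,
      fun h y v => ⟨h.2 y v, h.1 y v⟩⟩
  have h2 : ∀ ξ m : WithLp 2 (L2 G (E ⊗[ℂ] V) × L2 G (F ⊗[ℂ] V)),
      (∀ y, sumUnitary E F G V m y
        = (ℓ y : V →L[ℂ] V).lTensor (WithLp 2 (E × F)) (sumUnitary E F G V ξ y)) ↔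
      (ξ.fst, m.fst) ∈ (lengthOp ℓ E).graph ∧ (ξ.snd, m.snd) ∈ (lengthOp ℓ F).graph := by
    intro ξ m
    rw [mem_graph_lengthOp, mem_graph_lengthOp, ← forall_and]
    refine forall_congr' fun y => ?_
    constructor
    · intro h
      constructor
      · refine ext_slice fun v => ?_
        have := congrArg (fun z => (slice v z).fst) h
        simpa only [slice_lTensor, slice_sumUnitary, WithLp.toLp_fst] using this
      · refine ext_slice fun v => ?_
        have := congrArg (fun z => (slice v z).snd) h
        simpa only [slice_lTensor, slice_sumUnitary, WithLp.toLp_snd] using this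
    · rintro ⟨h3, h4⟩
      refine ext_slice fun v => ?_
      rw [slice_lTensor, slice_sumUnitary, slice_sumUnitary, h3, h4, slice_lTensor, slice_lTensor]
  intro ξ ξ'
  rw [hT]
  constructor
  · rintro ⟨u, m, hu1, hu2, hm1, hm2, rfl⟩
    refine ⟨sumUnitary E F G V u, sumUnitary E F G V m, (h1 ξ u).2 ⟨hu1, hu2⟩,
      (h2 ξ m).2 ⟨hm1, hm2⟩, ?_⟩
    rw [hJ', map_add]
  · rintro ⟨u, m, hu, hm, h⟩
    obtain ⟨u, rfl⟩ := (sumUnitary E F G V).surjective u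
    obtain ⟨m, rfl⟩ := (sumUnitary E F G V).surjective m
    obtain ⟨hu1, hu2⟩ := (h1 ξ u).1 hu
    obtain ⟨hm1, hm2⟩ := (h2 ξ m).1 hm
    rw [hJ', ← map_add] at h
    exact ⟨u, m, hu1, hu2, hm1, hm2, (sumUnitary E F G V).injective h⟩

end Inclusions

/-! ### The two Dirac operators -/

section Instances

set_option linter.unusedSectionVars false

variable {E F : Type*} [NormedAddCommGroup E] [InnerProductSpace ℂ E] [CompleteSpace E]
  [NormedAddCommGroup F] [InnerProductSpace ℂ F] [CompleteSpace F]

theorem nontrivial_of_injective {A : Type*} [CStarAlgebra A] [Nontrivial A]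
    {π : A →⋆ₐ[ℂ] (E →L[ℂ] E)} (h : Function.Injective π) : Nontrivial E := by
  by_contra hE
  rw [not_nontrivial_iff_subsingleton] at hE
  refine one_ne_zero (α := A) (h ?_)
  ext x
  exact Subsingleton.elim _ _

theorem adjoint_dsum_one_neg_one : ContinuousLinearMap.adjoint
    (dsum 1 (-1) : WithLp 2 (E × F) →L[ℂ] WithLp 2 (E × F)) = dsum 1 (-1) := by
  symm
  rw [ContinuousLinearMap.eq_adjoint_iff]
  intro x y
  rw [WithLp.prod_inner_apply, WithLp.prod_inner_apply]
  change inner ℂ x.fst y.fst + inner ℂ (-x.snd) y.snd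
    = inner ℂ x.fst y.fst + inner ℂ x.snd (-y.snd)
  rw [inner_neg_left, inner_neg_right]

theorem isAnticommuting_dsum (b : F →ₗ.[ℂ] E) (c : E →ₗ.[ℂ] F) :
    IsAnticommuting (blockOp 0 b c 0) (dsum 1 (-1)) where
  adjoint := adjoint_dsum_one_neg_one
  sq x := prod_ext rfl (neg_neg x.snd)
  anticomm x x' h := by
    rw [mem_graph_offDiagonal] at h ⊢
    have h1 := b.graph.neg_mem h.1
    exact ⟨h1, by simpa [dsum] using h.2⟩

theorem grading_of_isAnticommuting {D : E →ₗ.[ℂ] E} {J : E →L[ℂ] E} (h : IsAnticommuting D J)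
    (ξ : D.domain) : ∃ hξ : J ξ ∈ D.domain, D ⟨J ξ, hξ⟩ = -J (D ξ) :=
  exists_of_mem_graph (h.anticomm _ _ (D.mem_graph ξ))

theorem repSum_mul_dsum {A : Type*} [CStarAlgebra A] (πp : A →⋆ₐ[ℂ] (E →L[ℂ] E))
    (πm : A →⋆ₐ[ℂ] (F →L[ℂ] F)) (a : A) :
    repSum πp πm a * dsum 1 (-1) = dsum 1 (-1) * repSum πp πm a := by
  ext1 x
  exact prod_ext rfl (map_neg (πm a) x.snd)

theorem dsum_mul_dsum (S : E →L[ℂ] E) (T : F →L[ℂ] F) :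
    dsum S T * dsum 1 (-1) = dsum 1 (-1) * dsum S T := by
  ext1 x
  exact prod_ext rfl (map_neg T x.snd)

variable (E) in
/-- The operator `(0, -i; i, 0)` on `E ⊕ E`. -/
def rotation : WithLp 2 (E × E) →L[ℂ] WithLp 2 (E × E) :=
  inlL E E ∘L ((-Complex.I) • sndL E E) + inrL E E ∘L (Complex.I • fstL E E)

theorem rotation_fst (x : WithLp 2 (E × E)) : (rotation E x).fst = -Complex.I • x.snd :=
  add_zero _

theorem rotation_snd (x : WithLp 2 (E × E)) : (rotation E x).snd = Complex.I • x.fst :=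
  zero_add _

theorem isAnticommuting_rotation (D : E →ₗ.[ℂ] E) :
    IsAnticommuting (blockOp 0 D D 0) (rotation E) where
  adjoint := by
    symm
    rw [ContinuousLinearMap.eq_adjoint_iff]
    intro x y
    rw [WithLp.prod_inner_apply, WithLp.prod_inner_apply]
    change inner ℂ (rotation E x).fst y.fst + inner ℂ (rotation E x).snd y.snd
      = inner ℂ x.fst (rotation E y).fst + inner ℂ x.snd (rotation E y).snd
    rw [rotation_fst, rotation_fst, rotation_snd, rotation_snd]
    simp only [inner_smul_left, inner_smul_right, map_neg, Complex.conj_I]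
    ring
  sq x := by
    refine prod_ext ?_ ?_
    · rw [rotation_fst, rotation_snd, smul_smul, neg_mul, Complex.I_mul_I, neg_neg, one_smul]
    · rw [rotation_snd, rotation_fst, smul_smul, mul_neg, Complex.I_mul_I, neg_neg, one_smul]
  anticomm x x' h := by
    rw [mem_graph_offDiagonal] at h ⊢
    have h1 := D.graph.smul_mem (-Complex.I) h.1
    have h2 := D.graph.smul_mem Complex.I h.2
    simp only [WithLp.neg_fst, WithLp.neg_snd, rotation_fst, rotation_snd]
    refine ⟨?_, ?_⟩
    · simpa using h2
    · simpa using h1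

theorem repSum_mul_rotation {A : Type*} [CStarAlgebra A] (π : A →⋆ₐ[ℂ] (E →L[ℂ] E)) (a : A) :
    repSum π π a * rotation E = rotation E * repSum π π a := by
  ext1 x
  refine prod_ext ?_ ?_
  · change π a (rotation E x).fst = (rotation E (repSum π π a x)).fst
    rw [rotation_fst, rotation_fst, map_smul]
    rfl
  · change π a (rotation E x).snd = (rotation E (repSum π π a x)).snd
    rw [rotation_snd, rotation_snd, map_smul]
    rfl

variable {G : Type*} [Group G] {V : Type*} [NormedAddCommGroup V] [InnerProductSpace ℂ V]
  [FiniteDimensional ℂ V] [CompleteSpace V]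

theorem isDiracModel_evenToOdd (ℓ : G → selfAdjoint (V →L[ℂ] V)) (Dp : E →ₗ.[ℂ] F)
    (Dm : F →ₗ.[ℂ] E) :
    IsDiracModel ℓ (blockOp 0 Dm Dp 0) (dsum 1 (-1)) (diracEvenToOdd ℓ Dp Dm)
      (sumUnitary E F G V) := by
  refine isDiracModel_sumUnitary (fun m => WithLp.toLp 2 (m.fst, -m.snd)) (fun m y v => ?_)
    fun ξ ξ' => ?_
  · rw [slice_sumUnitary, slice_sumUnitary]
    exact prod_ext rfl (map_neg (slice v) _)
  · rw [diracEvenToOdd, mem_graph_blockOp]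
    simp only [mem_graph_neg_op]
    constructor
    · rintro ⟨p, q, r, _, hp, hq, hr, ⟨s, hs, rfl⟩, h1, h2⟩
      refine ⟨WithLp.toLp 2 (q, r), WithLp.toLp 2 (p, s), hr, hq, hp, hs, prod_ext ?_ ?_⟩
      · rw [h1, add_comm]
        rfl
      · exact h2
    · rintro ⟨u, m, hr, hq, hp, hs, rfl⟩
      exact ⟨m.fst, u.fst, u.snd, _, hp, hq, hr, ⟨m.snd, hs, rfl⟩, add_comm u.fst m.fst, rfl⟩

/-- The off-diagonal entries `D ∓ iℓ` are those of `(0 D; D 0)` plus those of `(0 -i; i 0)` times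
`diag(ℓ, ℓ)`. -/
theorem isDiracModel_oddToEven (ℓ : G → selfAdjoint (V →L[ℂ] V)) (D : E →ₗ.[ℂ] E) :
    IsDiracModel ℓ (blockOp 0 D D 0) (rotation E) (diracOddToEven ℓ D) (sumUnitary E E G V) := by
  refine isDiracModel_sumUnitary
    (fun m => WithLp.toLp 2 (-Complex.I • m.snd, Complex.I • m.fst)) (fun m y v => ?_)
    fun ξ ξ' => ?_
  · rw [slice_sumUnitary, slice_sumUnitary]
    refine prod_ext ?_ ?_
    · rw [rotation_fst]
      exact (slice v).map_smul (-Complex.I) (m.snd y)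
    · rw [rotation_snd]
      exact (slice v).map_smul Complex.I (m.fst y)
  · rw [diracOddToEven, mem_graph_offDiagonal, mem_graph_sub_op, mem_graph_add_op]
    simp only [mem_graph_smul_op]
    constructor
    · rintro ⟨⟨p, _, hp, ⟨q, hq, rfl⟩, h1⟩, ⟨r, _, hr, ⟨s, hs, rfl⟩, h2⟩⟩
      refine ⟨WithLp.toLp 2 (p, r), WithLp.toLp 2 (s, q), hr, hp, hs, hq, prod_ext ?_ ?_⟩
      · rw [h1, sub_eq_add_neg, ← neg_smul]
        rfl
      · exact h2
    · rintro ⟨u, m, hr, hp, hs, hq, rfl⟩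
      refine ⟨⟨u.fst, _, hp, ⟨m.snd, hq, rfl⟩, ?_⟩, ⟨u.snd, _, hr, ⟨m.fst, hs, rfl⟩, rfl⟩⟩
      rw [sub_eq_add_neg, ← neg_smul]
      rfl

end Instances

/-! ### The double of an odd spectral triple -/

section Double

variable {E : Type*} [NormedAddCommGroup E] [InnerProductSpace ℂ E] [CompleteSpace E]
  {D : E →ₗ.[ℂ] E}

/-- The Hilbert basis of `E ⊕ E` given by two copies of a Hilbert basis of `E`. -/
theorem exists_hilbertBasis_double {ι : Type*} (w : HilbertBasis ι ℂ E) :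
    ∃ w' : HilbertBasis (ι ⊕ ι) ℂ (WithLp 2 (E × E)),
      (∀ k, w' (Sum.inl k) = inlL E E (w k)) ∧ ∀ k, w' (Sum.inr k) = inrL E E (w k) := by
  classical
  let v : ι ⊕ ι → WithLp 2 (E × E) := Sum.elim (fun k => inlL E E (w k)) fun k => inrL E E (w k)
  have hw := orthonormal_iff_ite.1 w.orthonormal
  have hv : Orthonormal ℂ v := by
    rw [orthonormal_iff_ite]
    rintro (j | j) (k | k)
    · rw [WithLp.prod_inner_apply]
      change inner ℂ (w j) (w k) + inner ℂ (0 : E) 0 = _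
      simp [hw]
    · rw [WithLp.prod_inner_apply]
      change inner ℂ (w j) 0 + inner ℂ (0 : E) (w k) = _
      simp
    · rw [WithLp.prod_inner_apply]
      change inner ℂ 0 (w k) + inner ℂ (w j) (0 : E) = _
      simp
    · rw [WithLp.prod_inner_apply]
      change inner ℂ (0 : E) 0 + inner ℂ (w j) (w k) = _
      simp [hw]
  have h0 : ∀ x : E, (∀ k, inner ℂ (w k) x = 0) → x = 0 := fun x hx => by
    refine w.repr.injective ?_
    ext k
    rw [w.repr_apply_apply, hx, map_zero]
    rfl
  refine ⟨HilbertBasis.mkOfOrthogonalEqBot hv ?_, fun k => ?_, fun k => ?_⟩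
  · rw [Submodule.eq_bot_iff]
    intro x hx
    refine prod_ext (h0 _ fun k => ?_) (h0 _ fun k => ?_)
    · have := (Submodule.mem_orthogonal _ _).1 hx _ (Submodule.subset_span ⟨Sum.inl k, rfl⟩)
      rw [WithLp.prod_inner_apply] at this
      change inner ℂ (w k) x.fst + inner ℂ (0 : E) x.snd = 0 at this
      simpa using this
    · have := (Submodule.mem_orthogonal _ _).1 hx _ (Submodule.subset_span ⟨Sum.inr k, rfl⟩)
      rw [WithLp.prod_inner_apply] at this
      change inner ℂ (0 : E) x.fst + inner ℂ (w k) x.snd = 0 at this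
      simpa using this
  · rw [HilbertBasis.coe_mkOfOrthogonalEqBot]
    rfl
  · rw [HilbertBasis.coe_mkOfOrthogonalEqBot]
    rfl

/-- The square of `(0 D; D 0)` is `D² ⊕ D²`, so each eigenvalue occurs once in each summand. -/
theorem SqDiagonal.double {ι : Type*} {w : HilbertBasis ι ℂ E} {κ : ι → ℝ}
    (h : SqDiagonal D w κ) :
    ∃ w' : HilbertBasis (ι ⊕ ι) ℂ (WithLp 2 (E × E)),
      SqDiagonal (blockOp 0 D D 0) w' (Sum.elim κ κ) := by
  obtain ⟨w', h1, h2⟩ := exists_hilbertBasis_double w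
  refine ⟨w', ?_, ?_, ?_⟩
  · intro x x' y y' hx hy
    rw [mem_graph_offDiagonal] at hx hy
    rw [WithLp.prod_inner_apply, WithLp.prod_inner_apply]
    change inner ℂ x'.fst y.fst + inner ℂ x'.snd y.snd
      = inner ℂ x.fst y'.fst + inner ℂ x.snd y'.snd
    rw [h.symm _ _ _ _ hx.1 hy.2, h.symm _ _ _ _ hx.2 hy.1, add_comm]
  · have : ((blockOp 0 D D 0).graph : Set (WithLp 2 (E × E) × WithLp 2 (E × E)))
        = (fun p => (sndL E E p.1, fstL E E p.2)) ⁻¹' (D.graph : Set (E × E))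
          ∩ (fun p => (fstL E E p.1, sndL E E p.2)) ⁻¹' (D.graph : Set (E × E)) := by
      ext ⟨x, x'⟩
      exact mem_graph_offDiagonal
    rw [this]
    exact (h.closed.preimage (by fun_prop)).inter (h.closed.preimage (by fun_prop))
  · rintro (k | k)
    · obtain ⟨u, hu, hu'⟩ := h.sq k
      refine ⟨inrL E E u, ?_, ?_⟩
      · rw [h1, mem_graph_offDiagonal]
        exact ⟨D.graph.zero_mem, hu⟩
      · rw [h1, mem_graph_offDiagonal, ← map_smul]
        exact ⟨hu', D.graph.zero_mem⟩
    · obtain ⟨u, hu, hu'⟩ := h.sq k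
      refine ⟨inlL E E u, ?_, ?_⟩
      · rw [h2, mem_graph_offDiagonal]
        exact ⟨hu, D.graph.zero_mem⟩
      · rw [h2, mem_graph_offDiagonal, ← map_smul]
        exact ⟨D.graph.zero_mem, hu'⟩

/-- Each zeta sum is merely doubled, which preserves finiteness at every positive exponent. -/
theorem double_properties (hD : IsSelfAdjoint D)
    (hc : IsCompactOperator (invOneAddSq D ^ (1 / 2 : ℝ))) :
    IsSelfAdjoint (blockOp 0 D D 0) ∧
      IsCompactOperator (invOneAddSq (blockOp 0 D D 0) ^ (1 / 2 : ℝ)) ∧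
      ∀ t, 0 < t → (zeta (blockOp 0 D D 0) t < ∞ ↔ zeta D t < ∞) := by
  obtain ⟨ι, w, κ, h⟩ := exists_sqDiagonal hD hc
  obtain ⟨w', h'⟩ := h.double
  refine ⟨h'.isSelfAdjoint, h'.isCompactOperator fun C => ?_, fun t ht => ?_⟩
  · have hf := h.finite_le hc C
    refine ((hf.image Sum.inl).union (hf.image Sum.inr)).subset ?_
    rintro (k | k) hk
    · exact Or.inl ⟨k, hk, rfl⟩
    · exact Or.inr ⟨k, hk, rfl⟩
  · rw [h'.zeta_eq ht, h.zeta_eq ht]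
    have hs : HasSum (fun k => ENNReal.ofReal ((1 + Sum.elim κ κ k) ^ (-(t / 2)))) _ :=
      HasSum.sum
        (ENNReal.summable (f := fun k => ENNReal.ofReal ((1 + κ k) ^ (-(t / 2))))).hasSum
        (ENNReal.summable (f := fun k => ENNReal.ofReal ((1 + κ k) ^ (-(t / 2))))).hasSum
    rw [hs.tsum_eq, ENNReal.add_lt_top, and_self]

theorem finitelySummable_double (hD : IsSelfAdjoint D)
    (hc : IsCompactOperator (invOneAddSq D ^ (1 / 2 : ℝ))) (hfs : FinitelySummable D) :
    FinitelySummable (blockOp 0 D D 0) := by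
  obtain ⟨t, ht, h⟩ := hfs
  exact ⟨t, ht, ((double_properties hD hc).2.2 t ht).2 h⟩

theorem abscissa_double (hD : IsSelfAdjoint D)
    (hc : IsCompactOperator (invOneAddSq D ^ (1 / 2 : ℝ))) :
    abscissa (blockOp 0 D D 0) = abscissa D := by
  rw [abscissa, abscissa]
  congr 1
  ext t
  exact and_congr_right fun ht => (double_properties hD hc).2.2 t ht

variable {A : Type*} [CStarAlgebra A] {π : A →⋆ₐ[ℂ] (E →L[ℂ] E)}

theorem isCommutator_double {a : A} {T : E →L[ℂ] E} (h : IsCommutator D (π a) T) :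
    IsCommutator (blockOp 0 D D 0) (repSum π π a)
      (inlL E E ∘L T ∘L sndL E E + inrL E E ∘L T ∘L fstL E E) := by
  rw [isCommutator_iff] at h ⊢
  intro x x' hx
  rw [mem_graph_offDiagonal] at hx ⊢
  have h1 := h _ _ hx.1
  have h2 := h _ _ hx.2
  rw [← add_zero (T x.snd)] at h1
  rw [← zero_add (T x.fst)] at h2
  exact ⟨h1, h2⟩

theorem isCommutator_of_double {a : A} (h : IsCommutator (blockOp 0 D D 0) (repSum π π a) 0) :
    IsCommutator D (π a) 0 := by
  rw [isCommutator_iff] at h ⊢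
  intro x x' hx
  have h1 := h (inlL E E x) (inrL E E x') (mem_graph_offDiagonal.2 ⟨D.graph.zero_mem, hx⟩)
  exact (mem_graph_offDiagonal.1 h1).2

theorem UniformlyBounded.double {G : Type*} [Group G] {α : TwistedAction G A}
    {𝒜 : StarSubalgebra ℂ A} (h : UniformlyBounded α π 𝒜 D) :
    UniformlyBounded α (repSum π π) 𝒜 (blockOp 0 D D 0) := by
  intro a ha y
  obtain ⟨C, hC⟩ := h a ha y
  refine ⟨‖inlL E E‖ * (C * ‖sndL E E‖) + ‖inrL E E‖ * (C * ‖fstL E E‖), fun x => ?_⟩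
  obtain ⟨T, hT, hTC⟩ := hC x
  refine ⟨_, isCommutator_double hT, (norm_add_le _ _).trans (add_le_add ?_ ?_)⟩
  · refine (ContinuousLinearMap.opNorm_comp_le _ _).trans ?_
    gcongr
    refine (ContinuousLinearMap.opNorm_comp_le _ _).trans ?_
    gcongr
  · refine (ContinuousLinearMap.opNorm_comp_le _ _).trans ?_
    gcongr
    refine (ContinuousLinearMap.opNorm_comp_le _ _).trans ?_
    gcongr

end Double

end TwistedTriple

end

/-! ### The theorem, from the odd and the even instance of the model -/

open TwistedTriple in
theorem theorem3p4
    {A : Type*} [CStarAlgebra A] [Nontrivial A] {G : Type*} [Group G]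
    {V : Type*} [NormedAddCommGroup V] [InnerProductSpace ℂ V] [FiniteDimensional ℂ V]
    [CompleteSpace V] [Nontrivial V]
    {H : Type*} [NormedAddCommGroup H] [InnerProductSpace ℂ H] [CompleteSpace H]
    {Hp : Type*} [NormedAddCommGroup Hp] [InnerProductSpace ℂ Hp] [CompleteSpace Hp]
    {Hm : Type*} [NormedAddCommGroup Hm] [InnerProductSpace ℂ Hm] [CompleteSpace Hm]
    (𝒜 : StarSubalgebra ℂ A) (α : TwistedAction G A) (hα : α.IsSmooth 𝒜)
    (ℓ : G → selfAdjoint (V →L[ℂ] V)) (hℓb : TranslationBounded ℓ) (hℓp : IsProperLength ℓ) :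
    -- odd to even
    (∀ (π : A →⋆ₐ[ℂ] (H →L[ℂ] H)) (D : H →ₗ.[ℂ] H),
      IsSpectralTriple 𝒜 π D → Function.Injective π → UniformlyBounded α π 𝒜 D →
      ∃ Rep : crossedProduct α π →⋆ₐ[ℂ]
          (WithLp 2 (L2 G (H ⊗[ℂ] V) × L2 G (H ⊗[ℂ] V)) →L[ℂ]
            WithLp 2 (L2 G (H ⊗[ℂ] V) × L2 G (H ⊗[ℂ] V))),
        (∀ f : G →₀ A, Rep (toCrossed α π f)
          = dsum (regRep α (ampl V π) f) (regRep α (ampl V π) f)) ∧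
        IsEvenSpectralTriple (smoothCrossed α π 𝒜 hα) Rep (diracOddToEven ℓ D) (dsum 1 (-1)) ∧
        (IsNondegenerate 𝒜 π D →
          IsNondegenerate (smoothCrossed α π 𝒜 hα) Rep (diracOddToEven ℓ D)) ∧
        (FinitelySummable D → PolynomialGrowth ℓ →
          FinitelySummable (diracOddToEven ℓ D) ∧
          abscissa (diracOddToEven ℓ D) ≤ abscissa D + growth ℓ ∧
          ((∃ L : ℝ, Tendsto (fun n : ℕ => Real.log (ball ℓ n).ncard / Real.log n) atTop (𝓝 L)) →
            abscissa (diracOddToEven ℓ D) = abscissa D + growth ℓ))) ∧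
    -- even to odd, with `H = Hp ⊕ Hm`, `π = πp ⊕ πm` and `D = (0 Dm; Dp 0)`
    (∀ (πp : A →⋆ₐ[ℂ] (Hp →L[ℂ] Hp)) (πm : A →⋆ₐ[ℂ] (Hm →L[ℂ] Hm))
      (Dp : Hp →ₗ.[ℂ] Hm) (Dm : Hm →ₗ.[ℂ] Hp),
      IsEvenSpectralTriple 𝒜 (repSum πp πm) (blockOp 0 Dm Dp 0) (dsum 1 (-1)) →
      Function.Injective (repSum πp πm) →
      UniformlyBounded α (repSum πp πm) 𝒜 (blockOp 0 Dm Dp 0) →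
      ∃ Rep : crossedProduct α (repSum πp πm) →⋆ₐ[ℂ]
          (WithLp 2 (L2 G (Hp ⊗[ℂ] V) × L2 G (Hm ⊗[ℂ] V)) →L[ℂ]
            WithLp 2 (L2 G (Hp ⊗[ℂ] V) × L2 G (Hm ⊗[ℂ] V))),
        (∀ f : G →₀ A, Rep (toCrossed α (repSum πp πm) f)
          = dsum (regRep α (ampl V πp) f) (regRep α (ampl V πm) f)) ∧
        IsSpectralTriple (smoothCrossed α (repSum πp πm) 𝒜 hα) Rep (diracEvenToOdd ℓ Dp Dm) ∧
        (IsNondegenerate 𝒜 (repSum πp πm) (blockOp 0 Dm Dp 0) →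
          IsNondegenerate (smoothCrossed α (repSum πp πm) 𝒜 hα) Rep (diracEvenToOdd ℓ Dp Dm)) ∧
        (FinitelySummable (blockOp 0 Dm Dp 0) → PolynomialGrowth ℓ →
          FinitelySummable (diracEvenToOdd ℓ Dp Dm) ∧
          abscissa (diracEvenToOdd ℓ Dp Dm) ≤ abscissa (blockOp 0 Dm Dp 0) + growth ℓ ∧
          ((∃ L : ℝ, Tendsto (fun n : ℕ => Real.log (ball ℓ n).ncard / Real.log n) atTop (𝓝 L)) →
            abscissa (diracEvenToOdd ℓ Dp Dm) = abscissa (blockOp 0 Dm Dp 0) + growth ℓ))) := by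

  refine ⟨fun π D hD hπ hub => ?_, fun πp πm Dp Dm hD hπ hub => ?_⟩
  -- `A ≠ 0` and faithfulness force a nonzero Hilbert space; equality of abscissas needs at least
  -- one eigenvector of `D²`.
  · have hX := nontrivial_of_injective hπ
    have hX' : Nontrivial (WithLp 2 (H × H)) :=
      (WithLp.toLp_injective 2).nontrivial
    have hT := isDiracModel_oddToEven ℓ D
    have hJ := isAnticommuting_rotation D
    obtain ⟨hsa, hc, -⟩ := double_properties hD.isSelfAdjoint hD.compact
    have hcomm := repSum_mul_rotation π
    have hinj : Function.Injective (repSum π π) := fun a b h => hπ <| by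
      ext x
      exact congrArg (fun S => (S (inlL H H x)).fst) h
    obtain ⟨Rep, hRinj, hRep⟩ := exists_multiple_rep (π₀ := π) (π := repSum π π)
      -- The crossed product is built from `π` on `H`, whereas the model lives over `H ⊕ H`; the two
      -- inclusions provide the two copies.
      (sumUnitary H H G V) α (fun k : Bool => if k then inlL H H else inrL H H)
      (by
        rintro (_ | _) (_ | _) <;>
          simp only [if_true, if_false, adjoint_inlL, adjoint_inrL, Bool.false_eq_true] <;> rfl)
      (by
        rw [Fintype.sum_bool]
        simp only [if_true, if_false, adjoint_inlL, adjoint_inrL, Bool.false_eq_true]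
        ext1 x
        exact inlL_add_inrL x)
      (by
        rintro (_ | _) a x
        · exact prod_ext (map_zero (π a)) rfl
        · exact prod_ext rfl (map_zero (π a)))
    have hRep' := fun f => (hRep f).trans (dsum_regRep α π π f).symm
    refine ⟨Rep, hRep', ⟨hT.isSpectralTriple hJ hsa hc hℓp hℓb hcomm hα hD.dense hub.double hRep,
      adjoint_dsum_one_neg_one, ?_, commute_of_toCrossed fun f => ?_,
      grading_of_isAnticommuting (isAnticommuting_dsum _ _)⟩, fun hnd => ?_, fun hfs hpg => ?_⟩
    · ext1 x
      exact prod_ext rfl (neg_neg x.snd)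
    · rw [hRep', dsum_mul_dsum]
    · exact hT.isNondegenerate hJ hsa hℓp hcomm hinj hα
        (fun a ha h => (hnd.2 a ha).1 (isCommutator_of_double h)) hRinj hRep
    · rw [← abscissa_double hD.isSelfAdjoint hD.compact]
      exact hT.summability hJ hsa hc hℓp
        (finitelySummable_double hD.isSelfAdjoint hD.compact hfs) hpg
  · have hX := nontrivial_of_injective hπ
    have hT := isDiracModel_evenToOdd ℓ Dp Dm
    have hJ := isAnticommuting_dsum Dm Dp
    have hcomm := repSum_mul_dsum πp πm
    obtain ⟨Rep, hRinj, hRep⟩ := exists_multiple_rep (π₀ := repSum πp πm) (π := repSum πp πm)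
      -- Here the crossed product is already built on `H⁺ ⊕ H⁻`, so a single copy suffices,
      -- multiplied only by the dimension of `V`.
      (sumUnitary Hp Hm G V) α (fun _ : Unit => 1)
      (fun _ _ => by rw [if_pos rfl, ContinuousLinearMap.adjoint_one]; rfl)
      (by rw [Fintype.sum_unique, ContinuousLinearMap.adjoint_one]; rfl)
      (fun _ _ _ => rfl)
    refine ⟨Rep, fun f => (hRep f).trans (dsum_regRep α πp πm f).symm,
      hT.isSpectralTriple hJ hD.isSelfAdjoint hD.compact hℓp hℓb hcomm hα hD.dense hub hRep,
      fun hnd => ?_, fun hfs hpg => ?_⟩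
    · exact hT.isNondegenerate hJ hD.isSelfAdjoint hℓp hcomm hπ hα
        (fun a ha h => (hnd.2 a ha).1 h) hRinj hRep
    · exact hT.summability hJ hD.isSelfAdjoint hD.compact hℓp hfs hpg
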